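/- Let $\mathbb{DH}$ denote the real algebra of dual quaternions (dimension $8$ over $\mathbb R$). Let $L=(h_1,\dots,h_6)$ be a closed 6R linkage, i.e. $h_1,\dots,h_6\in\mathbb{DH}$ with $h_i^2=-1$ and $h_i\neq\pm h_{i+1}$ for all $i$ (indices modulo $6$). Its configuration set $K\subset(\mathbb P^1_{\mathbb R})^6$ is the set of all $(t_1,\dots,t_6)$ with $(t_1-h_1)(t_2-h_2)\cdots(t_6-h_6)\in\mathbb R^*$ (in homogeneous coordinates $t_i=(x_i:y_i)$ the factor $t_i-h_i$ is read as $x_i-y_ih_i$). Assume that $L$ has mobility one, i.e. $\dim K=1$, and that the Zariski closure $K_{\mathbb C}\subset(\mathbb P^1_{\mathbb C})^6$ of $K$ has exactly one irreducible component of dimension one; let $N(K)$ be the normalization of this component. Let $B$ be the set of all $(t_1,\dots,t_6)\in K_{\mathbb C}$ with $(t_1-h_1)\cdots(t_6-h_6)=0$. A bond is a point $\beta\in N(K)$ lying over a point of $B$. For a bond $\beta$ and $0\le i\le j\le 6$ let $v_\beta(i,j)$ be the vanishing order at $\beta$ of $F_{i,j}=(t_{i+1}-h_{i+1})\cdots(t_j-h_j)$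 (with homogeneous coordinates of the $t_k$ that are regular and not both zero at $\beta$), and let $$k_\beta(i,j)=v_\beta(i,j-1)+v_\beta(i-1,j)-v_\beta(i,j)-v_\beta(i-1,j-1)\qquad(1\le i<j\le 6)$$ be the connection number. A bond $\beta$ lying over $(t_1,\dots,t_6)$ connects $h_i$ and $h_j$ if $t_i,t_j$ are exactly the coordinates of value $\pm\mathrm i$, or, in general, if $k_\beta(i,j)\neq0$; its multiplicity (as a bond connecting $h_i$ and $h_j$) is $k_\beta(i,j)$. For joints $h_i,h_{i+1},h_{i+2}$ let $l_{i,i+1,i+2}$ be the dimension of the real linear span in $\mathbb{DH}$ of all products $h_{k_1}\cdots h_{k_s}$ with $i\le k_1<\dots<k_s\le i+2$ (including the empty product $1$). Assume that $l_{1,2,3}=l_{4,5,6}=8$, and fix $\tau_1,\tau_4\in\{+\mathrm i,-\mathrm i\}$. Then there are at most two bonds connecting $h_1$ and $h_4$ that lie over points $(t_1,\dots,t_6)$ with $t_1=\tau_1$ and $t_4=\tau_4$, counted with multiplicity: there are only finitely many such bonds $\beta$, each satisfies $k_\beta(1,4)\ge1$, and $$\sum_\beta k_\beta(1,4)\le 2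 .$$ -/

import Mathlib

open scoped Quaternion LinearAlgebra.Projectivization

noncomputable section

namespace Linkage

/-! ### Dual quaternions -/

/-- Dual quaternions with coefficients in a commutative ring `A`, that is `𝔻ℍ ⊗ A`: the quaternions
over the dual numbers `A[ε]`. For `A = ℝ` this is the algebra `𝔻ℍ`, of real dimension eight. -/
abbrev DualQuat (A : Type*) [CommRing A] : Type _ := Quaternion (DualNumber A)

/-- The eight coordinates of a dual quaternion (primal and dual part of each component). -/
def DualQuat.coords {A : Type*} [CommRing A] (q : DualQuat A) : Fin 8 → A :=
  ![q.re.fst, q.re.snd, q.imI.fst, q.imI.snd, q.imJ.fst, q.imJ.snd, q.imK.fst, q.imK.snd]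

/-- Coefficient extension `𝔻ℍ ⊗ A → 𝔻ℍ ⊗ A'` along a ring homomorphism `A → A'`. -/
def DualQuat.baseChange {A A' : Type*} [CommRing A] [CommRing A'] (φ : A →+* A')
    (q : DualQuat A) : DualQuat A' :=
  ⟨(φ q.re.fst, φ q.re.snd), (φ q.imI.fst, φ q.imI.snd),
    (φ q.imJ.fst, φ q.imJ.snd), (φ q.imK.fst, φ q.imK.snd)⟩

/-- A closed `n`R linkage `(h_1, …, h_n)` (indexed from `0`, cyclically): each `h_i` is a line,
`h_i² = -1`, and cyclically consecutive lines are distinct, `h_i ≠ ± h_{i+1}`. -/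
structure IsLinkage {n : ℕ} [NeZero n] (h : Fin n → DualQuat ℝ) : Prop where
  sq_eq : ∀ i, h i * h i = -1
  ne_next : ∀ i, h i ≠ h (i + 1)
  ne_neg_next : ∀ i, h i ≠ -h (i + 1)

/-- The coupling space of a sequence of joints: the real span of all products
`h_{k_1} ⋯ h_{k_s}` with `k_1 < ⋯ < k_s` (the empty product being `1`). -/
def couplingSpace (L : List (DualQuat ℝ)) : Submodule ℝ (DualQuat ℝ) :=
  Submodule.span ℝ {x | ∃ l : List (DualQuat ℝ), l.Sublist L ∧ l.prod = x}

/-- The coupling dimension. -/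
def couplingDim (L : List (DualQuat ℝ)) : ℕ := Module.finrank ℝ (couplingSpace L)

/-- With homogeneous coordinates `v k = (v k 0 : v k 1)` for the rotation parameter of joint `k`
(so `t_k = v k 0 / v k 1`, and `t_k = ∞` iff `v k 1 = 0`), the product
`(t_{i+1} - h_{i+1}) ⋯ (t_j - h_j)` over the joints number `i+1, …, j` (joint number `m` has
index `m - 1` in `Fin n`), with the factor `t - h` homogenized to `v k 0 - v k 1 * h`. -/
def chain {A : Type*} [CommRing A] (φ : ℝ →+* A) {n : ℕ} (h : Fin n → DualQuat ℝ)
    (v : Fin n → Fin 2 → A) (i j : ℕ) : DualQuat A :=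
  ((((List.finRange n).take j).drop i).map fun k =>
    v k 0 • (1 : DualQuat A) - v k 1 • DualQuat.baseChange φ (h k)).prod

/-! ### The Zariski topology on `(ℙ¹_ℂ)ⁿ` -/

/-- The complex variety `(ℙ¹_ℂ)ⁿ`. -/
def P1Pow (n : ℕ) : Type := Fin n → ℙ ℂ (Fin 2 → ℂ)

/-- All tuples of homogeneous coordinate vectors of the points of `C ⊆ (ℙ¹)ⁿ`. -/
def cone {n : ℕ} (C : Set (P1Pow n)) : Set (Fin n × Fin 2 → ℂ) :=
  {v | ∃ hv : ∀ i, (fun j => v (i, j)) ≠ 0,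
    (fun i => Projectivization.mk ℂ (fun j => v (i, j)) (hv i) : P1Pow n) ∈ C}

/-- The set of points at which a polynomial in the homogeneous coordinates is not identically
zero on all coordinate vectors of the point; for a multihomogeneous polynomial this is the
usual basic open set. -/
def basicOpen {n : ℕ} (f : MvPolynomial (Fin n × Fin 2) ℂ) : Set (P1Pow n) :=
  {p | ∃ v ∈ cone {p}, MvPolynomial.aeval v f ≠ 0}

/-- The Zariski topology on `(ℙ¹_ℂ)ⁿ`. -/
instance zariski (n : ℕ) : TopologicalSpace (P1Pow n) :=
  TopologicalSpace.generateFrom (Set.range basicOpen)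

/-- The ideal of all polynomials in the homogeneous coordinates that vanish on `C`. -/
def coneIdeal {n : ℕ} (C : Set (P1Pow n)) : Ideal (MvPolynomial (Fin n × Fin 2) ℂ) :=
  MvPolynomial.vanishingIdeal ℂ (cone C)

theorem coneIdeal_isPrime {n : ℕ} {C : Set (P1Pow n)} (hC : IsIrreducible C) :
    (coneIdeal C).IsPrime := by
  have key : ∀ f : MvPolynomial (Fin n × Fin 2) ℂ, f ∉ coneIdeal C →
      (C ∩ basicOpen f).Nonempty := by
    intro f hf
    simp only [coneIdeal, MvPolynomial.mem_vanishingIdeal_iff, not_forall] at hf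
    obtain ⟨v, ⟨hv, hvC⟩, hfv⟩ := hf
    exact ⟨_, hvC, v, ⟨hv, rfl⟩, hfv⟩
  have hopen : ∀ f : MvPolynomial (Fin n × Fin 2) ℂ, IsOpen (basicOpen f) :=
    fun f => TopologicalSpace.isOpen_generateFrom_of_mem ⟨f, rfl⟩
  refine ⟨?_, ?_⟩
  · rw [Ideal.ne_top_iff_one]
    intro h1
    obtain ⟨p, hp⟩ := hC.1
    have h2 := h1 (fun x => (p x.1).rep x.2)
      ⟨fun i => (p i).rep_nonzero, by
        have h3 : (fun i => Projectivization.mk ℂ (p i).rep (p i).rep_nonzero) = p :=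
          funext fun i => Projectivization.mk_rep _
        exact (congrArg (· ∈ C) h3).mpr hp⟩
    simp at h2
  · intro f g hfg
    by_contra! hcon
    obtain ⟨p, hpC, ⟨v, ⟨hv, hvp⟩, hfv⟩, ⟨w, ⟨hw, hwp⟩, hgw⟩⟩ :=
      hC.2 _ _ (hopen f) (hopen g) (key f hcon.1) (key g hcon.2)
    replace hvp : (fun i => Projectivization.mk ℂ (fun j => v (i, j)) (hv i)) = p := hvp
    replace hwp : (fun i => Projectivization.mk ℂ (fun j => w (i, j)) (hw i)) = p := hwp
    have hc : ∀ i, ∃ c : ℂ, (fun j => w (i, j)) = fun j => c * v (i, j) := by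
      intro i
      have h1 := congrFun (hwp.trans hvp.symm) i
      rw [Projectivization.mk_eq_mk_iff'] at h1
      obtain ⟨c, hc⟩ := h1
      exact ⟨c, hc.symm⟩
    choose c hc using hc
    let T : MvPolynomial (Fin n × Fin 2) ℂ → MvPolynomial (Fin n) ℂ := fun q =>
      MvPolynomial.aeval (fun x : Fin n × Fin 2 => MvPolynomial.X x.1 * MvPolynomial.C (v x)) q
    have hT : ∀ (q) (d : Fin n → ℂ), MvPolynomial.aeval d (T q) =
        MvPolynomial.aeval (fun x => d x.1 * v x) q := by
      intro q d
      simp only [T, MvPolynomial.aeval_eq_bind₁, MvPolynomial.aeval_bind₁]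
      congr 2
      funext x
      simp
    have hTf : T f ≠ 0 := by
      intro h0
      have := hT f 1
      rw [h0] at this
      simp only [map_zero, Pi.one_apply, one_mul] at this
      exact hfv this.symm
    have hTg : T g ≠ 0 := by
      intro h0
      have := hT g c
      rw [h0, map_zero] at this
      apply hgw
      rw [this]
      congr 2
      funext x
      exact congrFun (hc x.1) x.2
    have hX : (∏ i : Fin n, (MvPolynomial.X i : MvPolynomial (Fin n) ℂ)) ≠ 0 :=
      Finset.prod_ne_zero_iff.2 fun i _ => MvPolynomial.X_ne_zero i
    obtain ⟨d, hd⟩ : ∃ d : Fin n → ℂ,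
        MvPolynomial.eval d (T f * T g * ∏ i, MvPolynomial.X i) ≠ 0 := by
      by_contra! h0
      exact mul_ne_zero (mul_ne_zero hTf hTg) hX (MvPolynomial.funext fun x => by simpa using h0 x)
    simp only [map_mul, map_prod, MvPolynomial.eval_X, mul_ne_zero_iff,
      Finset.prod_ne_zero_iff] at hd
    obtain ⟨⟨hdf, hdg⟩, hd0⟩ := hd
    have hmem : (fun x : Fin n × Fin 2 => d x.1 * v x) ∈ cone C := by
      have hne : ∀ i, (fun j => d i * v (i, j)) ≠ 0 := by
        intro i h0
        refine hv i (funext fun j => ?_)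
        have := congrFun h0 j
        simpa [hd0 i (Finset.mem_univ i)] using this
      refine ⟨hne, ?_⟩
      have h3 : (fun i => Projectivization.mk ℂ (fun j => d i * v (i, j)) (hne i)) = p := by
        rw [← hvp]
        funext i
        rw [Projectivization.mk_eq_mk_iff']
        exact ⟨d i, rfl⟩
      exact h3 ▸ hpC
    have := hfg _ hmem
    rw [map_mul, ← hT, ← hT] at this
    rcases mul_eq_zero.1 this with h0 | h0
    · exact hdf (by simpa [MvPolynomial.aeval_eq_eval] using h0)
    · exact hdg (by simpa [MvPolynomial.aeval_eq_eval] using h0)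

/-! ### Configuration set and configuration curve -/

/-- The inclusion `ℙ¹_ℝ ⊆ ℙ¹_ℂ`. -/
def toComplex (p : ℙ ℝ (Fin 2 → ℝ)) : ℙ ℂ (Fin 2 → ℂ) :=
  Projectivization.mk ℂ (fun j => (p.rep j : ℂ)) fun h0 =>
    p.rep_nonzero (funext fun j => Complex.ofReal_eq_zero.1 (congrFun h0 j))

/-- The configuration set `K ⊆ (ℙ¹_ℝ)ⁿ`: the tuples satisfying the closure condition
`(t_1 - h_1) ⋯ (t_n - h_n) ∈ ℝ^*`. -/
def configSet {n : ℕ} (h : Fin n → DualQuat ℝ) : Set (Fin n → ℙ ℝ (Fin 2 → ℝ)) :=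
  {p | ∃ r : ℝ, r ≠ 0 ∧ chain (RingHom.id ℝ) h (fun k => (p k).rep) 0 n = r • (1 : DualQuat ℝ)}

/-- The Zariski closure `K_ℂ ⊆ (ℙ¹_ℂ)ⁿ` of the configuration set. -/
def configClosure {n : ℕ} (h : Fin n → DualQuat ℝ) : Set (P1Pow n) :=
  closure ((fun (p : Fin n → ℙ ℝ (Fin 2 → ℝ)) => (fun i => toComplex (p i) : P1Pow n)) ''
    configSet h)

/-- The mobility of the linkage: the dimension of the configuration set. -/
def mobility {n : ℕ} (h : Fin n → DualQuat ℝ) : WithBot ℕ∞ := topologicalKrullDim (configClosure h)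

/-- A one-dimensional irreducible component of `K_ℂ`. -/
structure ConfigCurve {n : ℕ} (h : Fin n → DualQuat ℝ) where
  carrier : Set (P1Pow n)
  isComponent : Maximal (fun s => IsIrreducible s ∧ s ⊆ configClosure h) carrier
  dim_eq : topologicalKrullDim carrier = 1

namespace ConfigCurve

variable {n : ℕ} {h : Fin n → DualQuat ℝ} (K : ConfigCurve h)

/-- The multihomogeneous coordinate ring of the curve. -/
abbrev CoordRing : Type := MvPolynomial (Fin n × Fin 2) ℂ ⧸ coneIdeal K.carrier

instance : (coneIdeal K.carrier).IsPrime := coneIdeal_isPrime K.isComponent.1.1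

/-- The fraction field of the multihomogeneous coordinate ring. -/
abbrev ConeField : Type := FractionRing K.CoordRing

/-- The homogeneous coordinate functions on the curve: `x i 0` and `x i 1` are the two homogeneous
coordinates of the `i`-th factor. -/
def x (i : Fin n) (j : Fin 2) : K.ConeField :=
  algebraMap K.CoordRing K.ConeField (Ideal.Quotient.mk _ (MvPolynomial.X (i, j)))

/-- The field of rational functions of the curve, generated by the coordinate functions
`t_i = x i 0 / x i 1` (for those `i` for which `t_i` is not constantly `∞`; otherwise the
quotient is `0` here). -/
def functionField : IntermediateField ℂ K.ConeField :=
  IntermediateField.adjoin ℂ (Set.range fun i => K.x i 0 / K.x i 1)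

/-- The coordinate function `t_i` as a rational function on the curve. -/
def t (i : Fin n) : K.functionField :=
  ⟨K.x i 0 / K.x i 1, IntermediateField.subset_adjoin _ _ ⟨i, rfl⟩⟩

/-- The points of the normalization `N(K)`: the places of the function field over `ℂ`, i.e. the
valuation rings `ℂ ⊆ R ⊊ ℂ(K)`. -/
structure NPoint where
  ring : ValuationSubring K.functionField
  const_mem : ∀ z : ℂ, algebraMap ℂ K.functionField z ∈ ring
  ne_top : ring ≠ ⊤

end ConfigCurve

namespace ConfigCurve.NPoint

variable {n : ℕ} {h : Fin n → DualQuat ℝ} {K : ConfigCurve h} (β : K.NPoint)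

open Classical in
/-- Homogeneous coordinates of `t_i ∈ ℙ¹` that are regular and not both zero at `β`. -/
def localCoord (i : Fin n) : Fin 2 → K.functionField :=
  if K.x i 1 = 0 then ![1, 0]
  else if K.t i ∈ β.ring then ![K.t i, 1] else ![1, (K.t i)⁻¹]

/-- `β` lies over the point `p`: modulo the maximal ideal of `β`, the homogeneous coordinate
vectors of `t_i` and of `p i` are proportional for every `i`. -/
def LiesOver (p : P1Pow n) : Prop :=
  ∀ i, algebraMap ℂ K.functionField ((p i).rep 0) * β.localCoord i 1 -
    algebraMap ℂ K.functionField ((p i).rep 1) * β.localCoord i 0 ∈ β.ring.nonunits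

/-- The vanishing order at `β` of a dual quaternion valued function regular at `β`: the largest
`m` such that all coordinates lie in the `m`-th power of the maximal ideal. -/
def order (q : DualQuat K.functionField) : ℕ :=
  sSup {m : ℕ | ∀ c : Fin 8, ∃ y ∈ (IsLocalRing.maximalIdeal β.ring) ^ m,
    (y : K.functionField) = q.coords c}

/-- The vanishing order `v_β(i,j)` of `F_{i,j} = (t_{i+1} - h_{i+1}) ⋯ (t_j - h_j)` at `β`. -/
def v (i j : ℕ) : ℕ :=
  β.order (chain ((algebraMap ℂ K.functionField).comp Complex.ofRealHom) h β.localCoord i j)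

/-- The connection number
`k_β(i,j) = v_β(i,j-1) + v_β(i-1,j) - v_β(i,j) - v_β(i-1,j-1)` of the joints number `i < j`.
Here the joint number `i` is given by its index in `Fin n`, which is `i - 1`. -/
def connectionNumber (i j : Fin n) : ℤ :=
  (β.v (i + 1) j : ℤ) + β.v i (j + 1) - β.v (i + 1) (j + 1) - β.v i j

end ConfigCurve.NPoint

/-- The set `B ⊆ K_ℂ` of all points with `(t_1 - h_1) ⋯ (t_n - h_n) = 0`. -/
def bondLocus {n : ℕ} (h : Fin n → DualQuat ℝ) : Set (P1Pow n) :=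
  {p | p ∈ configClosure h ∧ chain Complex.ofRealHom h (fun k => (p k).rep) 0 n = 0}

/-- The point of `ℙ¹_ℂ` with affine coordinate `z`. -/
def affinePt (z : ℂ) : ℙ ℂ (Fin 2 → ℂ) :=
  Projectivization.mk ℂ ![z, 1] fun h0 => one_ne_zero (congrFun h0 1)

namespace ConfigCurve.NPoint

variable {n : ℕ} {h : Fin n → DualQuat ℝ} {K : ConfigCurve h} (β : K.NPoint)

/-- `β` is a bond lying over the point `p = (t_1, …, t_n)`. -/
def IsBondOver (p : P1Pow n) : Prop := p ∈ bondLocus h ∧ β.LiesOver p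

/-- The bond `β`, lying over `p`, connects the joints `i` and `j`: the `i`-th and the `j`-th are
exactly the coordinates of `p` with values `± i`, or, in general, the connection number
`k_β(i,j)` does not vanish. -/
def Connects (p : P1Pow n) (i j : Fin n) : Prop :=
  (∀ k, (p k = affinePt Complex.I ∨ p k = affinePt (-Complex.I)) ↔ (k = i ∨ k = j)) ∨
    β.connectionNumber i j ≠ 0

end ConfigCurve.NPoint

/-- The bonds connecting the joints `i` and `j` with prescribed values `t_i = a`, `t_j = b`. -/
def connectingBonds {n : ℕ} {h : Fin n → DualQuat ℝ} (K : ConfigCurve h) (i j : Fin n) (a b : ℂ) :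
    Set K.NPoint :=
  {β | ∃ p : P1Pow n, β.IsBondOver p ∧ β.Connects p i j ∧ p i = affinePt a ∧ p j = affinePt b}

end Linkage

end

noncomputable section

namespace Linkage

/-! ### Coordinates of dual quaternions -/

namespace DualQuat

variable {A B : Type*} [CommRing A] [CommRing B]

theorem ext_coords {p q : DualQuat A} (h : ∀ c, p.coords c = q.coords c) : p = q := by
  have h0 := h 0; have h1 := h 1; have h2 := h 2; have h3 := h 3
  have h4 := h 4; have h5 := h 5; have h6 := h 6; have h7 := h 7
  simp only [coords, Matrix.cons_val] at h0 h1 h2 h3 h4 h5 h6 h7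
  refine QuaternionAlgebra.ext ?_ ?_ ?_ ?_ <;> refine TrivSqZeroExt.ext ?_ ?_ <;> assumption

theorem coords_add (p q : DualQuat A) (c : Fin 8) :
    (p + q).coords c = p.coords c + q.coords c := by
  fin_cases c <;> simp [coords]

theorem coords_neg (q : DualQuat A) (c : Fin 8) : (-q).coords c = -q.coords c := by
  fin_cases c <;> simp [coords]

theorem coords_smul (x : A) (q : DualQuat A) (c : Fin 8) :
    (x • q).coords c = x * q.coords c := by
  fin_cases c <;> simp [coords]

theorem coords_zero (c : Fin 8) : (0 : DualQuat A).coords c = 0 := by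
  fin_cases c <;> simp [coords]

theorem coords_one : (1 : DualQuat A).coords = ![1, 0, 0, 0, 0, 0, 0, 0] := by
  funext c; fin_cases c <;> simp [coords]

theorem coords_star (q : DualQuat A) (c : Fin 8) :
    (star q).coords c = if c < 2 then q.coords c else -q.coords c := by
  fin_cases c <;> simp [coords]

theorem coords_baseChange (φ : A →+* B) (q : DualQuat A) (c : Fin 8) :
    (baseChange φ q).coords c = φ (q.coords c) := by
  fin_cases c <;> rfl

theorem coords_mul (p q : DualQuat A) : (p * q).coords =
    ![p.coords 0 * q.coords 0 - p.coords 2 * q.coords 2 - p.coords 4 * q.coords 4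
        - p.coords 6 * q.coords 6,
      p.coords 0 * q.coords 1 + p.coords 1 * q.coords 0
        - (p.coords 2 * q.coords 3 + p.coords 3 * q.coords 2)
        - (p.coords 4 * q.coords 5 + p.coords 5 * q.coords 4)
        - (p.coords 6 * q.coords 7 + p.coords 7 * q.coords 6),
      p.coords 0 * q.coords 2 + p.coords 2 * q.coords 0 + p.coords 4 * q.coords 6
        - p.coords 6 * q.coords 4,
      p.coords 0 * q.coords 3 + p.coords 1 * q.coords 2
        + (p.coords 2 * q.coords 1 + p.coords 3 * q.coords 0)
        + (p.coords 4 * q.coords 7 + p.coords 5 * q.coords 6)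
        - (p.coords 6 * q.coords 5 + p.coords 7 * q.coords 4),
      p.coords 0 * q.coords 4 - p.coords 2 * q.coords 6 + p.coords 4 * q.coords 0
        + p.coords 6 * q.coords 2,
      p.coords 0 * q.coords 5 + p.coords 1 * q.coords 4
        - (p.coords 2 * q.coords 7 + p.coords 3 * q.coords 6)
        + (p.coords 4 * q.coords 1 + p.coords 5 * q.coords 0)
        + (p.coords 6 * q.coords 3 + p.coords 7 * q.coords 2),
      p.coords 0 * q.coords 6 + p.coords 2 * q.coords 4 - p.coords 4 * q.coords 2
        + p.coords 6 * q.coords 0,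
      p.coords 0 * q.coords 7 + p.coords 1 * q.coords 6
        + (p.coords 2 * q.coords 5 + p.coords 3 * q.coords 4)
        - (p.coords 4 * q.coords 3 + p.coords 5 * q.coords 2)
        + (p.coords 6 * q.coords 1 + p.coords 7 * q.coords 0)] := by
  funext c
  fin_cases c <;>
    simp only [coords, Matrix.cons_val, Quaternion.re_mul, Quaternion.imI_mul, Quaternion.imJ_mul,
      Quaternion.imK_mul, TrivSqZeroExt.fst_add, TrivSqZeroExt.snd_add, TrivSqZeroExt.fst_sub,
      TrivSqZeroExt.snd_sub, TrivSqZeroExt.fst_mul, TrivSqZeroExt.snd_mul, smul_eq_mul,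
      MulOpposite.smul_eq_mul_unop, MulOpposite.unop_op, Fin.zero_eta, Fin.mk_one, Fin.reduceFinMk]

end DualQuat

/-- The algebra of dual quaternions as an opaque copy of `DualQuat A`, whose algebraic structure
is found through its ring, algebra and star instances only. -/
def DQ (A : Type*) [CommRing A] : Type _ := DualQuat A

namespace DQ

variable {A B : Type*} [CommRing A] [CommRing B]

instance : Ring (DQ A) := inferInstanceAs (Ring (DualQuat A))
instance : Algebra A (DQ A) := inferInstanceAs (Algebra A (DualQuat A))
instance : StarRing (DQ A) := inferInstanceAs (StarRing (DualQuat A))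

/-- The identification of the two copies. -/
def of : DualQuat A ≃ DQ A := Equiv.refl _

theorem of_add (p q : DualQuat A) : of (p + q) = of p + of q := rfl
theorem of_mul (p q : DualQuat A) : of (p * q) = of p * of q := rfl
theorem of_neg (q : DualQuat A) : of (-q) = -of q := rfl
theorem of_one : of (1 : DualQuat A) = 1 := rfl

/-- The eight coordinates. -/
def coords (q : DQ A) : Fin 8 → A := DualQuat.coords (of.symm q)

theorem coords_of (q : DualQuat A) : (of q).coords = q.coords := rfl

theorem ext_coords {p q : DQ A} (h : ∀ c, p.coords c = q.coords c) : p = q :=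
  DualQuat.ext_coords h

theorem coords_add (p q : DQ A) (c : Fin 8) : (p + q).coords c = p.coords c + q.coords c :=
  DualQuat.coords_add _ _ c

theorem coords_neg (q : DQ A) (c : Fin 8) : (-q).coords c = -q.coords c :=
  DualQuat.coords_neg _ c

theorem coords_smul (x : A) (q : DQ A) (c : Fin 8) : (x • q).coords c = x * q.coords c :=
  DualQuat.coords_smul x _ c

theorem coords_zero (c : Fin 8) : (0 : DQ A).coords c = 0 := DualQuat.coords_zero c

theorem coords_one : (1 : DQ A).coords = ![1, 0, 0, 0, 0, 0, 0, 0] := DualQuat.coords_one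

theorem coords_star (q : DQ A) (c : Fin 8) :
    (star q).coords c = if c < 2 then q.coords c else -q.coords c := DualQuat.coords_star _ c

theorem coords_mul (p q : DQ A) : (p * q).coords =
    ![p.coords 0 * q.coords 0 - p.coords 2 * q.coords 2 - p.coords 4 * q.coords 4
        - p.coords 6 * q.coords 6,
      p.coords 0 * q.coords 1 + p.coords 1 * q.coords 0
        - (p.coords 2 * q.coords 3 + p.coords 3 * q.coords 2)
        - (p.coords 4 * q.coords 5 + p.coords 5 * q.coords 4)
        - (p.coords 6 * q.coords 7 + p.coords 7 * q.coords 6),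
      p.coords 0 * q.coords 2 + p.coords 2 * q.coords 0 + p.coords 4 * q.coords 6
        - p.coords 6 * q.coords 4,
      p.coords 0 * q.coords 3 + p.coords 1 * q.coords 2
        + (p.coords 2 * q.coords 1 + p.coords 3 * q.coords 0)
        + (p.coords 4 * q.coords 7 + p.coords 5 * q.coords 6)
        - (p.coords 6 * q.coords 5 + p.coords 7 * q.coords 4),
      p.coords 0 * q.coords 4 - p.coords 2 * q.coords 6 + p.coords 4 * q.coords 0
        + p.coords 6 * q.coords 2,
      p.coords 0 * q.coords 5 + p.coords 1 * q.coords 4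
        - (p.coords 2 * q.coords 7 + p.coords 3 * q.coords 6)
        + (p.coords 4 * q.coords 1 + p.coords 5 * q.coords 0)
        + (p.coords 6 * q.coords 3 + p.coords 7 * q.coords 2),
      p.coords 0 * q.coords 6 + p.coords 2 * q.coords 4 - p.coords 4 * q.coords 2
        + p.coords 6 * q.coords 0,
      p.coords 0 * q.coords 7 + p.coords 1 * q.coords 6
        + (p.coords 2 * q.coords 5 + p.coords 3 * q.coords 4)
        - (p.coords 4 * q.coords 3 + p.coords 5 * q.coords 2)
        + (p.coords 6 * q.coords 1 + p.coords 7 * q.coords 0)] := DualQuat.coords_mul _ _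

theorem coords_sub (p q : DQ A) (c : Fin 8) : (p - q).coords c = p.coords c - q.coords c := by
  rw [sub_eq_add_neg, coords_add, coords_neg, sub_eq_add_neg]

/-- The dual quaternion with given coordinates. -/
def ofCoords (v : Fin 8 → A) : DQ A := of ⟨(v 0, v 1), (v 2, v 3), (v 4, v 5), (v 6, v 7)⟩

theorem coords_ofCoords (v : Fin 8 → A) : (ofCoords v).coords = v := by
  funext c; fin_cases c <;> rfl

theorem ofCoords_coords (q : DQ A) : ofCoords q.coords = q :=
  ext_coords fun c => by rw [coords_ofCoords]

/-- The coordinates as a linear equivalence. -/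
def coordsEquiv (A : Type*) [CommRing A] : DQ A ≃ₗ[A] (Fin 8 → A) where
  toFun := coords
  invFun := ofCoords
  map_add' p q := funext (coords_add p q)
  map_smul' x q := funext (coords_smul x q)
  left_inv := ofCoords_coords
  right_inv := coords_ofCoords

theorem coords_sum {ι : Type*} (s : Finset ι) (f : ι → DQ A) (c : Fin 8) :
    (∑ i ∈ s, f i).coords c = ∑ i ∈ s, (f i).coords c := by
  rw [← Finset.sum_apply]
  exact congrFun (map_sum (coordsEquiv A) f s) c

/-- Coefficient extension as a ring homomorphism. -/
def map (φ : A →+* B) : DQ A →+* DQ B where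
  toFun q := ofCoords fun c => φ (q.coords c)
  map_one' := ext_coords fun c => by
    rw [coords_ofCoords, coords_one, coords_one]
    fin_cases c <;> simp
  map_zero' := ext_coords fun c => by
    rw [coords_ofCoords, coords_zero, coords_zero, map_zero]
  map_add' p q := ext_coords fun c => by
    rw [coords_ofCoords, coords_add, coords_add, coords_ofCoords, coords_ofCoords, map_add]
  map_mul' p q := ext_coords fun c => by
    rw [coords_ofCoords, coords_mul, coords_mul, coords_ofCoords, coords_ofCoords]
    generalize p.coords = v
    generalize q.coords = w
    fin_cases c <;> simp

theorem coords_map (φ : A →+* B) (q : DQ A) (c : Fin 8) :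
    (map φ q).coords c = φ (q.coords c) := congrFun (coords_ofCoords _) c

theorem of_baseChange (φ : A →+* B) (q : DualQuat A) :
    of (DualQuat.baseChange φ q) = map φ (of q) :=
  ext_coords fun c => by rw [coords_map, coords_of, coords_of, DualQuat.coords_baseChange]

theorem of_smul (x : A) (q : DualQuat A) : of (x • q) = x • of q :=
  ext_coords fun c => by rw [coords_smul, coords_of, coords_of, DualQuat.coords_smul]

theorem map_smul (φ : A →+* B) (x : A) (q : DQ A) : map φ (x • q) = φ x • map φ q :=
  ext_coords fun c => by simp only [coords_map, coords_smul, _root_.map_mul]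

theorem map_star (φ : A →+* B) (q : DQ A) : map φ (star q) = star (map φ q) :=
  ext_coords fun c => by
    rw [coords_map, coords_star, coords_star, apply_ite φ, coords_map, map_neg]

theorem map_map {C : Type*} [CommRing C] (φ : A →+* B) (ψ : B →+* C) (q : DQ A) :
    map ψ (map φ q) = map (ψ.comp φ) q :=
  ext_coords fun c => by simp only [coords_map, RingHom.comp_apply]

theorem map_injective {φ : A →+* B} (hφ : Function.Injective φ) :
    Function.Injective (map φ) := fun p q h => ext_coords fun c => hφ <| by
  rw [← coords_map, ← coords_map, h]

theorem star_smul (x : A) (q : DQ A) : star (x • q) = x • star q :=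
  ext_coords fun c => by
    rw [coords_smul, coords_star, coords_star, mul_ite, coords_smul, mul_neg]

end DQ

/-! ### Primal parts, units and commutators -/

namespace DQ

variable {A B : Type*} [CommRing A] [CommRing B]

/-- The dual unit as a dual quaternion. -/
def eps (A : Type*) [CommRing A] : DQ A := ofCoords ![0, 1, 0, 0, 0, 0, 0, 0]

theorem coords_eps_mul (q : DQ A) : (eps A * q).coords =
    ![0, q.coords 0, 0, q.coords 2, 0, q.coords 4, 0, q.coords 6] := by
  rw [coords_mul, eps, coords_ofCoords]
  generalize q.coords = v
  funext c; fin_cases c <;> simp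

theorem coords_mul_eps (q : DQ A) : (q * eps A).coords =
    ![0, q.coords 0, 0, q.coords 2, 0, q.coords 4, 0, q.coords 6] := by
  rw [coords_mul, eps, coords_ofCoords]
  generalize q.coords = v
  funext c; fin_cases c <;> simp

theorem eps_mul_comm (q : DQ A) : eps A * q = q * eps A := by
  refine ext_coords fun c => ?_
  rw [coords_eps_mul, coords_mul_eps]

theorem eps_mul_eps : eps A * eps A = 0 := by
  refine ext_coords fun c => ?_
  rw [coords_eps_mul, coords_zero, eps, coords_ofCoords]
  fin_cases c <;> simp

theorem map_eps (φ : A →+* B) : map φ (eps A) = eps B := by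
  refine ext_coords fun c => ?_
  rw [coords_map, eps, eps, coords_ofCoords, coords_ofCoords]
  fin_cases c <;> simp

theorem eps_mul_eq_zero_iff {q : DQ A} : eps A * q = 0 ↔
    q.coords 0 = 0 ∧ q.coords 2 = 0 ∧ q.coords 4 = 0 ∧ q.coords 6 = 0 := by
  constructor
  · intro h
    have h1 : (eps A * q).coords = 0 := funext fun c => by rw [h, coords_zero]; rfl
    rw [coords_eps_mul] at h1
    exact ⟨congrFun h1 1, congrFun h1 3, congrFun h1 5, congrFun h1 7⟩
  · rintro ⟨h0, h2, h4, h6⟩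
    refine ext_coords fun c => ?_
    rw [coords_eps_mul, coords_zero, h0, h2, h4, h6]
    fin_cases c <;> rfl

theorem exists_eq_eps_mul {q : DQ A} (h : eps A * q = 0) : ∃ m, q = eps A * m := by
  obtain ⟨h0, h2, h4, h6⟩ := eps_mul_eq_zero_iff.1 h
  have key : ∀ v : Fin 8 → A, v 0 = 0 → v 2 = 0 → v 4 = 0 → v 6 = 0 →
      ∃ w : Fin 8 → A, v = ![0, w 0, 0, w 2, 0, w 4, 0, w 6] := by
    intro v h0 h2 h4 h6
    refine ⟨![v 1, 0, v 3, 0, v 5, 0, v 7, 0], ?_⟩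
    funext c
    fin_cases c <;> simp [h0, h2, h4, h6]
  obtain ⟨w, hw⟩ := key q.coords h0 h2 h4 h6
  refine ⟨ofCoords w, ext_coords fun c => ?_⟩
  rw [coords_eps_mul, coords_ofCoords, hw]

/-- A real dual quaternion with nonzero primal part is invertible. -/
theorem isUnit_of_eps_mul_ne_zero {q : DQ ℝ} (h : eps ℝ * q ≠ 0) : IsUnit q := by
  set n : ℝ := q.coords 0 ^ 2 + q.coords 2 ^ 2 + q.coords 4 ^ 2 + q.coords 6 ^ 2 with hn
  set d : ℝ := 2 * (q.coords 0 * q.coords 1 + q.coords 2 * q.coords 3 + q.coords 4 * q.coords 5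
    + q.coords 6 * q.coords 7) with hd
  have hn0 : n ≠ 0 := by
    intro h0
    apply h
    rw [eps_mul_eq_zero_iff]
    have h1 := sq_nonneg (q.coords 0)
    have h2 := sq_nonneg (q.coords 2)
    have h3 := sq_nonneg (q.coords 4)
    have h4 := sq_nonneg (q.coords 6)
    refine ⟨?_, ?_, ?_, ?_⟩ <;> refine pow_eq_zero_iff (two_ne_zero) |>.1 ?_ <;> linarith
  have e1 : q * star q = n • (1 : DQ ℝ) + d • eps ℝ := by
    refine ext_coords fun c => ?_
    rw [coords_mul, coords_add, coords_smul, coords_smul, coords_one, eps, coords_ofCoords]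
    simp only [coords_star]
    rw [hn, hd]
    generalize q.coords = v
    fin_cases c <;> simp <;> ring
  have e2 : star q * q = n • (1 : DQ ℝ) + d • eps ℝ := by
    refine ext_coords fun c => ?_
    rw [coords_mul, coords_add, coords_smul, coords_smul, coords_one, eps, coords_ofCoords]
    simp only [coords_star]
    rw [hn, hd]
    generalize q.coords = v
    fin_cases c <;> simp <;> ring
  have e3 : (n • (1 : DQ ℝ) + d • eps ℝ) * (n⁻¹ • 1 - (d / n ^ 2) • eps ℝ) = 1 := by
    rw [add_mul, mul_sub, mul_sub, smul_mul_smul_comm, smul_mul_smul_comm, smul_mul_smul_comm,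
      smul_mul_smul_comm, eps_mul_eps, one_mul, one_mul, mul_one, smul_zero, sub_zero,
      mul_inv_cancel₀ hn0, one_smul, sub_add, ← sub_smul]
    have : n * (d / n ^ 2) - d * n⁻¹ = 0 := by field_simp; ring
    rw [this, zero_smul, sub_zero]
  have e4 : (n⁻¹ • 1 - (d / n ^ 2) • eps ℝ) * (n • (1 : DQ ℝ) + d • eps ℝ) = 1 := by
    rw [sub_mul, mul_add, mul_add, smul_mul_smul_comm, smul_mul_smul_comm, smul_mul_smul_comm,
      smul_mul_smul_comm, eps_mul_eps, one_mul, one_mul, mul_one, smul_zero, add_zero,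
      inv_mul_cancel₀ hn0, one_smul, add_sub_assoc, ← sub_smul]
    have : n⁻¹ * d - d / n ^ 2 * n = 0 := by field_simp; ring
    rw [this, zero_smul, add_zero]
  refine isUnit_iff_exists.2 ⟨star q * (n⁻¹ • 1 - (d / n ^ 2) • eps ℝ), ?_, ?_⟩
  · rw [← mul_assoc, e1, e3]
  · have hc : Commute (star q) (n⁻¹ • 1 - (d / n ^ 2) • eps ℝ) := by
      refine Commute.sub_right ((Commute.one_right _).smul_right _) (Commute.smul_right ?_ _)
      exact (eps_mul_comm _).symm
    rw [hc.eq, mul_assoc, e2, e4]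

/-- A real dual quaternion with square `-1` is a line in normalized Plücker coordinates. -/
theorem line_of_sq {h : DQ ℝ} (hh : h * h = -1) :
    h.coords 0 = 0 ∧ h.coords 1 = 0 ∧
    h.coords 2 ^ 2 + h.coords 4 ^ 2 + h.coords 6 ^ 2 = 1 ∧
    h.coords 2 * h.coords 3 + h.coords 4 * h.coords 5 + h.coords 6 * h.coords 7 = 0 := by
  have h1 : (h * h).coords = fun c => -(1 : DQ ℝ).coords c :=
    funext fun c => by rw [hh, coords_neg]
  rw [coords_mul, coords_one] at h1
  have e0 := congrFun h1 0; have e1 := congrFun h1 1; have e2 := congrFun h1 2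
  have e3 := congrFun h1 3; have e4 := congrFun h1 4; have e5 := congrFun h1 5
  have e6 := congrFun h1 6; have e7 := congrFun h1 7
  simp only [Matrix.cons_val] at e0 e1 e2 e3 e4 e5 e6 e7
  generalize h.coords = v at *
  have z0 : v 0 = 0 := by
    by_contra hne
    have f2 : v 2 = 0 := mul_left_cancel₀ hne (by linarith)
    have f4 : v 4 = 0 := mul_left_cancel₀ hne (by linarith)
    have f6 : v 6 = 0 := mul_left_cancel₀ hne (by linarith)
    rw [f2, f4, f6] at e0
    nlinarith [sq_nonneg (v 0)]
  rw [z0] at e0 e1 e2 e3 e4 e5 e6 e7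
  have n1 : v 2 ^ 2 + v 4 ^ 2 + v 6 ^ 2 = 1 := by linarith
  have z1 : v 1 = 0 := by
    have f2 : v 1 * v 2 = 0 := by linarith
    have f4 : v 1 * v 4 = 0 := by linarith
    have f6 : v 1 * v 6 = 0 := by linarith
    linear_combination (-(v 1)) * n1 + v 2 * f2 + v 4 * f4 + v 6 * f6
  exact ⟨z0, z1, n1, by linarith⟩

theorem star_of_sq {h : DQ ℝ} (hh : h * h = -1) : star h = -h := by
  obtain ⟨h0, h1, -, -⟩ := line_of_sq hh
  refine ext_coords fun c => ?_
  rw [coords_star, coords_neg]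
  generalize h.coords = v at *
  fin_cases c <;> simp [h0, h1]

/-- Lines with commuting primal parts are parallel. -/
theorem exists_parallel {h k : DQ ℝ} (hh : h * h = -1) (hk : k * k = -1)
    (hc : eps ℝ * (h * k - k * h) = 0) :
    ∃ σ : ℝ, (σ = 1 ∨ σ = -1) ∧ eps ℝ * (k - σ • h) = 0 := by
  obtain ⟨h0, h1, hn, hd⟩ := line_of_sq hh
  obtain ⟨k0, k1, kn, kd⟩ := line_of_sq hk
  obtain ⟨-, c2, c4, c6⟩ := eps_mul_eq_zero_iff.1 hc
  rw [coords_sub, coords_mul, coords_mul] at c2 c4 c6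
  simp only [Matrix.cons_val] at c2 c4 c6
  simp only [eps_mul_eq_zero_iff, coords_sub, coords_smul]
  generalize h.coords = v at *
  generalize k.coords = w at *
  rw [h0, k0] at c2 c4 c6
  have x2 : v 4 * w 6 - v 6 * w 4 = 0 := by linarith
  have x4 : v 6 * w 2 - v 2 * w 6 = 0 := by linarith
  have x6 : v 2 * w 4 - v 4 * w 2 = 0 := by linarith
  have hs : (v 2 * w 2 + v 4 * w 4 + v 6 * w 6) ^ 2 = 1 := by
    linear_combination (w 2 ^ 2 + w 4 ^ 2 + w 6 ^ 2) * hn + kn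
      - (v 4 * w 6 - v 6 * w 4) * x2 - (v 6 * w 2 - v 2 * w 6) * x4
      - (v 2 * w 4 - v 4 * w 2) * x6
  refine ⟨v 2 * w 2 + v 4 * w 4 + v 6 * w 6, sq_eq_one_iff.1 hs, ?_, ?_, ?_, ?_⟩
  · rw [h0, k0]; ring
  · linear_combination (-w 2) * hn + v 6 * x4 - v 4 * x6
  · linear_combination (-w 4) * hn - v 6 * x2 + v 2 * x6
  · linear_combination (-w 6) * hn + v 4 * x2 - v 2 * x4

/-- Commuting lines agree up to orientation. -/
theorem eq_or_eq_neg_of_comm {h k : DQ ℝ} (hh : h * h = -1) (hk : k * k = -1)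
    (hc : h * k = k * h) : k = h ∨ k = -h := by
  obtain ⟨σ, hσ, hp⟩ := exists_parallel hh hk (by rw [hc, sub_self, mul_zero])
  suffices k = σ • h by
    rcases hσ with rfl | rfl
    · left; rw [this, one_smul]
    · right; rw [this, neg_smul, one_smul]
  obtain ⟨h0, h1, hn, hd⟩ := line_of_sq hh
  obtain ⟨k0, k1, kn, kd⟩ := line_of_sq hk
  obtain ⟨-, p2, p4, p6⟩ := eps_mul_eq_zero_iff.1 hp
  have hc' := congrArg coords hc
  rw [coords_mul, coords_mul] at hc'
  have c3 := congrFun hc' 3; have c5 := congrFun hc' 5; have c7 := congrFun hc' 7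
  simp only [Matrix.cons_val] at c3 c5 c7
  rw [coords_sub, coords_smul] at p2 p4 p6
  have hσ2 : σ ^ 2 = 1 := by rcases hσ with rfl | rfl <;> norm_num
  refine ext_coords fun c => ?_
  rw [coords_smul]
  generalize h.coords = v at *
  generalize k.coords = w at *
  have q2 : w 2 = σ * v 2 := by linarith
  have q4 : w 4 = σ * v 4 := by linarith
  have q6 : w 6 = σ * v 6 := by linarith
  rw [h0, h1, k0, k1, q2, q4, q6] at c3 c5 c7
  rw [q2, q4, q6] at kd
  have x3 : v 4 * (w 7 - σ * v 7) - v 6 * (w 5 - σ * v 5) = 0 := by linarith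
  have x5 : v 6 * (w 3 - σ * v 3) - v 2 * (w 7 - σ * v 7) = 0 := by linarith
  have x7 : v 2 * (w 5 - σ * v 5) - v 4 * (w 3 - σ * v 3) = 0 := by linarith
  have kd' : v 2 * w 3 + v 4 * w 5 + v 6 * w 7 = 0 := by
    linear_combination σ * kd - (v 2 * w 3 + v 4 * w 5 + v 6 * w 7) * hσ2
  have y : v 2 * (w 3 - σ * v 3) + v 4 * (w 5 - σ * v 5) + v 6 * (w 7 - σ * v 7) = 0 := by
    linear_combination kd' - σ * hd
  have r3 : w 3 = σ * v 3 := by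
    linear_combination (-(w 3 - σ * v 3)) * hn + v 2 * y + v 6 * x5 - v 4 * x7
  have r5 : w 5 = σ * v 5 := by
    linear_combination (-(w 5 - σ * v 5)) * hn + v 4 * y - v 6 * x3 + v 2 * x7
  have r7 : w 7 = σ * v 7 := by
    linear_combination (-(w 7 - σ * v 7)) * hn + v 6 * y + v 4 * x3 - v 2 * x5
  fin_cases c <;> simp [h0, h1, k0, k1, q2, q4, q6, r3, r5, r7]

/-- Any two lines are conjugate. -/
theorem exists_conjugator {h k : DQ ℝ} (hh : h * h = -1) (hk : k * k = -1) :
    ∃ g : DQ ℝ, IsUnit g ∧ h * g = g * k := by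
  have key : ∀ x : DQ ℝ, h * (h * x + x * k) = (h * x + x * k) * k := by
    intro x
    rw [mul_add, add_mul, ← mul_assoc, hh, mul_assoc x, hk, neg_one_mul, mul_neg_one, mul_assoc,
      add_comm]
  by_contra! hcon
  have hz : ∀ x : DQ ℝ, eps ℝ * (h * x + x * k) = 0 := by
    intro x
    by_contra hne
    exact hcon _ (isUnit_of_eps_mul_ne_zero hne) (key x)
  obtain ⟨h0, h1, hn, hd⟩ := line_of_sq hh
  obtain ⟨k0, k1, kn, kd⟩ := line_of_sq hk
  have z1 := eps_mul_eq_zero_iff.1 (hz 1)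
  have z2 := eps_mul_eq_zero_iff.1 (hz (ofCoords ![0, 0, 1, 0, 0, 0, 0, 0]))
  have z3 := eps_mul_eq_zero_iff.1 (hz (ofCoords ![0, 0, 0, 0, 1, 0, 0, 0]))
  simp only [coords_add, coords_mul, coords_one, coords_ofCoords, Matrix.cons_val] at z1 z2 z3
  generalize h.coords = v at *
  generalize k.coords = w at *
  obtain ⟨-, a2, a4, a6⟩ := z1
  obtain ⟨b0, b2, b4, b6⟩ := z2
  obtain ⟨d0, d2, d4, d6⟩ := z3
  have f2 : v 2 = 0 := by linarith
  have f4 : v 4 = 0 := by linarith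
  have f6 : v 6 = 0 := by linarith
  rw [f2, f4, f6] at hn
  norm_num at hn

end DQ

/-! ### Coupling spaces of dimension eight -/

namespace DQ

/-- The standard basis. -/
def unitVec (A : Type*) [CommRing A] (c : Fin 8) : DQ A := ofCoords (Pi.single c 1)

theorem sum_coords_smul_unitVec {A : Type*} [CommRing A] (q : DQ A) :
    ∑ c, q.coords c • unitVec A c = q := by
  refine ext_coords fun d => ?_
  rw [coords_sum]
  simp only [coords_smul, unitVec, coords_ofCoords, Pi.single_apply, mul_ite, mul_one, mul_zero,
    Finset.sum_ite_eq, Finset.mem_univ, if_true]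

theorem map_unitVec {A B : Type*} [CommRing A] [CommRing B] (φ : A →+* B) (c : Fin 8) :
    map φ (unitVec A c) = unitVec B c := by
  refine ext_coords fun d => ?_
  rw [coords_map, unitVec, unitVec, coords_ofCoords, coords_ofCoords, Pi.single_apply,
    Pi.single_apply, apply_ite φ, map_one, map_zero]

theorem finrank_eq_eight (k : Type*) [Field k] : Module.finrank k (DQ k) = 8 := by
  rw [(coordsEquiv k).finrank_eq, Module.finrank_fin_fun]

/-- The identification with `DualQuat ℝ` as a linear equivalence. -/
def ofLinear : DualQuat ℝ ≃ₗ[ℝ] DQ ℝ where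
  toFun := of
  invFun := of.symm
  map_add' := of_add
  map_smul' := of_smul
  left_inv _ := rfl
  right_inv _ := rfl

theorem eq_top_of_couplingDim {k₀ k₁ k₂ : DualQuat ℝ} (H : couplingDim [k₀, k₁, k₂] = 8)
    (S : Submodule ℝ (DQ ℝ)) (s : 1 ∈ S) (s0 : of k₀ ∈ S) (s1 : of k₁ ∈ S) (s2 : of k₂ ∈ S)
    (s01 : of k₀ * of k₁ ∈ S) (s02 : of k₀ * of k₂ ∈ S) (s12 : of k₁ * of k₂ ∈ S)
    (s012 : of k₀ * of k₁ * of k₂ ∈ S) : S = ⊤ := by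
  have : Module.Finite ℝ (DQ ℝ) := Module.Finite.equiv (coordsEquiv ℝ).symm
  have htop : (couplingSpace [k₀, k₁, k₂]).map ofLinear.toLinearMap = ⊤ := by
    refine Submodule.eq_top_of_finrank_eq ?_
    rw [finrank_eq_eight]
    exact (LinearEquiv.finrank_map_eq ofLinear _).trans H
  have hle : couplingSpace [k₀, k₁, k₂] ≤ S.comap ofLinear.toLinearMap := by
    refine Submodule.span_le.2 ?_
    rintro x ⟨l, hl, rfl⟩
    rw [← List.mem_sublists'] at hl
    simp only [List.sublists'_cons, List.sublists'_nil, List.map_cons, List.map_nil,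
      List.cons_append, List.nil_append, List.mem_cons, List.not_mem_nil, or_false] at hl
    change of l.prod ∈ S
    rcases hl with rfl | rfl | rfl | rfl | rfl | rfl | rfl | rfl <;>
      simp only [List.prod_cons, List.prod_nil, mul_one, of_mul, of_one, ← mul_assoc] <;>
      assumption
  rw [← Submodule.map_le_iff_le_comap, htop] at hle
  exact top_le_iff.1 hle

variable {A : Type*} [CommRing A] [Algebra ℂ A]

/-- Coefficient extension of a linear functional. -/
def liftFunctional (A : Type*) [CommRing A] [Algebra ℂ A] (L : DQ ℂ →ₗ[ℂ] ℂ) : DQ A →ₗ[A] A where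
  toFun q := ∑ c, q.coords c * algebraMap ℂ A (L (unitVec ℂ c))
  map_add' p q := by simp only [coords_add, add_mul, Finset.sum_add_distrib]
  map_smul' x q := by
    simp only [coords_smul, mul_assoc, RingHom.id_apply, smul_eq_mul, Finset.mul_sum]

theorem liftFunctional_apply (L : DQ ℂ →ₗ[ℂ] ℂ) (q : DQ A) :
    liftFunctional A L q = ∑ c, q.coords c * algebraMap ℂ A (L (unitVec ℂ c)) := rfl

theorem liftFunctional_map (L : DQ ℂ →ₗ[ℂ] ℂ) (x : DQ ℂ) :
    liftFunctional A L (map (algebraMap ℂ A) x) = algebraMap ℂ A (L x) := by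
  conv_rhs => rw [← sum_coords_smul_unitVec x]
  rw [liftFunctional_apply, _root_.map_sum, _root_.map_sum]
  refine Finset.sum_congr rfl fun c _ => ?_
  rw [coords_map, _root_.map_smul, smul_eq_mul, _root_.map_mul]

/-- The complexification of a real dual quaternion. -/
abbrev cx (h : DualQuat ℝ) : DQ ℂ := map Complex.ofRealHom (of h)

/-- The factor `(1 + c y) - y h`, that is `t - h` with the homogeneous coordinates of `t`
normalized by `x - c y = 1`. -/
def factor (h : DualQuat ℝ) (c : ℂ) (y : A) : DQ A :=
  1 + y • map (algebraMap ℂ A) (c • 1 - cx h)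

/-- The eight products of the elements `c - h` in increasing order. -/
def gens (h : Fin 3 → DualQuat ℝ) (c : Fin 3 → ℂ) : Fin 8 → DQ ℂ :=
  ![1, c 0 • 1 - cx (h 0), c 1 • 1 - cx (h 1), c 2 • 1 - cx (h 2),
    (c 0 • 1 - cx (h 0)) * (c 1 • 1 - cx (h 1)), (c 0 • 1 - cx (h 0)) * (c 2 • 1 - cx (h 2)),
    (c 1 • 1 - cx (h 1)) * (c 2 • 1 - cx (h 2)),
    (c 0 • 1 - cx (h 0)) * (c 1 • 1 - cx (h 1)) * (c 2 • 1 - cx (h 2))]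

/-- The eight squarefree monomials in three variables. -/
def monos (y : Fin 3 → A) : Fin 8 → A :=
  ![1, y 0, y 1, y 2, y 0 * y 1, y 0 * y 2, y 1 * y 2, y 0 * y 1 * y 2]

theorem span_gens {h : Fin 3 → DualQuat ℝ} (H : couplingDim [h 0, h 1, h 2] = 8) (c : Fin 3 → ℂ) :
    Submodule.span ℂ (Set.range (gens h c)) = ⊤ := by
  set S := Submodule.span ℂ (Set.range (gens h c)) with hS
  have hg : ∀ i, gens h c i ∈ S := fun i => Submodule.subset_span ⟨i, rfl⟩
  have g0 := hg 0; have g1 := hg 1; have g2 := hg 2; have g3 := hg 3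
  have g4 := hg 4; have g5 := hg 5; have g6 := hg 6; have g7 := hg 7
  simp only [gens, Matrix.cons_val] at g0 g1 g2 g3 g4 g5 g6 g7
  have e : ∀ i, cx (h i) = c i • 1 - (c i • 1 - cx (h i)) := fun i => by rw [sub_sub_cancel]
  have e0 := e 0; have e1 := e 1; have e2 := e 2
  generalize c 0 • (1 : DQ ℂ) - cx (h 0) = k0 at *
  generalize c 1 • (1 : DQ ℂ) - cx (h 1) = k1 at *
  generalize c 2 • (1 : DQ ℂ) - cx (h 2) = k2 at *
  let T : Submodule ℝ (DQ ℝ) :=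
    { carrier := {x | map Complex.ofRealHom x ∈ S}
      add_mem' := fun {x y} hx hy => by
        rw [Set.mem_ofPred_eq, map_add]; exact S.add_mem hx hy
      zero_mem' := by rw [Set.mem_ofPred_eq, map_zero]; exact S.zero_mem
      smul_mem' := fun r x hx => by
        rw [Set.mem_ofPred_eq, map_smul]; exact S.smul_mem _ hx }
  have hT : T = ⊤ := by
    apply eq_top_of_couplingDim H T
    · change map _ _ ∈ S
      rw [map_one]; exact g0
    all_goals
      change map _ _ ∈ S
      simp only [_root_.map_mul, e0, e1, e2]
      try simp only [sub_mul, mul_sub, smul_mul_assoc, mul_smul_comm, one_mul, mul_one, smul_sub]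
      repeat' first | assumption | apply S.sub_mem | apply S.smul_mem
  refine eq_top_iff.2 fun q _ => ?_
  rw [← sum_coords_smul_unitVec q]
  refine S.sum_mem fun d _ => S.smul_mem _ ?_
  rw [← map_unitVec Complex.ofRealHom]
  exact (eq_top_iff.1 hT) (Submodule.mem_top : unitVec ℝ d ∈ ⊤)

theorem factor_prod (h : Fin 3 → DualQuat ℝ) (c : Fin 3 → ℂ) (y : Fin 3 → A) :
    factor (h 0) (c 0) (y 0) * factor (h 1) (c 1) (y 1) * factor (h 2) (c 2) (y 2) =
      ∑ j, monos y j • map (algebraMap ℂ A) (gens h c j) := by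
  simp only [Fin.sum_univ_eight, monos, gens, factor, Matrix.cons_val, map_one, _root_.map_mul]
  generalize map (algebraMap ℂ A) (c 0 • (1 : DQ ℂ) - cx (h 0)) = k0
  generalize map (algebraMap ℂ A) (c 1 • (1 : DQ ℂ) - cx (h 1)) = k1
  generalize map (algebraMap ℂ A) (c 2 • (1 : DQ ℂ) - cx (h 2)) = k2
  simp only [add_mul, mul_add, one_mul, mul_one, smul_mul_assoc, mul_smul_comm, smul_smul,
    smul_add, one_smul, mul_assoc]
  rw [show y 2 * (y 1 * y 0) = y 0 * (y 1 * y 2) by ring, mul_comm (y 1) (y 0),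
    mul_comm (y 2) (y 0), mul_comm (y 2) (y 1)]
  abel

/-- The Segre coordinates are linear functions of the product of three factors. -/
theorem exists_functional {h : Fin 3 → DualQuat ℝ} (H : couplingDim [h 0, h 1, h 2] = 8)
    (c : Fin 3 → ℂ) : ∃ L : Fin 8 → DQ ℂ →ₗ[ℂ] ℂ,
      ∀ (A : Type) [CommRing A] [Algebra ℂ A] (y : Fin 3 → A) (i : Fin 8),
      liftFunctional A (L i) (factor (h 0) (c 0) (y 0) * factor (h 1) (c 1) (y 1) *
        factor (h 2) (c 2) (y 2)) = monos y i := by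
  have hcard : Fintype.card (Fin 8) = Module.finrank ℂ (DQ ℂ) := by
    rw [finrank_eq_eight, Fintype.card_fin]
  let b := basisOfTopLeSpanOfCardEqFinrank (gens h c) (span_gens H c).ge hcard
  refine ⟨fun i => b.coord i, fun A _ _ y i => ?_⟩
  rw [factor_prod, _root_.map_sum]
  have hb : ∀ j, b.coord i (gens h c j) = if j = i then 1 else 0 := by
    intro j
    have : gens h c j = b j := by rw [coe_basisOfTopLeSpanOfCardEqFinrank]
    rw [this, Module.Basis.coord_apply, Module.Basis.repr_self, Finsupp.single_apply]
  simp only [_root_.map_smul, liftFunctional_map, hb, smul_eq_mul]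
  rw [Finset.sum_eq_single i]
  · simp
  · intro j _ hj; simp [hj]
  · intro hi; exact absurd (Finset.mem_univ i) hi

end DQ

/-! ### The intersection of a line with a Segre quadric -/

namespace DQ

section generalRing

variable {A : Type*} [CommRing A]

theorem add_star_self (p : DQ A) :
    p + star p = (2 * p.coords 0) • 1 + (2 * p.coords 1) • eps A := by
  refine ext_coords fun c => ?_
  rw [coords_add, coords_star, coords_add, coords_smul, coords_smul, coords_one, eps,
    coords_ofCoords]
  generalize p.coords = v
  fin_cases c <;> simp [two_mul]

/-- A rank one element `y` of the quaternion algebra satisfies `y x y ∈ A[ε] y`. -/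
theorem exists_mul_mul_eq {y : DQ A} (hy : y * star y = 0) (x : DQ A) :
    ∃ s t : A, y * x * y = s • y + t • (eps A * y) := by
  have h1 : y * x * y = y * (x * y + star (x * y)) := by
    rw [mul_add, star_mul, ← mul_assoc, ← mul_assoc, hy, zero_mul, add_zero]
  refine ⟨2 * (x * y).coords 0, 2 * (x * y).coords 1, ?_⟩
  rw [h1, add_star_self, mul_add, mul_smul_comm, mul_smul_comm, mul_one, eps_mul_comm]

end generalRing

theorem map_of_sq {A : Type*} [CommRing A] (φ : ℝ →+* A) {h : DualQuat ℝ} (hh : h * h = -1) :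
    map φ (of h) * map φ (of h) = -1 := by
  rw [← _root_.map_mul, ← of_mul, hh, of_neg, of_one, _root_.map_neg, map_one]

theorem star_map_of_sq {A : Type*} [CommRing A] (φ : ℝ →+* A) {h : DualQuat ℝ}
    (hh : h * h = -1) : star (map φ (of h)) = -map φ (of h) := by
  rw [← map_star, star_of_sq (h := of h) (by rw [← of_mul, hh, of_neg, of_one]), _root_.map_neg]

theorem of_sq {h : DualQuat ℝ} (hh : h * h = -1) : of h * of h = -1 := by
  rw [← of_mul, hh, of_neg, of_one]

theorem cx_sq {h : DualQuat ℝ} (hh : h * h = -1) : cx h * cx h = -1 := map_of_sq _ hh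

theorem star_cx {h : DualQuat ℝ} (hh : h * h = -1) : star (cx h) = -cx h := star_map_of_sq _ hh

theorem eq_zero_of_real_add_smul {a : ℂ} (ha : a = Complex.I ∨ a = -Complex.I) {r s : DQ ℝ}
    (h : map Complex.ofRealHom r + a • map Complex.ofRealHom s = 0) : r = 0 ∧ s = 0 := by
  have key : ∀ c, r.coords c = 0 ∧ s.coords c = 0 := by
    intro c
    have h1 : (map Complex.ofRealHom r + a • map Complex.ofRealHom s).coords c = 0 := by
      rw [h, coords_zero]
    rw [coords_add, coords_smul, coords_map, coords_map] at h1
    generalize r.coords c = x at *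
    generalize s.coords c = y at *
    have hre := congrArg Complex.re h1
    have him := congrArg Complex.im h1
    rcases ha with rfl | rfl <;> simp at hre him <;> exact ⟨hre, him⟩
  exact ⟨ext_coords fun c => by rw [(key c).1, coords_zero],
    ext_coords fun c => by rw [(key c).2, coords_zero]⟩

theorem eps_map_ne_zero {r s : DQ ℝ} {a : ℂ} (ha : a = Complex.I ∨ a = -Complex.I)
    (hs : eps ℝ * s ≠ 0) :
    eps ℂ * (a • map Complex.ofRealHom r - map Complex.ofRealHom s) ≠ 0 := by
  intro h
  apply hs
  refine (eq_zero_of_real_add_smul (r := eps ℝ * s) (s := -(eps ℝ * r)) ha ?_).1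
  rw [mul_sub, mul_smul_comm] at h
  rw [_root_.map_neg, _root_.map_mul, _root_.map_mul, map_eps, smul_neg, ← sub_eq_add_neg,
    ← neg_eq_zero, neg_sub, h]

theorem eps_mul_line_ne_zero {h : DualQuat ℝ} (hh : h * h = -1) : eps ℝ * of h ≠ 0 := by
  intro h0
  have h1 : (eps ℝ * of h) * of h = 0 := by rw [h0, zero_mul]
  rw [mul_assoc, of_sq hh, mul_neg, mul_one, neg_eq_zero] at h1
  have h2 := congrArg (fun q => coords q 1) h1
  simp only [coords_zero, eps, coords_ofCoords] at h2
  simp at h2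

theorem sq_eq_neg_one {a : ℂ} (ha : a = Complex.I ∨ a = -Complex.I) : a * a = -1 := by
  rcases ha with rfl | rfl <;> simp

/-- Two consecutive factors never multiply to zero. -/
theorem linear_mul_ne_zero {h k : DualQuat ℝ} (hh : h * h = -1) (hk : k * k = -1) (h1 : k ≠ h)
    (h2 : k ≠ -h) {b : ℂ} (hb : b = Complex.I ∨ b = -Complex.I) {x y : ℂ} (hxy : x ≠ 0 ∨ y ≠ 0) :
    (x • 1 - y • cx h) * (b • 1 - cx k) ≠ 0 := by
  intro h0
  have hne : eps ℂ * (b • 1 - cx k) ≠ 0 := by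
    have := eps_map_ne_zero (r := 1) (s := of k) hb (eps_mul_line_ne_zero hk)
    rwa [map_one] at this
  have hne' : b • 1 - cx k ≠ 0 := fun hz => hne (by rw [hz, mul_zero])
  rw [sub_mul, smul_mul_assoc, smul_mul_assoc, one_mul, sub_eq_zero] at h0
  have hy : y ≠ 0 := by
    rintro rfl
    rw [zero_smul, smul_eq_zero] at h0
    rcases h0 with h0 | h0
    · simp [h0] at hxy
    · exact hne' h0
  have h3 : cx h * (b • 1 - cx k) = (x / y) • (b • 1 - cx k) := by
    rw [div_eq_inv_mul, mul_smul, h0, smul_smul, inv_mul_cancel₀ hy, one_smul]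
  have hl : (x / y) * (x / y) = -1 := by
    have h4 : cx h * (cx h * (b • 1 - cx k)) = ((x / y) * (x / y)) • (b • 1 - cx k) := by
      rw [h3, mul_smul_comm, h3, smul_smul]
    rw [← mul_assoc, cx_sq hh, neg_one_mul] at h4
    have h5 : ((x / y) * (x / y) + 1) • (b • 1 - cx k) = 0 := by
      rw [add_smul, ← h4, one_smul, neg_add_cancel]
    rcases smul_eq_zero.1 h5 with h6 | h6
    · exact eq_neg_of_add_eq_zero_left h6
    · exact absurd h6 hne'
  have hσ : ∃ σ : ℝ, (σ = 1 ∨ σ = -1) ∧ x / y = σ * b := by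
    have hbb := sq_eq_neg_one hb
    have : (x / y - b) * (x / y + b) = 0 := by linear_combination hl - hbb
    rcases mul_eq_zero.1 this with h7 | h7
    · exact ⟨1, Or.inl rfl, by push_cast; linear_combination h7⟩
    · exact ⟨-1, Or.inr rfl, by push_cast; linear_combination h7⟩
  obtain ⟨σ, hσ, hx⟩ := hσ
  have h8 : map Complex.ofRealHom (σ • 1 - of h * of k) +
      b • map Complex.ofRealHom (of h + σ • of k) = 0 := by
    rw [hx, mul_sub, mul_smul_comm, mul_one, smul_sub, smul_smul, mul_assoc,
      sq_eq_neg_one hb] at h3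
    rw [_root_.map_sub, _root_.map_add, map_smul, map_smul, map_one, _root_.map_mul]
    change (σ : ℂ) • 1 - cx h * cx k + b • (cx h + (σ : ℂ) • cx k) = 0
    rw [smul_add, smul_smul, mul_comm b]
    have h9 := sub_eq_zero.2 h3
    rw [mul_neg_one, neg_smul] at h9
    rw [← h9]
    abel
  have h10 := (eq_zero_of_real_add_smul hb h8).2
  have h11 : of k = -σ • of h := by
    have hs2 : σ * σ = 1 := by rcases hσ with rfl | rfl <;> norm_num
    rw [eq_neg_of_add_eq_zero_left h10, smul_neg, neg_smul, neg_neg, smul_smul, hs2, one_smul]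
  rcases hσ with rfl | rfl
  · exact h2 (of.injective (by rw [h11, of_neg, neg_smul, one_smul]))
  · exact h1 (of.injective (by rw [h11, neg_neg, one_smul]))

end DQ

namespace DQ

theorem conj_mul_linear {A : Type*} [CommRing A] {H : DQ A} (hH : H * H = -1) (x y : A) :
    (x • 1 + y • H) * (x • 1 - y • H) = (x * x + y * y) • 1 := by
  simp only [add_mul, mul_sub, smul_mul_smul_comm, hH, one_mul, mul_one, mul_comm y x, smul_neg,
    add_smul]
  abel

theorem linear_mul_conj {A : Type*} [CommRing A] {H : DQ A} (hH : H * H = -1) (x y : A) :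
    (x • 1 - y • H) * (x • 1 + y • H) = (x * x + y * y) • 1 := by
  simp only [sub_mul, mul_add, smul_mul_smul_comm, hH, one_mul, mul_one, mul_comm y x, smul_neg,
    add_smul]
  abel

theorem line_mul_conj {A : Type*} [CommRing A] {H : DQ A} (hH : H * H = -1) {a : A}
    (ha : a * a = -1) : (a • 1 - H) * (a • 1 + H) = 0 := by
  have := linear_mul_conj hH a 1
  rwa [one_smul, ha, mul_one, neg_add_cancel, zero_smul] at this

theorem conj_mul_line {A : Type*} [CommRing A] {H : DQ A} (hH : H * H = -1) {a : A}
    (ha : a * a = -1) : (a • 1 + H) * (a • 1 - H) = 0 := by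
  have := conj_mul_linear hH a 1
  rwa [one_smul, ha, mul_one, neg_add_cancel, zero_smul] at this

/-- If the commutator of two different lines annihilates `z`, the primal part of `z` vanishes. -/
theorem mul_commutator {h k : DualQuat ℝ} (hh : h * h = -1) (hk : k * k = -1) (h1 : k ≠ h)
    (h2 : k ≠ -h) {z : DQ ℂ} (hz : z * (cx h * cx k - cx k * cx h) = 0) (hz0 : z ≠ 0) :
    eps ℂ * z = 0 ∧ eps ℝ * (of h * of k - of k * of h) = 0 := by
  have hC : map Complex.ofRealHom (of h * of k - of k * of h) = cx h * cx k - cx k * cx h := by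
    rw [_root_.map_sub, _root_.map_mul, _root_.map_mul]
  rw [← hC] at hz
  by_cases he : eps ℝ * (of h * of k - of k * of h) = 0
  · refine ⟨?_, he⟩
    obtain ⟨n, hn⟩ := exists_eq_eps_mul he
    have hn0 : eps ℝ * n ≠ 0 := by
      rw [← hn]
      intro h0
      rcases eq_or_eq_neg_of_comm (of_sq hh) (of_sq hk) (sub_eq_zero.1 h0) with h3 | h3
      · exact h1 (of.injective h3)
      · exact h2 (of.injective h3)
    have hu := (isUnit_of_eps_mul_ne_zero hn0).map (map Complex.ofRealHom)
    rw [hn, _root_.map_mul, map_eps, ← mul_assoc] at hz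
    rw [eps_mul_comm]
    exact (hu.mul_left_eq_zero).1 hz
  · exact absurd (((isUnit_of_eps_mul_ne_zero he).map (map Complex.ofRealHom)).mul_left_eq_zero.1
      hz) hz0

theorem commutator_mul {h k : DualQuat ℝ} (hh : h * h = -1) (hk : k * k = -1) (h1 : k ≠ h)
    (h2 : k ≠ -h) {z : DQ ℂ} (hz : (cx h * cx k - cx k * cx h) * z = 0) (hz0 : z ≠ 0) :
    eps ℂ * z = 0 ∧ eps ℝ * (of h * of k - of k * of h) = 0 := by
  have h3 := congrArg star hz
  rw [star_mul, star_sub, star_mul, star_mul, star_cx hh, star_cx hk, star_zero] at h3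
  simp only [neg_mul_neg] at h3
  obtain ⟨h4, h5⟩ := mul_commutator hh hk h1 h2 (z := star z)
    (by rw [← neg_sub, mul_neg, h3, neg_zero]) (by simpa using hz0)
  refine ⟨?_, h5⟩
  have h6 := congrArg star h4
  have h7 : star (eps ℂ) = eps ℂ := by
    refine ext_coords fun c => ?_
    rw [coords_star, eps, coords_ofCoords]
    fin_cases c <;> simp
  rwa [star_mul, star_star, h7, star_zero, ← eps_mul_comm] at h6

/-- Three lines with commuting consecutive primal parts have coupling dimension less than eight. -/
theorem not_all_parallel {h : Fin 3 → DualQuat ℝ} (H : couplingDim [h 0, h 1, h 2] = 8)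
    (h1 : h 1 * h 1 = -1) (c01 : eps ℝ * (of (h 0) * of (h 1) - of (h 1) * of (h 0)) = 0)
    (c12 : eps ℝ * (of (h 1) * of (h 2) - of (h 2) * of (h 1)) = 0) : False := by
  let T : Submodule ℝ (DQ ℝ) :=
    LinearMap.ker (LinearMap.mulLeft ℝ (eps ℝ) ∘ₗ
      (LinearMap.mulRight ℝ (of (h 1)) - LinearMap.mulLeft ℝ (of (h 1))))
  have hT : ∀ q, q ∈ T ↔ eps ℝ * (q * of (h 1) - of (h 1) * q) = 0 := fun q => Iff.rfl
  have hmul : ∀ p ∈ T, ∀ q ∈ T, p * q ∈ T := by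
    intro p hp q hq
    rw [hT] at hp hq ⊢
    have : eps ℝ * (p * q * of (h 1) - of (h 1) * (p * q)) =
        p * (eps ℝ * (q * of (h 1) - of (h 1) * q)) +
          (eps ℝ * (p * of (h 1) - of (h 1) * p)) * q := by
      rw [← mul_assoc p, ← eps_mul_comm p]
      noncomm_ring
    rw [this, hp, hq, mul_zero, zero_mul, add_zero]
  have t0 : of (h 0) ∈ T := (hT _).2 c01
  have t1 : of (h 1) ∈ T := by rw [hT, sub_self, mul_zero]
  have t2 : of (h 2) ∈ T := by
    rw [hT, ← neg_sub, mul_neg, c12, neg_zero]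
  have htop : T = ⊤ := eq_top_of_couplingDim H T
    (by rw [hT, one_mul, mul_one, sub_self, mul_zero]) t0 t1 t2 (hmul _ t0 _ t1) (hmul _ t0 _ t2)
    (hmul _ t1 _ t2) (hmul _ (hmul _ t0 _ t1) _ t2)
  have hall : ∀ q : DQ ℝ, eps ℝ * (q * of (h 1) - of (h 1) * q) = 0 := fun q =>
    (hT q).1 (htop ▸ Submodule.mem_top)
  have e1 := eps_mul_eq_zero_iff.1 (hall (unitVec ℝ 2))
  have e2 := eps_mul_eq_zero_iff.1 (hall (unitVec ℝ 4))
  obtain ⟨h0, -, hn, -⟩ := line_of_sq (of_sq h1)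
  simp only [coords_sub, coords_mul, unitVec, coords_ofCoords, Matrix.cons_val] at e1 e2
  generalize (of (h 1)).coords = v at *
  obtain ⟨-, -, a4, a6⟩ := e1
  obtain ⟨-, -, -, b6⟩ := e2
  have f4 : v 4 = 0 := by simp at a6; linarith
  have f6 : v 6 = 0 := by simp at a4; linarith
  have f2 : v 2 = 0 := by simp at b6; linarith
  rw [f2, f4, f6] at hn
  norm_num at hn

theorem factor_eq {A : Type*} [CommRing A] [Algebra ℂ A] (h : DualQuat ℝ) (c : ℂ) (y : A) :
    factor h c y = (1 + algebraMap ℂ A c * y) • 1 - y • map (algebraMap ℂ A) (cx h) := by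
  rw [factor, _root_.map_sub, map_smul, map_one, smul_sub, smul_smul, add_smul, one_smul,
    mul_comm y]
  abel

theorem isotropic_ne_zero {a : ℂ} (ha : a = Complex.I ∨ a = -Complex.I) : a ≠ 0 := by
  rcases ha with rfl | rfl <;> simp

theorem factor_isotropic (h : DualQuat ℝ) {a : ℂ} (ha : a = Complex.I ∨ a = -Complex.I) :
    factor h (-a) (1 / (2 * a)) = (1 / (2 * a)) • (a • 1 - cx h) := by
  have ha0 := isotropic_ne_zero ha
  have h1 : (1 : ℂ) + algebraMap ℂ ℂ (-a) * (1 / (2 * a)) = 1 / (2 * a) * a := by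
    rw [Algebra.algebraMap_self_apply]; field_simp; ring
  have h2 : map (algebraMap ℂ ℂ) (cx h) = cx h := ext_coords fun c => by
    rw [coords_map, Algebra.algebraMap_self_apply]
  rw [factor_eq, h1, h2, smul_sub, smul_smul]

theorem map_algebraMap_self (q : DQ ℂ) : map (algebraMap ℂ ℂ) q = q := ext_coords fun c => by
  rw [coords_map, Algebra.algebraMap_self_apply]

theorem factor_prod_ne_zero {h : Fin 3 → DualQuat ℝ} (H : couplingDim [h 0, h 1, h 2] = 8)
    (c y : Fin 3 → ℂ) :
    factor (h 0) (c 0) (y 0) * factor (h 1) (c 1) (y 1) * factor (h 2) (c 2) (y 2) ≠ 0 := by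
  intro h0
  obtain ⟨L, hL⟩ := exists_functional H c
  have := hL ℂ y 0
  rw [h0, map_zero] at this
  simp [monos] at this

/-- The lines `t₂ = const` of the quadric `t₁ = a` do not lie in the ideal of `t₄ = b`. -/
theorem no_line_of_second {h : Fin 3 → DualQuat ℝ} (H : couplingDim [h 0, h 1, h 2] = 8)
    (h2 : h 2 * h 2 = -1) {k : DualQuat ℝ} (hk : k * k = -1) (hk1 : k ≠ h 2) (hk2 : k ≠ -h 2)
    {a b : ℂ} (ha : a = Complex.I ∨ a = -Complex.I) (hb : b = Complex.I ∨ b = -Complex.I)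
    (c α : ℂ) (e1 : (a • 1 - cx (h 0)) * factor (h 1) c α * (b • 1 - cx k) = 0)
    (e2 : (a • 1 - cx (h 0)) * factor (h 1) c α * cx (h 2) * (b • 1 - cx k) = 0) : False := by
  have ha0 := isotropic_ne_zero ha
  have key : ∀ b' : ℂ, (b' = Complex.I ∨ b' = -Complex.I) →
      (a • 1 - cx (h 0)) * factor (h 1) c α * (b' • 1 - cx (h 2)) ≠ 0 := by
    intro b' hb' h0
    apply factor_prod_ne_zero H ![-a, c, -b'] ![1 / (2 * a), α, 1 / (2 * b')]
    simp only [Matrix.cons_val]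
    rw [factor_isotropic _ ha, factor_isotropic _ hb', smul_mul_assoc, smul_mul_assoc,
      mul_smul_comm, h0, smul_zero, smul_zero]
  generalize (a • 1 - cx (h 0)) * factor (h 1) c α = z at *
  have hz0 : z ≠ 0 := by
    rintro rfl
    exact key Complex.I (Or.inl rfl) (by rw [zero_mul])
  have e1' : z * cx k = b • z := by
    rw [mul_sub, mul_smul_comm, mul_one, sub_eq_zero] at e1; exact e1.symm
  have e2' : z * cx (h 2) * cx k = b • (z * cx (h 2)) := by
    rw [mul_sub, mul_smul_comm, mul_one, sub_eq_zero] at e2; exact e2.symm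
  obtain ⟨hez, hC⟩ := mul_commutator h2 hk hk1 hk2 (z := z) (by
    rw [mul_sub, ← mul_assoc, ← mul_assoc, e2', e1', smul_mul_assoc, sub_self]) hz0
  obtain ⟨σ, hσ, hp⟩ := exists_parallel (of_sq h2) (of_sq hk) hC
  obtain ⟨z', rfl⟩ := exists_eq_eps_mul hez
  have hp' := congrArg (map Complex.ofRealHom) hp
  rw [_root_.map_mul, map_eps, map_zero, _root_.map_sub, map_smul] at hp'
  have h3 : eps ℂ * z' * cx k = (σ : ℂ) • (eps ℂ * z' * cx (h 2)) := by
    rw [← sub_eq_zero, ← mul_smul_comm, ← mul_sub, eps_mul_comm, mul_assoc]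
    erw [hp']
    rw [mul_zero]
  apply key (σ * b)
  · rcases hσ with rfl | rfl <;> rcases hb with rfl | rfl <;> simp
  · rw [mul_sub, mul_smul_comm, mul_one, mul_smul, ← e1', h3, smul_smul]
    have : (σ : ℂ) * σ = 1 := by rcases hσ with rfl | rfl <;> norm_num
    rw [this, one_smul, sub_self]

/-- The lines `t₃ = const` of the quadric `t₁ = a` do not lie in the ideal of `t₄ = b`. -/
theorem no_line_of_third {h : Fin 3 → DualQuat ℝ} (H : couplingDim [h 0, h 1, h 2] = 8)
    (h0 : h 0 * h 0 = -1) (h1 : h 1 * h 1 = -1) (h2 : h 2 * h 2 = -1)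
    (h01 : h 1 ≠ h 0) (h01' : h 1 ≠ -h 0) (h12 : h 2 ≠ h 1) (h12' : h 2 ≠ -h 1)
    {k : DualQuat ℝ} (hk : k * k = -1) (hk1 : k ≠ h 2) (hk2 : k ≠ -h 2)
    {a b : ℂ} (hb : b = Complex.I ∨ b = -Complex.I)
    (c α : ℂ) (e1 : (a • 1 - cx (h 0)) * (factor (h 2) c α * (b • 1 - cx k)) = 0)
    (e2 : (a • 1 - cx (h 0)) * cx (h 1) * (factor (h 2) c α * (b • 1 - cx k)) = 0) : False := by
  have hx : factor (h 2) c α = (1 + c * α) • 1 - α • cx (h 2) := by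
    rw [factor_eq, map_algebraMap_self, Algebra.algebraMap_self_apply]
  have hα : 1 + c * α ≠ 0 ∨ α ≠ 0 := by
    by_cases h : α = 0
    · left; rw [h]; simp
    · exact Or.inr h
  have hy0 := linear_mul_ne_zero h2 hk hk1 hk2 hb hα
  rw [hx] at e1 e2
  generalize 1 + c * α = x at *
  set y := (x • 1 - α • cx (h 2)) * (b • 1 - cx k) with hy
  have e1' : cx (h 0) * y = a • y := by
    rw [sub_mul, smul_mul_assoc, one_mul, sub_eq_zero] at e1; exact e1.symm
  have e2' : cx (h 0) * (cx (h 1) * y) = a • (cx (h 1) * y) := by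
    rw [sub_mul, smul_mul_assoc, one_mul, sub_mul, smul_mul_assoc, sub_eq_zero, mul_assoc] at e2
    exact e2.symm
  obtain ⟨hey, hC⟩ := commutator_mul h0 h1 h01 h01' (z := y) (by
    rw [sub_mul, mul_assoc, mul_assoc, e2', e1', mul_smul_comm, sub_self]) hy0
  obtain ⟨σ, hσ, hp⟩ := exists_parallel (of_sq h0) (of_sq h1) hC
  have hp' := congrArg (map Complex.ofRealHom) hp
  rw [_root_.map_mul, map_eps, map_zero, _root_.map_sub, map_smul] at hp'
  obtain ⟨y', hy'⟩ := exists_eq_eps_mul hey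
  have f1 : cx (h 1) * y = (σ * a) • y := by
    have h3 : cx (h 1) * y - (σ : ℂ) • (cx (h 0) * y) = 0 := by
      rw [← smul_mul_assoc, ← sub_mul, hy', ← mul_assoc, ← eps_mul_comm]
      erw [hp']
      rw [zero_mul]
    rw [sub_eq_zero.1 h3, e1', smul_smul]
  have f2' : (x • 1 + α • cx (h 2)) * y = (x * x + α * α) • (b • 1 - cx k) := by
    rw [hy, ← mul_assoc, conj_mul_linear (cx_sq h2), smul_mul_assoc, one_mul]
  have hne : eps ℂ * (b • 1 - cx k) ≠ 0 := by
    have := eps_map_ne_zero (r := 1) (s := of k) hb (eps_mul_line_ne_zero hk)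
    rwa [map_one] at this
  have hxα : x * x + α * α = 0 := by
    have h3 := congrArg (eps ℂ * ·) f2'
    simp only [mul_smul_comm] at h3
    rw [← mul_assoc, eps_mul_comm, mul_assoc, hey, mul_zero] at h3
    exact (smul_eq_zero.1 h3.symm).resolve_right hne
  have hα0 : α ≠ 0 := by
    rintro rfl
    rw [mul_zero, add_zero, mul_self_eq_zero] at hxα
    simp [hxα] at hα
  have f2 : cx (h 2) * y = (-(x / α)) • y := by
    rw [hxα, zero_smul, add_mul, smul_mul_assoc, smul_mul_assoc, one_mul] at f2'
    have h4 : α • (cx (h 2) * y) = (-x) • y := by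
      rw [neg_smul]; exact eq_neg_of_add_eq_zero_right f2'
    calc cx (h 2) * y = α⁻¹ • (α • (cx (h 2) * y)) := by
          rw [smul_smul, inv_mul_cancel₀ hα0, one_smul]
      _ = _ := by rw [h4, smul_smul]; congr 1; field_simp
  obtain ⟨-, hC'⟩ := commutator_mul h1 h2 h12 h12' (z := y) (by
    rw [sub_mul, mul_assoc, mul_assoc, f1, f2, mul_smul_comm, mul_smul_comm, f1, f2, smul_smul,
      smul_smul, mul_comm, sub_self]) hy0
  exact not_all_parallel H h1 hC hC'

end DQ

theorem exists_subalgebra_finrank_le_two {A : Type*} [CommRing A] [Nontrivial A] [Algebra ℂ A]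
    {W : Submodule ℂ A} [FiniteDimensional ℂ W] (hW : Module.finrank ℂ W ≤ 2) {y z : A}
    (h1 : 1 ∈ W) (hy : y ∈ W) (hz : z ∈ W) (hyz : y * z ∈ W)
    (hiff : y ∈ (⊥ : Subalgebra ℂ A) ↔ z ∈ (⊥ : Subalgebra ℂ A)) :
    ∃ B : Subalgebra ℂ A, y ∈ B ∧ z ∈ B ∧ FiniteDimensional ℂ B ∧ Module.finrank ℂ B ≤ 2 := by
  by_cases hb : y ∈ (⊥ : Subalgebra ℂ A)
  · exact ⟨⊥, hb, hiff.1 hb, inferInstance, by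
      rw [Subalgebra.finrank_bot]; norm_num⟩
  have hzb : z ∉ (⊥ : Subalgebra ℂ A) := fun h => hb (hiff.2 h)
  have hli : LinearIndependent ℂ ![(1 : A), y] := by
    rw [LinearIndependent.pair_iff' one_ne_zero]
    intro c hc
    exact hb (Algebra.mem_bot.2 ⟨c, by rw [Algebra.algebraMap_eq_smul_one, hc]⟩)
  have hspan : Submodule.span ℂ {(1 : A), y} = W := by
    refine Submodule.eq_of_le_of_finrank_le
      (Submodule.span_le.2 (Set.insert_subset h1 (Set.singleton_subset_iff.2 hy))) ?_
    have := finrank_span_eq_card hli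
    rw [Matrix.range_cons, Matrix.range_cons, Matrix.range_empty, Set.union_empty,
      Set.singleton_union] at this
    rw [this, Fintype.card_fin]
    exact hW
  have hmem : ∀ w ∈ W, ∃ p q : ℂ, p • (1 : A) + q • y = w := fun w hw => by
    rwa [← hspan, Submodule.mem_span_pair] at hw
  have hyy : y * y ∈ W := by
    obtain ⟨p, q, rfl⟩ := hmem z hz
    have hq : q ≠ 0 := by
      rintro rfl
      exact hzb (by rw [zero_smul, add_zero]; exact Subalgebra.smul_mem _ (Subalgebra.one_mem _) _)
    rw [mul_add, mul_smul_comm, mul_smul_comm, mul_one] at hyz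
    have h2 := W.smul_mem q⁻¹ ((W.add_mem_iff_right (W.smul_mem p hy)).1 hyz)
    rwa [smul_smul, inv_mul_cancel₀ hq, one_smul] at h2
  refine ⟨W.toSubalgebra h1 ?_, hy, hz, ‹_›, hW⟩
  intro x w hx hw
  obtain ⟨p, q, rfl⟩ := hmem x hx
  obtain ⟨p', q', rfl⟩ := hmem w hw
  simp only [add_mul, mul_add, smul_mul_smul_comm, one_mul, mul_one]
  exact W.add_mem (W.add_mem (W.smul_mem _ h1) (W.smul_mem _ hy))
    (W.add_mem (W.smul_mem _ hy) (W.smul_mem _ hyy))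

/-- A finite-dimensional subalgebra contains the inverses of its elements. -/
theorem inverse_mem_of_finiteDimensional {A : Type*} [CommRing A] [Algebra ℂ A]
    (B : Subalgebra ℂ A) [FiniteDimensional ℂ B] {u v : A} (huv : u * v = 1) (hu : u ∈ B) :
    v ∈ B := by
  have hinj : Function.Injective (LinearMap.mulLeft ℂ (⟨u, hu⟩ : B)) := by
    intro x y hxy
    have h1 : u * (x : A) = u * (y : A) := congrArg Subtype.val hxy
    apply Subtype.ext
    calc (x : A) = v * (u * x) := by rw [← mul_assoc, mul_comm v, huv, one_mul]
      _ = y := by rw [h1, ← mul_assoc, mul_comm v, huv, one_mul]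
  obtain ⟨w, hw⟩ := (LinearMap.injective_iff_surjective.1 hinj) 1
  have h1 : u * (w : A) = 1 := congrArg Subtype.val hw
  have : v = w := by
    calc v = v * (u * w) := by rw [h1, mul_one]
      _ = w := by rw [← mul_assoc, mul_comm v, huv, one_mul]
  rw [this]
  exact w.2

namespace DQ

variable {A : Type} [CommRing A] [Algebra ℂ A]

/-- The idempotent attached to an isotropic parameter value. -/
def idem (h : DualQuat ℝ) (a : ℂ) : DQ ℂ := (1 / (2 * a)) • (a • 1 - cx h)

theorem factor_isotropic' (h : DualQuat ℝ) {a : ℂ} (ha : a = Complex.I ∨ a = -Complex.I) :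
    factor h (-a) (algebraMap ℂ A (1 / (2 * a))) = map (algebraMap ℂ A) (idem h a) := by
  rw [idem, ← factor_isotropic h ha, factor, factor, _root_.map_add, map_one, map_smul,
    map_algebraMap_self]

theorem idem_mul_self {h : DualQuat ℝ} (hh : h * h = -1) {a : ℂ}
    (ha : a = Complex.I ∨ a = -Complex.I) : idem h a * idem h a = idem h a := by
  have ha0 := isotropic_ne_zero ha
  have h1 : (a • 1 - cx h) * (a • 1 - cx h) = (2 * a) • (a • 1 - cx h) := by
    have := line_mul_conj (cx_sq hh) (sq_eq_neg_one ha)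
    have h2 : a • 1 - cx h = (2 * a) • 1 - (a • 1 + cx h) := by rw [two_mul, add_smul]; abel
    nth_rw 2 [h2]
    rw [mul_sub, this, sub_zero, mul_smul_comm, mul_one]
  rw [idem, smul_mul_smul_comm, h1, smul_smul]
  congr 1
  field_simp

theorem star_idem {h : DualQuat ℝ} (hh : h * h = -1) (a : ℂ) :
    star (idem h a) = (1 / (2 * a)) • (a • 1 + cx h) := by
  rw [idem, star_smul, star_sub, star_smul, star_one, star_cx hh, sub_neg_eq_add]

theorem idem_mul_star {h : DualQuat ℝ} (hh : h * h = -1) {a : ℂ}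
    (ha : a = Complex.I ∨ a = -Complex.I) : idem h a * star (idem h a) = 0 := by
  rw [star_idem hh, idem, smul_mul_smul_comm, line_mul_conj (cx_sq hh) (sq_eq_neg_one ha),
    smul_zero]

theorem exists_idem_conj {h k : DualQuat ℝ} (hh : h * h = -1) (hk : k * k = -1) {a b : ℂ}
    (ha : a = Complex.I ∨ a = -Complex.I) (hb : b = Complex.I ∨ b = -Complex.I) :
    ∃ g g' : DQ ℂ, star (idem k b) = g' * idem h a * g := by
  obtain ⟨σ, hσ, hab⟩ : ∃ σ : ℝ, (σ = 1 ∨ σ = -1) ∧ (σ : ℂ) * b = -a := by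
    rcases ha with rfl | rfl <;> rcases hb with rfl | rfl
    · exact ⟨-1, Or.inr rfl, by simp⟩
    · exact ⟨1, Or.inl rfl, by simp⟩
    · exact ⟨1, Or.inl rfl, by simp⟩
    · exact ⟨-1, Or.inr rfl, by simp⟩
  have hσ2 : σ * σ = 1 := by rcases hσ with rfl | rfl <;> norm_num
  obtain ⟨g, hg, hgh⟩ := exists_conjugator (of_sq hh) (k := σ • of k)
    (by rw [smul_mul_smul_comm, hσ2, one_smul, of_sq hk])
  obtain ⟨g', hg'⟩ := hg.exists_left_inv
  refine ⟨map Complex.ofRealHom g, map Complex.ofRealHom g', ?_⟩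
  have h1 : map Complex.ofRealHom g' * map Complex.ofRealHom g = 1 := by
    rw [← _root_.map_mul, hg', map_one]
  have h2 : cx h * map Complex.ofRealHom g = (σ : ℂ) • (map Complex.ofRealHom g * cx k) := by
    rw [← _root_.map_mul, hgh, mul_smul_comm, map_smul, _root_.map_mul]
    rfl
  have ha0 := isotropic_ne_zero ha
  have hb0 := isotropic_ne_zero hb
  rw [star_idem hk, idem, mul_assoc, smul_mul_assoc, sub_mul, smul_mul_assoc, one_mul, h2,
    smul_sub, smul_smul, smul_smul, mul_sub, mul_smul_comm, mul_smul_comm, ← mul_assoc, h1,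
    one_mul, smul_add, smul_smul, sub_eq_add_neg, ← neg_smul]
  have e1 : 1 / (2 * b) * b = 1 / (2 * a) * a := by field_simp
  have e2 : 1 / (2 * b) = -(1 / (2 * a) * σ) := by
    field_simp; linear_combination hab
  rw [e1, ← e2]

theorem factor_mul_conj {h : DualQuat ℝ} (hh : h * h = -1) {b : ℂ}
    (hb : b = Complex.I ∨ b = -Complex.I) :
    star (map (algebraMap ℂ A) (idem h b)) * map (algebraMap ℂ A) (b • 1 - cx h) = 0 := by
  rw [← map_star, star_idem hh, ← _root_.map_mul, smul_mul_assoc,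
    conj_mul_line (cx_sq hh) (sq_eq_neg_one hb), smul_zero, map_zero]

theorem eq_zero_of_add_smul_eq_zero [Nontrivial A] {y : A} (hy : y ∉ (⊥ : Subalgebra ℂ A))
    {p q : DQ ℂ} (h : map (algebraMap ℂ A) p + y • map (algebraMap ℂ A) q = 0) :
    p = 0 ∧ q = 0 := by
  have hq : q = 0 := by
    refine ext_coords fun c => ?_
    rw [coords_zero]
    by_contra hne
    have h1 := congrArg (fun x => coords x c) h
    simp only [coords_add, coords_smul, coords_map, coords_zero] at h1
    apply hy
    refine Algebra.mem_bot.2 ⟨-(p.coords c / q.coords c), ?_⟩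
    have h2 : algebraMap ℂ A (q.coords c) * algebraMap ℂ A (q.coords c)⁻¹ = 1 := by
      rw [← _root_.map_mul, mul_inv_cancel₀ hne, map_one]
    rw [div_eq_mul_inv, _root_.map_neg, _root_.map_mul]
    linear_combination (-algebraMap ℂ A (q.coords c)⁻¹) * h1 + y * h2
  refine ⟨?_, hq⟩
  rw [hq, map_zero, smul_zero, add_zero] at h
  exact map_injective (algebraMap ℂ A).injective (h.trans (map_zero _).symm)

theorem mul_mul_eq_zero_of_shift {x k y : DQ ℂ} {c : ℂ} (h1 : x * y = 0)
    (h2 : x * (c • 1 - k) * y = 0) : x * k * y = 0 := by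
  rwa [mul_sub, sub_mul, mul_smul_comm, mul_one, smul_mul_assoc, h1, smul_zero, zero_sub,
    neg_eq_zero] at h2

/-- The intersection of the two Segre threefolds with `t₁ = a`, `t₄ = b` has length at most two. -/
theorem finrank_le_two {h : Fin 6 → DualQuat ℝ} (hL : IsLinkage h)
    (h123 : couplingDim [h 0, h 1, h 2] = 8) (h456 : couplingDim [h 3, h 4, h 5] = 8)
    {a b : ℂ} (ha : a = Complex.I ∨ a = -Complex.I) (hb : b = Complex.I ∨ b = -Complex.I)
    (c : Fin 6 → ℂ) (hc0 : c 0 = -a) (hc3 : c 3 = -b) (y : Fin 6 → A)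
    (hgen : Algebra.adjoin ℂ (Set.range y) = ⊤) {u v : A} (huv : u * v = 1)
    (hcl : factor (h 0) (c 0) (y 0) * factor (h 1) (c 1) (y 1) * factor (h 2) (c 2) (y 2) =
      u • star (factor (h 3) (c 3) (y 3) * factor (h 4) (c 4) (y 4) * factor (h 5) (c 5) (y 5)))
    (hy0 : y 0 = algebraMap ℂ A (1 / (2 * a))) (hy3 : y 3 = algebraMap ℂ A (1 / (2 * b))) :
    Module.Finite ℂ A ∧ Module.finrank ℂ A ≤ 2 := by
  rcases subsingleton_or_nontrivial A with hA | hA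
  · exact ⟨inferInstance, by rw [Module.finrank_zero_of_subsingleton]; norm_num⟩
  have hsq := hL.sq_eq
  have hn : ∀ i : Fin 6, h (i + 1) ≠ h i := fun i => (hL.ne_next i).symm
  have hn' : ∀ i : Fin 6, h (i + 1) ≠ -h i := fun i e =>
    hL.ne_neg_next i (of.injective (by rw [e, of_neg, of_neg, neg_neg]))
  obtain ⟨L, hLf⟩ := exists_functional (h := ![h 0, h 1, h 2]) h123 ![c 0, c 1, c 2]
  obtain ⟨L', hLf'⟩ := exists_functional (h := ![h 3, h 4, h 5]) h456 ![c 3, c 4, c 5]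
  have hm := hLf A ![y 0, y 1, y 2]
  have hm' := hLf' A ![y 3, y 4, y 5]
  simp only [Matrix.cons_val] at hm hm'
  have hf0 : factor (h 0) (c 0) (y 0) = map (algebraMap ℂ A) (idem (h 0) a) := by
    rw [hc0, hy0, factor_isotropic' _ ha]
  have hf3 : factor (h 3) (c 3) (y 3) = map (algebraMap ℂ A) (idem (h 3) b) := by
    rw [hc3, hy3, factor_isotropic' _ hb]
  set f1 := factor (h 1) (c 1) (y 1) with hf1
  set f2 := factor (h 2) (c 2) (y 2) with hf2
  set p := factor (h 3) (c 3) (y 3) * factor (h 4) (c 4) (y 4) * factor (h 5) (c 5) (y 5) with hp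
  set q := factor (h 0) (c 0) (y 0) * f1 * f2 with hq
  set E := map (algebraMap ℂ A) (idem (h 0) a) with hE
  set E' := map (algebraMap ℂ A) (idem (h 3) b) with hE'
  have hpE : star p = star (factor (h 4) (c 4) (y 4) * factor (h 5) (c 5) (y 5)) * star E' := by
    rw [hp, hf3, mul_assoc, star_mul]
  -- the one-dimensional family containing `q`
  have hq1 : E * q = q := by
    rw [hq, hf0, ← mul_assoc, ← mul_assoc, hE, ← _root_.map_mul, idem_mul_self (hsq 0) ha]
  have hq2 : q * star E' = q := by
    rw [hcl, hpE, smul_mul_assoc, mul_assoc, ← star_mul, hE', ← _root_.map_mul,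
      idem_mul_self (hsq 3) hb]
  have hqb : q * map (algebraMap ℂ A) (b • 1 - cx (h 3)) = 0 := by
    rw [hcl, hpE, smul_mul_assoc, mul_assoc, factor_mul_conj (hsq 3) hb, mul_zero, smul_zero]
  obtain ⟨g, g', hg⟩ := exists_idem_conj (hsq 0) (hsq 3) ha hb
  obtain ⟨s, t, hst⟩ := exists_mul_mul_eq (y := E)
    (by rw [hE, ← map_star, ← _root_.map_mul, idem_mul_star (hsq 0) ha, map_zero])
    (q * map (algebraMap ℂ A) g')
  have hqst : q = s • map (algebraMap ℂ A) (idem (h 0) a * g) +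
      t • map (algebraMap ℂ A) (eps ℂ * idem (h 0) a * g) := by
    calc q = E * q * star E' := by rw [hq1, hq2]
      _ = E * (q * map (algebraMap ℂ A) g') * E * map (algebraMap ℂ A) g := by
        rw [hE', ← map_star, hg]; simp only [_root_.map_mul, mul_assoc]; rfl
      _ = _ := by
        rw [hst, add_mul, smul_mul_assoc, smul_mul_assoc]
        simp only [_root_.map_mul, map_eps]
        rfl
  let W : Submodule ℂ A := Submodule.span ℂ {s, t}
  have hWdim : Module.finrank ℂ W ≤ 2 := by
    classical
    have h1 := finrank_span_finset_le_card (R := ℂ) (M := A) ({s, t} : Finset A)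
    rw [Finset.coe_pair] at h1
    exact h1.trans Finset.card_le_two
  have hWfin : FiniteDimensional ℂ W := FiniteDimensional.span_of_finite ℂ (Set.toFinite _)
  have hWL : ∀ l : DQ ℂ →ₗ[ℂ] ℂ, liftFunctional A l q ∈ W := by
    intro l
    rw [hqst, _root_.map_add, _root_.map_smul, _root_.map_smul, liftFunctional_map,
      liftFunctional_map, smul_eq_mul, smul_eq_mul, mul_comm s, mul_comm t, ← Algebra.smul_def,
      ← Algebra.smul_def]
    exact W.add_mem (W.smul_mem _ (Submodule.subset_span (by simp)))
      (W.smul_mem _ (Submodule.subset_span (by simp)))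
  have hW1 : (1 : A) ∈ W := by have := hWL (L 0); rwa [hm 0] at this
  have hWy : y 1 ∈ W := by have := hWL (L 2); rwa [hm 2] at this
  have hWz : y 2 ∈ W := by have := hWL (L 3); rwa [hm 3] at this
  have hWyz : y 1 * y 2 ∈ W := by have := hWL (L 6); rwa [hm 6] at this
  have hE0 : E = map (algebraMap ℂ A) ((1 / (2 * a)) • (a • 1 - cx (h 0))) := rfl
  have ha0 := isotropic_ne_zero ha
  have h2a : (1 / (2 * a)) ≠ 0 := by simp [ha0]
  have hconst : ∀ i (z : ℂ), factor (h i) (c i) (algebraMap ℂ A z) =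
      map (algebraMap ℂ A) (factor (h i) (c i) z) := by
    intro i z
    rw [factor, factor, _root_.map_add, map_one, map_smul, map_algebraMap_self]
  have hiff : y 1 ∈ (⊥ : Subalgebra ℂ A) ↔ y 2 ∈ (⊥ : Subalgebra ℂ A) := by
    constructor
    · intro hy1
      by_contra hy2
      obtain ⟨z, hz⟩ := Algebra.mem_bot.1 hy1
      have h1 : map (algebraMap ℂ A) (idem (h 0) a * factor (h 1) (c 1) z * (b • 1 - cx (h 3))) +
          y 2 • map (algebraMap ℂ A) (idem (h 0) a * factor (h 1) (c 1) z *
            (c 2 • 1 - cx (h 2)) * (b • 1 - cx (h 3))) = 0 := by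
        have h2 : f2 = 1 + y 2 • map (algebraMap ℂ A) (c 2 • 1 - cx (h 2)) := rfl
        rw [← hqb, hq, hf0, hf1, ← hz, hconst, h2, hE]
        generalize factor (h 1) (c 1) z = w
        generalize c 2 • 1 - cx (h 2) = w'
        generalize b • 1 - cx (h 3) = w''
        simp only [_root_.map_mul, mul_add, add_mul, mul_one, mul_smul_comm, smul_mul_assoc,
          mul_assoc]
      obtain ⟨e1, e2⟩ := eq_zero_of_add_smul_eq_zero hy2 h1
      rw [idem, smul_mul_assoc, smul_mul_assoc, smul_eq_zero_iff_right h2a] at e1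
      rw [idem, smul_mul_assoc, smul_mul_assoc, smul_mul_assoc, smul_eq_zero_iff_right h2a] at e2
      refine no_line_of_second (h := ![h 0, h 1, h 2]) h123 (hsq 2) (hsq 3) (hn 2) (hn' 2)
        ha hb (c 1) z e1 ?_
      exact mul_mul_eq_zero_of_shift e1 e2
    · intro hy2
      by_contra hy1
      obtain ⟨z, hz⟩ := Algebra.mem_bot.1 hy2
      have h1 : map (algebraMap ℂ A) (idem (h 0) a * (factor (h 2) (c 2) z *
          (b • 1 - cx (h 3)))) + y 1 • map (algebraMap ℂ A) (idem (h 0) a *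
            (c 1 • 1 - cx (h 1)) * (factor (h 2) (c 2) z * (b • 1 - cx (h 3)))) = 0 := by
        have h2 : f1 = 1 + y 1 • map (algebraMap ℂ A) (c 1 • 1 - cx (h 1)) := rfl
        rw [← hqb, hq, hf0, hf2, ← hz, hconst, h2, hE]
        generalize factor (h 2) (c 2) z = w
        generalize c 1 • 1 - cx (h 1) = w'
        generalize b • 1 - cx (h 3) = w''
        simp only [_root_.map_mul, mul_add, add_mul, mul_one, mul_smul_comm, smul_mul_assoc,
          mul_assoc]
      obtain ⟨e1, e2⟩ := eq_zero_of_add_smul_eq_zero hy1 h1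
      rw [idem, smul_mul_assoc, smul_eq_zero_iff_right h2a] at e1
      rw [idem, smul_mul_assoc, smul_mul_assoc, smul_eq_zero_iff_right h2a] at e2
      refine no_line_of_third (h := ![h 0, h 1, h 2]) h123 (hsq 0) (hsq 1) (hsq 2) (hn 0) (hn' 0)
        (hn 1) (hn' 1) (hsq 3) (hn 2) (hn' 2) hb (c 2) z e1 ?_
      exact mul_mul_eq_zero_of_shift e1 e2
  obtain ⟨B, hB1, hB2, hBfin, hBdim⟩ :=
    exists_subalgebra_finrank_le_two hWdim hW1 hWy hWz hWyz hiff
  have hB0 : y 0 ∈ B := by rw [hy0]; exact B.algebraMap_mem _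
  have hB3 : y 3 ∈ B := by rw [hy3]; exact B.algebraMap_mem _
  have hmB : ∀ j, monos ![y 0, y 1, y 2] j ∈ B := by
    intro j
    fin_cases j
    · exact B.one_mem
    · exact hB0
    · exact hB1
    · exact hB2
    · exact B.mul_mem hB0 hB1
    · exact B.mul_mem hB0 hB2
    · exact B.mul_mem hB1 hB2
    · exact B.mul_mem (B.mul_mem hB0 hB1) hB2
  have hqB : ∀ d, q.coords d ∈ B := by
    intro d
    have h1 := factor_prod ![h 0, h 1, h 2] ![c 0, c 1, c 2] ![y 0, y 1, y 2]
    simp only [Matrix.cons_val] at h1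
    rw [hq, hf1, hf2, h1, coords_sum]
    refine B.sum_mem fun j _ => ?_
    rw [coords_smul, coords_map]
    exact B.mul_mem (hmB j) (B.algebraMap_mem _)
  have hqs : ∀ l : DQ ℂ →ₗ[ℂ] ℂ, liftFunctional A l (star q) ∈ B := by
    intro l
    rw [liftFunctional_apply]
    refine B.sum_mem fun d _ => B.mul_mem ?_ (B.algebraMap_mem _)
    rw [coords_star]
    split_ifs
    · exact hqB d
    · exact B.neg_mem (hqB d)
  have hsp : star q = u • p := by rw [hcl, star_smul, star_star]
  have hu : u ∈ B := by
    have := hqs (L' 0)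
    rwa [hsp, _root_.map_smul, hm' 0, smul_eq_mul, monos, Matrix.cons_val_zero, mul_one] at this
  have hv : v ∈ B := inverse_mem_of_finiteDimensional B huv hu
  have hpB : ∀ i, monos ![y 3, y 4, y 5] i ∈ B := by
    intro i
    have h1 : p = v • star q := by rw [hsp, smul_smul, mul_comm, huv, one_smul]
    rw [← hm' i, h1, _root_.map_smul, smul_eq_mul]
    exact B.mul_mem hv (hqs _)
  have hB : B = ⊤ := by
    refine top_le_iff.1 (hgen ▸ Algebra.adjoin_le ?_)
    rintro _ ⟨i, rfl⟩
    fin_cases i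
    · exact hB0
    · exact hB1
    · exact hB2
    · exact hB3
    · exact hpB 2
    · exact hpB 3
  subst hB
  refine ⟨Module.Finite.equiv (Subalgebra.topEquiv (R := ℂ) (A := A)).toLinearEquiv, ?_⟩
  rwa [(Subalgebra.topEquiv (R := ℂ) (A := A)).toLinearEquiv.finrank_eq] at hBdim

end DQ

theorem finrank_quotient_range_le {k V P : Type*} [Field k] [AddCommGroup V] [Module k V]
    [AddCommGroup P] [Module k P] (f : V →ₗ[k] V) (hf : Function.Injective f)
    (U : Submodule k V) (g : P →ₗ[k] V) (I : Submodule k P) (hUW : U ≤ LinearMap.range g)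
    (hI : I.map g ≤ U.map f) (hfU : U.map f ≤ LinearMap.range g) [Module.Finite k (P ⧸ I)]
    [Module.Finite k (V ⧸ LinearMap.range g)] :
    Module.Finite k (V ⧸ LinearMap.range f) ∧
      Module.finrank k (V ⧸ LinearMap.range f) ≤ Module.finrank k (P ⧸ I) := by
  set N := U.map f with hN
  set W := LinearMap.range g with hW
  let a : (P ⧸ I) →ₗ[k] V ⧸ N := I.mapQ N g (Submodule.map_le_iff_le_comap.1 hI)
  let b : (V ⧸ N) →ₗ[k] V ⧸ W := Submodule.factor hfU
  have hbs : Function.Surjective b := Submodule.factor_surjective hfU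
  have hker : LinearMap.ker b = LinearMap.range a := by
    ext x
    obtain ⟨x, rfl⟩ := N.mkQ_surjective x
    have h1 : b (N.mkQ x) = W.mkQ x := rfl
    rw [LinearMap.mem_ker, h1, Submodule.mkQ_apply, Submodule.Quotient.mk_eq_zero]
    constructor
    · rintro ⟨p, rfl⟩
      exact ⟨I.mkQ p, rfl⟩
    · rintro ⟨p, hp⟩
      obtain ⟨p, rfl⟩ := I.mkQ_surjective p
      have h2 : N.mkQ (g p) = N.mkQ x := hp
      rw [Submodule.mkQ_apply, Submodule.mkQ_apply, Submodule.Quotient.eq] at h2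
      have h3 := W.sub_mem (⟨p, rfl⟩ : g p ∈ W) (hfU h2)
      simpa using h3
  have : Module.Finite k (LinearMap.ker b) := by rw [hker]; infer_instance
  have : Module.Finite k ((V ⧸ N) ⧸ LinearMap.ker b) :=
    Module.Finite.equiv (b.quotKerEquivOfSurjective hbs).symm
  have hfinQ : Module.Finite k (V ⧸ N) := Module.Finite.of_submodule_quotient (LinearMap.ker b)
  have hQ : Module.finrank k (V ⧸ N) ≤ Module.finrank k (V ⧸ W) + Module.finrank k (P ⧸ I) := by
    rw [← LinearMap.finrank_range_add_finrank_ker b, LinearMap.range_eq_top.2 hbs, finrank_top,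
      hker]
    exact Nat.add_le_add_left (LinearMap.finrank_range_le a) _
  have hNr : N ≤ LinearMap.range f := by
    rintro _ ⟨u, -, rfl⟩
    exact ⟨u, rfl⟩
  let c : (V ⧸ N) →ₗ[k] V ⧸ LinearMap.range f := Submodule.factor hNr
  have hcs : Function.Surjective c := Submodule.factor_surjective hNr
  let e : (V ⧸ U) →ₗ[k] V ⧸ N := U.mapQ N f (Submodule.map_le_iff_le_comap.1 le_rfl)
  have hei : Function.Injective e := by
    rw [← LinearMap.ker_eq_bot, LinearMap.ker_eq_bot']
    intro x hx
    obtain ⟨x, rfl⟩ := U.mkQ_surjective x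
    have h1 : N.mkQ (f x) = 0 := hx
    rw [Submodule.mkQ_apply, Submodule.Quotient.mk_eq_zero] at h1
    obtain ⟨u, hu, hux⟩ := h1
    rw [Submodule.mkQ_apply, Submodule.Quotient.mk_eq_zero, ← hf hux]
    exact hu
  have hrange : LinearMap.range e ≤ LinearMap.ker c := by
    rintro _ ⟨x, rfl⟩
    obtain ⟨x, rfl⟩ := U.mkQ_surjective x
    have h1 : c (e (U.mkQ x)) = (LinearMap.range f).mkQ (f x) := rfl
    rw [LinearMap.mem_ker, h1, Submodule.mkQ_apply, Submodule.Quotient.mk_eq_zero]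
    exact ⟨x, rfl⟩
  have hfinU : Module.Finite k (V ⧸ U) := Module.Finite.of_injective e hei
  have hUW' : Module.finrank k (V ⧸ W) ≤ Module.finrank k (V ⧸ U) :=
    LinearMap.finrank_le_finrank_of_surjective (Submodule.factor_surjective hUW)
  have h1 : Module.finrank k (V ⧸ U) ≤ Module.finrank k (LinearMap.ker c) := by
    rw [← LinearMap.finrank_range_of_inj hei]
    exact Submodule.finrank_mono hrange
  have h2 := LinearMap.finrank_range_add_finrank_ker c
  rw [LinearMap.range_eq_top.2 hcs, finrank_top] at h2
  exact ⟨Module.Finite.of_surjective c hcs, by omega⟩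

open IsDedekindDomain

theorem finrank_quotient_lt_of_lt {k D : Type*} [Field k] [CommRing D] [Algebra k D]
    {I J : Ideal D} (h : I < J) [Module.Finite k (D ⧸ I)] :
    Module.finrank k (D ⧸ J) < Module.finrank k (D ⧸ I) := by
  let g : (D ⧸ I) →ₗ[k] D ⧸ J := (Ideal.Quotient.factorₐ k h.le).toLinearMap
  have hg : Function.Surjective g := Ideal.Quotient.factor_surjective h.le
  have : Module.Finite k (D ⧸ J) := Module.Finite.of_surjective g hg
  refine lt_of_le_of_ne (LinearMap.finrank_le_finrank_of_surjective hg) fun he => ?_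
  have hi := (LinearMap.injective_iff_surjective_of_finrank_eq_finrank he.symm).2 hg
  refine h.not_ge fun x hx => ?_
  have h1 : g (Ideal.Quotient.mk I x) = g 0 := by
    rw [map_zero]
    exact Ideal.Quotient.eq_zero_iff_mem.2 hx
  exact Ideal.Quotient.eq_zero_iff_mem.1 (hi h1)

theorem card_le_finrank_quotient_prod {k D : Type*} [Field k] [CommRing D] [Algebra k D]
    [IsDedekindDomain D] (s : Multiset (Ideal D)) (hs : ∀ P ∈ s, P ≠ ⊤) (h0 : ∀ P ∈ s, P ≠ ⊥)
    (hfin : Module.Finite k (D ⧸ s.prod)) : s.card ≤ Module.finrank k (D ⧸ s.prod) := by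
  induction s using Multiset.induction with
  | empty => simp
  | cons P s ih =>
    rw [Multiset.card_cons]
    have hne : s.prod ≠ ⊥ := by
      intro h
      rw [← Ideal.zero_eq_bot, Multiset.prod_eq_zero_iff] at h
      exact h0 0 (Multiset.mem_cons_of_mem h) rfl
    have hlt : (P ::ₘ s).prod < s.prod := by
      rw [Multiset.prod_cons]
      refine lt_of_le_of_ne Ideal.mul_le_right fun h => hs P (Multiset.mem_cons_self _ _) ?_
      have := mul_right_cancel₀ (b := s.prod) hne (h.trans (one_mul _).symm)
      rw [this, Ideal.one_eq_top]
    have h1 := finrank_quotient_lt_of_lt (k := k) hlt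
    have h2 : Module.Finite k (D ⧸ s.prod) :=
      Module.Finite.of_surjective (Ideal.Quotient.factorₐ k hlt.le).toLinearMap
        (Ideal.Quotient.factor_surjective hlt.le)
    have h3 := ih (fun Q hQ => hs Q (Multiset.mem_cons_of_mem hQ))
      (fun Q hQ => h0 Q (Multiset.mem_cons_of_mem hQ)) h2
    omega

theorem sum_le_finrank_quotient {k D : Type*} [Field k] [CommRing D] [Algebra k D]
    [IsDedekindDomain D] (T : Finset (HeightOneSpectrum D)) (e : HeightOneSpectrum D → ℕ)
    (I : Ideal D) (hI : ∀ P ∈ T, I ≤ P.asIdeal ^ e P) [Module.Finite k (D ⧸ I)] :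
    ∑ P ∈ T, e P ≤ Module.finrank k (D ⧸ I) := by
  have h1 : I ≤ ∏ P ∈ T, P.asIdeal ^ e P := by
    rw [← IsDedekindDomain.inf_pow_eq_prod_of_prime T _ e (fun P _ => P.prime)
      (fun P _ Q _ h he => h (HeightOneSpectrum.ext he))]
    exact Finset.le_inf hI
  let s : Multiset (Ideal D) := ∑ P ∈ T, Multiset.replicate (e P) P.asIdeal
  have hs : s.prod = ∏ P ∈ T, P.asIdeal ^ e P := by
    simp [s, Multiset.prod_sum]
  have hc : s.card = ∑ P ∈ T, e P := by simp [s]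
  have hmem : ∀ P ∈ s, ∃ Q : HeightOneSpectrum D, P = Q.asIdeal := by
    intro P hP
    obtain ⟨Q, -, hQ⟩ := Multiset.mem_sum.1 hP
    exact ⟨Q, Multiset.eq_of_mem_replicate hQ⟩
  rw [← hs] at h1
  let g := (Ideal.Quotient.factorₐ k h1).toLinearMap
  have hg : Function.Surjective g := Ideal.Quotient.factor_surjective h1
  rw [← hc]
  refine (card_le_finrank_quotient_prod (k := k) s ?_ ?_ (Module.Finite.of_surjective g hg)).trans
    (LinearMap.finrank_le_finrank_of_surjective hg)
  · intro P hP
    obtain ⟨Q, rfl⟩ := hmem P hP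
    exact Q.isPrime.ne_top
  · intro P hP
    obtain ⟨Q, rfl⟩ := hmem P hP
    exact Q.ne_bot

section place

variable {D F : Type*} [CommRing D] [IsDedekindDomain D] [Field F] [Algebra D F]
  [IsFractionRing D F]

theorem exists_heightOne_of_valuationSubring (R : ValuationSubring F) (hR : R ≠ ⊤)
    (hD : ∀ d : D, algebraMap D F d ∈ R) :
    ∃ P : HeightOneSpectrum D, ∀ x : F, x ∈ R ↔ P.valuation F x ≤ 1 := by
  let g : D →+* R := (algebraMap D F).codRestrict R.toSubring hD
  have hg : ∀ d, ((g d : R) : F) = algebraMap D F d := fun _ => rfl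
  let p : Ideal D := (IsLocalRing.maximalIdeal R).comap g
  have hp : p.IsPrime := Ideal.IsPrime.comap g
  have hunit : ∀ d : D, d ∉ p → (algebraMap D F d)⁻¹ ∈ R := by
    intro d hd
    have h1 : IsUnit (g d) := by
      by_contra h
      exact hd ((IsLocalRing.mem_maximalIdeal _).2 h)
    obtain ⟨u, hu⟩ := h1
    have h2 : algebraMap D F d * ((u⁻¹ : Rˣ) : R) = 1 := by
      rw [← hg, ← hu]
      exact congrArg Subtype.val u.mul_inv
    rw [inv_eq_of_mul_eq_one_right h2]
    exact (((u⁻¹ : Rˣ) : R)).2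
  have hp0 : p ≠ ⊥ := by
    intro h0
    refine hR (top_le_iff.1 fun x _ => ?_)
    obtain ⟨n, d, hd, rfl⟩ := IsFractionRing.div_surjective (A := D) x
    rw [div_eq_mul_inv]
    refine R.mul_mem _ _ (hD n) (hunit d fun h => ?_)
    rw [h0] at h
    exact nonZeroDivisors.ne_zero hd h
  refine ⟨⟨p, hp, hp0⟩, fun x => ?_⟩
  set P : HeightOneSpectrum D := ⟨p, hp, hp0⟩ with hP
  have hle : ∀ y : F, P.valuation F y ≤ 1 → y ∈ R := by
    intro y hy
    obtain ⟨n, d, hnd⟩ := P.exists_primeCompl_mul_eq_of_integer y hy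
    have hd0 : algebraMap D F (d : D) ≠ 0 := by
      intro h
      have : (d : D) = 0 := (IsFractionRing.injective D F) (by rw [h, map_zero])
      exact d.2 (by rw [this]; exact p.zero_mem)
    rw [eq_div_of_mul_eq hd0 hnd, div_eq_mul_inv]
    exact R.mul_mem _ _ (hD n) (hunit _ d.2)
  refine ⟨fun hx => ?_, hle x⟩
  by_contra! hlt
  have hx0 : x ≠ 0 := by
    rintro rfl
    rw [map_zero] at hlt
    exact not_lt_zero hlt
  have h1 : P.valuation F (x⁻¹) < 1 := by
    rw [map_inv₀]
    exact inv_lt_one_of_one_lt₀ hlt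
  obtain ⟨n, d, hnd⟩ := P.exists_primeCompl_mul_eq_of_integer x⁻¹ h1.le
  have hd1 : P.valuation F (algebraMap D F (d : D)) = 1 := by
    refine le_antisymm ?_ (not_lt.1 fun h => d.2 ?_)
    · rw [HeightOneSpectrum.valuation_of_algebraMap]
      exact P.intValuation_le_one _
    · exact (P.valuation_lt_one_iff_mem _).1 h
  have hn : n ∈ p := by
    refine (P.valuation_lt_one_iff_mem (K := F) n).1 ?_
    change P.valuation F (algebraMap D F n) < 1
    rw [← hnd, map_mul, hd1, mul_one]
    exact h1
  have h2 : x * algebraMap D F n = algebraMap D F (d : D) := by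
    rw [← hnd, mul_inv_cancel_left₀ hx0]
  have h3 : g d = (⟨x, hx⟩ : R) * g n := Subtype.ext h2.symm
  exact d.2 (show g d ∈ IsLocalRing.maximalIdeal R from h3 ▸ Ideal.mul_mem_left _ _ hn)

theorem mem_maximalIdeal_pow_iff {R : ValuationSubring F} {P : HeightOneSpectrum D}
    (hP : ∀ x : F, x ∈ R ↔ P.valuation F x ≤ 1) (m : ℕ) (x : F) :
    (∃ y ∈ IsLocalRing.maximalIdeal R ^ m, (y : F) = x) ↔
      P.valuation F x ≤ WithZero.exp (-(m : ℤ)) := by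
  obtain ⟨π, hπ⟩ := P.valuation_exists_uniformizer F
  have hπ0 : π ≠ 0 := by
    rintro rfl
    rw [map_zero] at hπ
    exact WithZero.exp_ne_zero hπ.symm
  have hunit : ∀ y : R, IsUnit y ↔ P.valuation F (y : F) = 1 := by
    intro y
    constructor
    · rintro ⟨u, rfl⟩
      refine le_antisymm ((hP _).1 (u : R).2) ?_
      have h1 : P.valuation F ((u : R) : F) * P.valuation F (((u⁻¹ : Rˣ) : R) : F) = 1 := by
        rw [← map_mul, ← map_one (P.valuation F)]
        exact congrArg (fun z : R => P.valuation F (z : F)) u.mul_inv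
      rw [← h1]
      exact mul_le_of_le_one_right' ((hP _).1 ((u⁻¹ : Rˣ) : R).2)
    · intro h
      have h0 : (y : F) ≠ 0 := by
        intro h0
        rw [h0, map_zero] at h
        exact zero_ne_one h
      refine IsUnit.of_mul_eq_one (⟨(y : F)⁻¹, (hP _).2 ?_⟩ : R)
        (Subtype.ext (mul_inv_cancel₀ h0))
      rw [map_inv₀, h, inv_one]
  have hπR : π ∈ R := by
    rw [hP, hπ, ← WithZero.exp_zero, WithZero.exp_le_exp]
    norm_num
  have hdiv : ∀ (n : ℕ) (y : F), P.valuation F y ≤ WithZero.exp (-(n : ℤ)) → y / π ^ n ∈ R := by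
    intro n y hy
    rw [hP, map_div₀, map_pow, hπ, ← WithZero.exp_nsmul]
    refine div_le_one_of_le₀ (hy.trans_eq ?_) zero_le
    congr 1
    simp
  have hmax : IsLocalRing.maximalIdeal R = Ideal.span {(⟨π, hπR⟩ : R)} := by
    ext y
    rw [IsLocalRing.mem_maximalIdeal, mem_nonunits_iff, hunit, Ideal.mem_span_singleton]
    constructor
    · intro h
      have h1 : P.valuation F (y : F) < WithZero.exp 0 := by
        rw [WithZero.exp_zero]
        exact lt_of_le_of_ne ((hP _).1 y.2) h
      have h2 : P.valuation F (y : F) ≤ WithZero.exp (-((1 : ℕ) : ℤ)) := by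
        rcases eq_or_ne (P.valuation F (y : F)) 0 with h0 | h0
        · rw [h0]; exact zero_le
        · rw [← WithZero.exp_log h0] at h1 ⊢
          rw [WithZero.exp_lt_exp] at h1
          rw [WithZero.exp_le_exp]
          push_cast
          omega
      refine ⟨⟨_, hdiv 1 _ h2⟩, Subtype.ext ?_⟩
      change (y : F) = π * (y / π ^ 1)
      field_simp
    · rintro ⟨z, rfl⟩ h
      have h1 : P.valuation F (π * z) = 1 := h
      rw [map_mul, hπ] at h1
      have h2 : (WithZero.exp (-1) : WithZero (Multiplicative ℤ)) < 1 := by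
        rw [← WithZero.exp_zero, WithZero.exp_lt_exp]; norm_num
      exact absurd h1 (ne_of_lt (lt_of_le_of_lt (mul_le_of_le_one_right' ((hP _).1 z.2)) h2))
  rw [hmax, Ideal.span_singleton_pow]
  constructor
  · rintro ⟨y, hy, rfl⟩
    obtain ⟨z, rfl⟩ := Ideal.mem_span_singleton.1 hy
    change P.valuation F (π ^ m * z) ≤ _
    rw [map_mul, map_pow, hπ, ← WithZero.exp_nsmul]
    refine (mul_le_of_le_one_right' ((hP _).1 z.2)).trans_eq ?_
    congr 1
    simp
  · intro h
    refine ⟨(⟨π, hπR⟩ : R) ^ m * ⟨_, hdiv m x h⟩,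
      Ideal.mul_mem_right _ _ (Ideal.mem_span_singleton_self _), ?_⟩
    change π ^ m * (x / π ^ m) = x
    field_simp

end place

open Polynomial

theorem finite_quotient_polynomial {k : Type*} [Field k] (I : Ideal k[X]) (hI : I ≠ ⊥) :
    Module.Finite k (k[X] ⧸ I) := by
  obtain ⟨p, hp, hp0⟩ := Submodule.exists_mem_ne_zero_of_ne_bot hI
  have h1 : Module.Finite k (k[X] ⧸ Ideal.span {p}) := (AdjoinRoot.powerBasis hp0).finite
  have h2 : Ideal.span {p} ≤ I := (Ideal.span_singleton_le_iff_mem _).2 hp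
  exact Module.Finite.of_surjective (Ideal.Quotient.factorₐ k h2).toLinearMap
    (Ideal.Quotient.factor_surjective h2)

theorem finite_quotient_of_finite_polynomial {k B : Type*} [Field k] [CommRing B] [IsDomain B]
    [Algebra k B] [Algebra k[X] B] [IsScalarTower k k[X] B] [Module.Finite k[X] B]
    {I : Ideal B} (hI : I ≠ ⊥) : Module.Finite k (B ⧸ I) := by
  obtain ⟨c, hc, hc0⟩ := Submodule.exists_mem_ne_zero_of_ne_bot hI
  have h1 : I.comap (algebraMap k[X] B) ≠ ⊥ :=
    Ideal.comap_ne_bot_of_integral_mem hc0 hc (Algebra.IsIntegral.isIntegral (R := k[X]) c)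
  have h2 := finite_quotient_polynomial _ h1
  have h3 : Module.Finite (k[X] ⧸ I.comap (algebraMap k[X] B)) (B ⧸ I) :=
    Module.Finite.of_restrictScalars_finite k[X] _ _
  have h4 : IsScalarTower k (k[X] ⧸ I.comap (algebraMap k[X] B)) (B ⧸ I) := by
    refine IsScalarTower.of_algebraMap_eq (R := k)
      (S := k[X] ⧸ I.comap (algebraMap k[X] B)) (A := B ⧸ I) fun x => ?_
    exact congrArg (Ideal.Quotient.mk I) (IsScalarTower.algebraMap_apply k k[X] B x)
  exact Module.Finite.trans (k[X] ⧸ I.comap (algebraMap k[X] B)) (B ⧸ I)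

theorem exists_finite_polynomial_algHom {k O : Type} [Field k] [CommRing O] [IsDomain O]
    [Algebra k O] [Algebra.FiniteType k O] (h : Algebra.trdeg k O = 1) :
    ∃ g : k[X] →ₐ[k] O, Function.Injective g ∧ g.Finite := by
  obtain ⟨s, g, hg, hgf⟩ := exists_finite_inj_algHom_of_fg k O
  let : Algebra (MvPolynomial (Fin s) k) O := g.toRingHom.toAlgebra
  have : IsScalarTower k (MvPolynomial (Fin s) k) O :=
    IsScalarTower.of_algebraMap_eq fun x => (g.commutes x).symm
  have : FaithfulSMul (MvPolynomial (Fin s) k) O :=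
    (faithfulSMul_iff_algebraMap_injective _ _).2 hg
  have : Module.Finite (MvPolynomial (Fin s) k) O := hgf
  have h0 : Algebra.trdeg (MvPolynomial (Fin s) k) O = 0 := trdeg_eq_zero
  have h1 := trdeg_add_eq k (MvPolynomial (Fin s) k) (A := O)
  rw [h0, h, MvPolynomial.trdeg_of_isDomain] at h1
  obtain rfl : s = 1 := by simpa using h1
  let e := MvPolynomial.uniqueAlgEquiv k (Fin 1)
  refine ⟨g.comp e.symm.toAlgHom, hg.comp e.symm.injective, ?_⟩
  exact AlgHom.Finite.comp hgf (AlgHom.Finite.of_surjective _ e.symm.surjective)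

theorem finiteDimensional_of_fraction {R K O F : Type*} [CommRing R] [IsDomain R] [Field K]
    [CommRing O] [IsDomain O] [Field F] [Algebra R K] [IsFractionRing R K] [Algebra R O]
    [Module.Finite R O] [Algebra O F] [IsFractionRing O F] [Algebra R F] [Algebra K F]
    [IsScalarTower R K F] [IsScalarTower R O F] : FiniteDimensional K F := by
  obtain ⟨t, ht⟩ := (inferInstance : Module.Finite R O)
  let S : Set F := algebraMap O F '' t
  have : Finite S := (t.finite_toSet.image _).to_subtype
  have hfin : FiniteDimensional K (IntermediateField.adjoin K S) := by
    refine IntermediateField.finiteDimensional_adjoin ?_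
    rintro _ ⟨x, -, rfl⟩
    exact ((Algebra.IsIntegral.isIntegral (R := R) x).map
      (IsScalarTower.toAlgHom R O F)).tower_top
  have hO : ∀ x : O, algebraMap O F x ∈ IntermediateField.adjoin K S := by
    intro x
    have hx : x ∈ Submodule.span R (t : Set O) := ht ▸ Submodule.mem_top
    induction hx using Submodule.span_induction with
    | mem x hx => exact IntermediateField.subset_adjoin _ _ ⟨x, hx, rfl⟩
    | zero => rw [map_zero]; exact zero_mem _
    | add x y _ _ hx hy => rw [map_add]; exact add_mem hx hy
    | smul r x _ hx =>
      rw [Algebra.smul_def, map_mul, ← IsScalarTower.algebraMap_apply,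
        IsScalarTower.algebraMap_apply R K F]
      exact mul_mem ((IntermediateField.adjoin K S).algebraMap_mem _) hx
  have htop : IntermediateField.adjoin K S = ⊤ := by
    refine top_le_iff.1 fun x _ => ?_
    obtain ⟨n, d, -, rfl⟩ := IsFractionRing.div_surjective (A := O) x
    exact div_mem (hO n) (hO d)
  rw [htop] at hfin
  exact Module.Finite.equiv (IntermediateField.topEquiv (F := K) (E := F)).toLinearEquiv

theorem trdeg_subalgebra_eq {k F : Type} [Field k] [Field F] [Algebra k F]
    (O : Subalgebra k F) [IsFractionRing O F] : Algebra.trdeg k O = Algebra.trdeg k F := by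
  have h0 : Algebra.trdeg O F = 0 := by
    have : Algebra.IsAlgebraic O F := IsLocalization.isAlgebraic (S := F) (nonZeroDivisors O)
    exact trdeg_eq_zero
  have h1 := trdeg_add_eq k O (A := F)
  rwa [h0, add_zero] at h1

theorem curve_normalization {k F : Type} [Field k] [CharZero k] [Field F] [Algebra k F]
    (O : Subalgebra k F) (hO : O.FG) [IsFractionRing O F] (h : Algebra.trdeg k F = 1) :
    IsDedekindDomain (integralClosure O F) ∧ IsFractionRing (integralClosure O F) F ∧
    (∀ I : Ideal O, I ≠ ⊥ → Module.Finite k (O ⧸ I)) ∧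
    (∀ I : Ideal (integralClosure O F), I ≠ ⊥ → Module.Finite k (integralClosure O F ⧸ I)) ∧
    Module.Finite k (integralClosure O F ⧸
      LinearMap.range (IsScalarTower.toAlgHom k O (integralClosure O F)).toLinearMap) := by
  have : Algebra.FiniteType k O := O.fg_iff_finiteType.1 hO
  have hO1 : Algebra.trdeg k O = 1 := (trdeg_subalgebra_eq O).trans h
  obtain ⟨g, hg, hgf⟩ := exists_finite_polynomial_algHom hO1
  let : Algebra k[X] O := g.toRingHom.toAlgebra
  have : IsScalarTower k k[X] O :=
    IsScalarTower.of_algebraMap_eq fun x => (g.commutes x).symm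
  have hfO : Module.Finite k[X] O := hgf
  let : Algebra k[X] F := ((algebraMap O F).comp g.toRingHom).toAlgebra
  have : IsScalarTower k[X] O F := IsScalarTower.of_algebraMap_eq fun x => rfl
  have : IsScalarTower k k[X] F := IsScalarTower.of_algebraMap_eq fun x => by
    rw [IsScalarTower.algebraMap_apply k[X] O F, ← IsScalarTower.algebraMap_apply k k[X] O]
    rfl
  have : FaithfulSMul k[X] F := (faithfulSMul_iff_algebraMap_injective _ _).2
    ((IsFractionRing.injective O F).comp hg)
  let L := FractionRing k[X]
  let : Algebra L F := FractionRing.liftAlgebra k[X] F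
  have : IsScalarTower k[X] L F := FractionRing.isScalarTower_liftAlgebra k[X] F
  have : FiniteDimensional L F := finiteDimensional_of_fraction (R := k[X]) (O := O)
  let D := integralClosure O F
  have : IsScalarTower k[X] D F := IsScalarTower.of_algebraMap_eq fun x => rfl
  have : IsIntegralClosure D k[X] F := by
    refine ⟨Subtype.val_injective, fun {x} => ⟨fun hx => ⟨⟨x, hx.tower_top⟩, rfl⟩, ?_⟩⟩
    rintro ⟨y, rfl⟩
    exact isIntegral_trans (A := O) _ y.2
  have : CharZero k[X] := charZero_of_injective_algebraMap (algebraMap k k[X]).injective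
  have : CharZero L := charZero_of_injective_algebraMap (IsFractionRing.injective k[X] L)
  have hfD : Module.Finite k[X] D := IsIntegralClosure.finite k[X] L F D
  have : IsScalarTower k k[X] D := IsScalarTower.of_algebraMap_eq fun x => by
    apply Subtype.ext
    change algebraMap k F x = algebraMap k[X] F (algebraMap k k[X] x)
    rw [← IsScalarTower.algebraMap_apply]
  have hDfin : ∀ I : Ideal D, I ≠ ⊥ → Module.Finite k (D ⧸ I) := fun I hI =>
    finite_quotient_of_finite_polynomial hI
  refine ⟨IsIntegralClosure.isDedekindDomain k[X] L F D,
    IsIntegralClosure.isFractionRing_of_finite_extension k[X] L F D,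
    fun I hI => finite_quotient_of_finite_polynomial hI, hDfin, ?_⟩
  have : IsScalarTower k[X] O D := IsScalarTower.of_algebraMap_eq fun x => rfl
  obtain ⟨t, ht⟩ := (Module.Finite.of_restrictScalars_finite k[X] O D)
  obtain ⟨b, hb⟩ := IsLocalization.exist_integer_multiples_of_finset (nonZeroDivisors O)
    (t.map ⟨(Subtype.val : D → F), Subtype.val_injective⟩)
  have hb0 : (b : O) ≠ 0 := nonZeroDivisors.ne_zero b.2
  have hbD : ∀ d : D, ∃ o : O, algebraMap O D o = algebraMap O D b * d := by
    intro d
    have hd : d ∈ Submodule.span O (t : Set D) := ht ▸ Submodule.mem_top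
    induction hd using Submodule.span_induction with
    | mem x hx =>
      obtain ⟨o, ho⟩ := hb x (by simpa using hx)
      exact ⟨o, Subtype.ext (by rw [Algebra.smul_def] at ho; exact ho)⟩
    | zero => exact ⟨0, by simp⟩
    | add x y _ _ hx hy =>
      obtain ⟨o, ho⟩ := hx
      obtain ⟨o', ho'⟩ := hy
      exact ⟨o + o', by rw [map_add, ho, ho', mul_add]⟩
    | smul r x _ hx =>
      obtain ⟨o, ho⟩ := hx
      exact ⟨r * o, by rw [map_mul, ho, Algebra.smul_def]; ring⟩
  let I : Ideal D := Ideal.span {algebraMap O D b}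
  have hI : I ≠ ⊥ := by
    intro h
    have h1 : algebraMap O D b = 0 := Ideal.span_singleton_eq_bot.1 h
    exact hb0 (Subtype.ext (congrArg (fun d : D => (d : F)) h1))
  have := hDfin I hI
  let W := LinearMap.range (IsScalarTower.toAlgHom k O D).toLinearMap
  have hIW : I.restrictScalars k ≤ W := by
    intro x hx
    obtain ⟨d, rfl⟩ := Ideal.mem_span_singleton.1 hx
    obtain ⟨o, ho⟩ := hbD d
    exact ⟨o, ho⟩
  have : Module.Finite k (D ⧸ I.restrictScalars k) := hDfin I hI
  exact Module.Finite.of_surjective (Submodule.factor hIW) (Submodule.factor_surjective hIW)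

theorem exists_infinite_points {O : Type} [CommRing O] [IsDomain O] [Algebra ℂ O]
    [Algebra.FiniteType ℂ O] (h0 : ¬ Algebra.IsAlgebraic ℂ O) (h1 : Algebra.trdeg ℂ O ≠ 1) :
    ∃ x : O, x ≠ 0 ∧ ∃ ψ : ℂ → (O →ₐ[ℂ] ℂ), Function.Injective ψ ∧ ∀ z, ψ z x = 0 := by
  obtain ⟨s, g, hg, hgf⟩ := exists_finite_inj_algHom_of_fg ℂ O
  let : Algebra (MvPolynomial (Fin s) ℂ) O := g.toRingHom.toAlgebra
  have : IsScalarTower ℂ (MvPolynomial (Fin s) ℂ) O :=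
    IsScalarTower.of_algebraMap_eq fun x => (g.commutes x).symm
  have : FaithfulSMul (MvPolynomial (Fin s) ℂ) O :=
    (faithfulSMul_iff_algebraMap_injective _ _).2 hg
  have : Module.Finite (MvPolynomial (Fin s) ℂ) O := hgf
  have h2 : Algebra.trdeg (MvPolynomial (Fin s) ℂ) O = 0 := trdeg_eq_zero
  have h3 := trdeg_add_eq ℂ (MvPolynomial (Fin s) ℂ) (A := O)
  rw [h2, MvPolynomial.trdeg_of_isDomain, add_zero] at h3
  have hs : 2 ≤ s := by
    rcases s with _ | _ | s
    · exact absurd (trdeg_eq_zero_iff.1 (by simpa using h3.symm)) h0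
    · exact absurd (by simpa using h3.symm) h1
    · omega
  let i0 : Fin s := ⟨0, by omega⟩
  let i1 : Fin s := ⟨1, by omega⟩
  have h01 : i1 ≠ i0 := by simp [i0, i1]
  have key : ∀ z : ℂ, ∃ ψ : O →ₐ[ℂ] ℂ, ψ (g (.X i0)) = 0 ∧ ψ (g (.X i1)) = z := by
    intro z
    let e : MvPolynomial (Fin s) ℂ →ₐ[ℂ] ℂ := MvPolynomial.aeval fun i => if i = i0 then 0 else z
    have he : Function.Surjective e := fun c => ⟨MvPolynomial.C c, by simp [e]⟩
    have hmax : (RingHom.ker e).IsMaximal := RingHom.ker_isMaximal_of_surjective e he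
    obtain ⟨Q, hQ, hQc⟩ := Ideal.exists_ideal_over_maximal_of_isIntegral (S := O) (RingHom.ker e)
      (by
        intro x hx
        have hx0 : x = 0 := hg (by rw [map_zero]; exact hx)
        rw [hx0]; exact Ideal.zero_mem _)
    let : Field (O ⧸ Q) := Ideal.Quotient.field Q
    have hfin : Module.Finite ℂ (O ⧸ Q) := finite_of_finite_type_of_isJacobsonRing ℂ (O ⧸ Q)
    have hbij : Function.Bijective (algebraMap ℂ (O ⧸ Q)) :=
      IsAlgClosed.algebraMap_bijective_of_isIntegral
    let E : ℂ ≃ₐ[ℂ] O ⧸ Q := AlgEquiv.ofBijective (Algebra.ofId ℂ (O ⧸ Q)) hbij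
    have hψ : ∀ p c, e p = c → E.symm (Ideal.Quotient.mkₐ ℂ Q (g p)) = c := by
      intro p c hp
      have hm : p - MvPolynomial.C c ∈ RingHom.ker e := by
        rw [RingHom.mem_ker, map_sub, hp]
        simp [e]
      rw [← hQc] at hm
      have hm' : g (p - MvPolynomial.C c) ∈ Q := hm
      have hc : g (MvPolynomial.C c) = algebraMap ℂ O c := g.commutes c
      rw [map_sub, hc, ← Ideal.Quotient.eq] at hm'
      rw [AlgEquiv.symm_apply_eq]
      exact hm'
    exact ⟨E.symm.toAlgHom.comp (Ideal.Quotient.mkₐ ℂ Q),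
      hψ _ _ (by simp [e]), hψ _ _ (by simp [e, h01])⟩
  choose ψ hψ0 hψ1 using key
  refine ⟨g (.X i0), ?_, ψ, ?_, hψ0⟩
  · intro h
    exact MvPolynomial.X_ne_zero i0 (hg (by rw [h, map_zero]))
  · intro z w h
    rw [← hψ1 z, h, hψ1 w]

section zariski

variable {n : ℕ}

/-- The polynomial in the scaling factors obtained by rescaling each pair of homogeneous
coordinates. -/
def scale {L : Type*} [CommRing L] [Algebra ℂ L] (w : Fin n × Fin 2 → L) :
    MvPolynomial (Fin n × Fin 2) ℂ →ₐ[ℂ] MvPolynomial (Fin n) L :=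
  MvPolynomial.aeval fun x => MvPolynomial.X x.1 * MvPolynomial.C (w x)

theorem eval_scale {L : Type*} [CommRing L] [Algebra ℂ L] (w : Fin n × Fin 2 → L)
    (d : Fin n → L) (f : MvPolynomial (Fin n × Fin 2) ℂ) :
    MvPolynomial.eval d (scale w f) = MvPolynomial.aeval (fun x => d x.1 * w x) f := by
  have h : ((MvPolynomial.aeval d : MvPolynomial (Fin n) L →ₐ[L] L).restrictScalars ℂ).comp
      (scale w) = MvPolynomial.aeval (fun x => d x.1 * w x) := by
    ext x
    simp [scale]
  have := DFunLike.congr_fun h f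
  rw [← this]
  simp [MvPolynomial.aeval_eq_eval]

theorem scale_eq_zero {L : Type*} [Field L] [Algebra ℂ L] (w : Fin n × Fin 2 → L)
    (f : MvPolynomial (Fin n × Fin 2) ℂ)
    (h : ∀ d : Fin n → ℂ, (∀ i, d i ≠ 0) →
      MvPolynomial.aeval (fun x => algebraMap ℂ L (d x.1) * w x) f = 0) : scale w f = 0 := by
  refine MvPolynomial.funext_set (fun _ => algebraMap ℂ L '' {0}ᶜ) (fun _ => ?_) fun d hd => ?_
  · exact (Set.Infinite.image (algebraMap ℂ L).injective.injOn
      (Set.finite_singleton (0 : ℂ)).infinite_compl)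
  · choose e he hed using fun i => hd i (Set.mem_univ i)
    obtain rfl : (fun i => algebraMap ℂ L (e i)) = d := funext hed
    rw [eval_scale, h e he, map_zero]

/-- The chosen homogeneous coordinates of a point. -/
def P1Pow.rep (p : P1Pow n) (x : Fin n × Fin 2) : ℂ := (p x.1).rep x.2

theorem mem_cone_iff {C : Set (P1Pow n)} {v : Fin n × Fin 2 → ℂ} :
    v ∈ cone C ↔ ∃ p ∈ C, ∃ d : Fin n → ℂ, (∀ i, d i ≠ 0) ∧ v = fun x => d x.1 * p.rep x := by
  constructor
  · rintro ⟨hv, hvC⟩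
    refine ⟨_, hvC, ?_⟩
    choose d hd using fun i => Projectivization.exists_smul_eq_mk_rep ℂ _ (hv i)
    refine ⟨fun i => ((d i)⁻¹ : ℂˣ), fun i => Units.ne_zero _, funext fun x => ?_⟩
    have h1 := congrFun (hd x.1) x.2
    change d x.1 • v x = _ at h1
    change v x = ((d x.1)⁻¹ : ℂˣ) * (Projectivization.mk ℂ _ (hv x.1)).rep x.2
    rw [← h1, Units.smul_def, smul_eq_mul, Units.inv_mul_cancel_left]
  · rintro ⟨p, hp, d, hd, rfl⟩
    have hne : ∀ i, (fun j => d i * p.rep (i, j)) ≠ 0 := by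
      intro i h0
      refine (p i).rep_nonzero (funext fun j => ?_)
      have := congrFun h0 j
      exact (mul_eq_zero.1 this).resolve_left (hd i)
    refine ⟨hne, ?_⟩
    have h1 : (fun i => Projectivization.mk ℂ (fun j => d i * p.rep (i, j)) (hne i)) = p := by
      funext i
      conv_rhs => rw [← (p i).mk_rep]
      rw [Projectivization.mk_eq_mk_iff']
      exact ⟨d i, rfl⟩
    exact (congrArg (· ∈ C) h1).mpr hp

theorem rep_mem_cone {C : Set (P1Pow n)} {p : P1Pow n} (hp : p ∈ C) : p.rep ∈ cone C :=
  mem_cone_iff.2 ⟨p, hp, 1, fun _ => one_ne_zero, by simp⟩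

theorem mem_basicOpen_iff {f : MvPolynomial (Fin n × Fin 2) ℂ} {p : P1Pow n} :
    p ∈ basicOpen f ↔ scale p.rep f ≠ 0 := by
  constructor
  · rintro ⟨v, hv, hf⟩ h0
    obtain ⟨q, rfl, d, -, rfl⟩ := mem_cone_iff.1 hv
    rw [← eval_scale, h0, map_zero] at hf
    exact hf rfl
  · intro h
    by_contra hp
    refine h (scale_eq_zero _ _ fun d hd => ?_)
    by_contra h1
    exact hp ⟨_, mem_cone_iff.2 ⟨p, rfl, d, hd, rfl⟩, h1⟩

theorem basicOpen_mul (f g : MvPolynomial (Fin n × Fin 2) ℂ) :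
    basicOpen (f * g) = basicOpen f ∩ basicOpen g := by
  ext p
  rw [Set.mem_inter_iff, mem_basicOpen_iff, mem_basicOpen_iff, mem_basicOpen_iff, map_mul,
    mul_ne_zero_iff]

theorem isTopologicalBasis_basicOpen :
    TopologicalSpace.IsTopologicalBasis (Set.range (basicOpen (n := n))) where
  exists_subset_inter := by
    rintro _ ⟨f, rfl⟩ _ ⟨g, rfl⟩ p hp
    exact ⟨_, ⟨f * g, rfl⟩, basicOpen_mul f g ▸ hp, (basicOpen_mul f g).le⟩
  sUnion_eq := by
    refine Set.eq_univ_of_forall fun p => ⟨_, ⟨1, rfl⟩, mem_basicOpen_iff.2 ?_⟩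
    rw [map_one]
    exact one_ne_zero
  eq_generateFrom := rfl

theorem isOpen_basicOpen (f : MvPolynomial (Fin n × Fin 2) ℂ) : IsOpen (basicOpen f) :=
  TopologicalSpace.isOpen_generateFrom_of_mem ⟨f, rfl⟩

theorem mem_coneIdeal_iff {C : Set (P1Pow n)} {f : MvPolynomial (Fin n × Fin 2) ℂ} :
    f ∈ coneIdeal C ↔ ∀ p ∈ C, scale p.rep f = 0 := by
  rw [coneIdeal, MvPolynomial.mem_vanishingIdeal_iff]
  constructor
  · intro h p hp
    by_contra h0
    obtain ⟨v, hv, hf⟩ := mem_basicOpen_iff.2 h0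
    obtain ⟨q, rfl, d, hd, rfl⟩ := mem_cone_iff.1 hv
    exact hf (h _ (mem_cone_iff.2 ⟨_, hp, d, hd, rfl⟩))
  · intro h v hv
    obtain ⟨p, hp, d, -, rfl⟩ := mem_cone_iff.1 hv
    rw [← eval_scale, h p hp, map_zero]

theorem mem_iff_of_isClosed {C : Set (P1Pow n)} (hC : IsClosed C) {p : P1Pow n} :
    p ∈ C ↔ ∀ f ∈ coneIdeal C, scale p.rep f = 0 := by
  refine ⟨fun hp f hf => mem_coneIdeal_iff.1 hf p hp, fun h => ?_⟩
  by_contra hp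
  obtain ⟨_, ⟨f, rfl⟩, hpf, hf⟩ :=
    isTopologicalBasis_basicOpen.exists_subset_of_mem_open (show p ∈ Cᶜ from hp) hC.isOpen_compl
  refine mem_basicOpen_iff.1 hpf (h f (mem_coneIdeal_iff.2 fun q hq => ?_))
  by_contra h0
  exact hf (mem_basicOpen_iff.2 h0) hq

instance : TopologicalSpace.NoetherianSpace (P1Pow n) := by
  refine ((TopologicalSpace.noetherianSpace_TFAE (P1Pow n)).out 0 1).2 ?_
  have hmono : StrictAnti fun C : TopologicalSpace.Closeds (P1Pow n) =>
      coneIdeal (C : Set (P1Pow n)) := by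
    intro C C' h
    refine lt_of_le_of_ne (fun f hf => ?_) fun he => h.not_ge fun p hp => ?_
    · exact mem_coneIdeal_iff.2 fun p hp => mem_coneIdeal_iff.1 hf p (h.le hp)
    · exact (mem_iff_of_isClosed C.isClosed).2 ((show coneIdeal _ = coneIdeal _ from he) ▸ (mem_iff_of_isClosed C'.isClosed).1 hp)
  have hwf : WellFoundedGT (Ideal (MvPolynomial (Fin n × Fin 2) ℂ)) := inferInstance
  exact ⟨Subrelation.wf (fun {a b} (h : a < b) => hmono h)
    (InvImage.wf (fun C : TopologicalSpace.Closeds (P1Pow n) => coneIdeal (C : Set (P1Pow n)))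
      hwf.wf)⟩

theorem isClosed_singleton_point (p : P1Pow n) : IsClosed ({p} : Set (P1Pow n)) := by
  refine isClosed_of_closure_subset fun q hq => funext fun i => ?_
  let f : MvPolynomial (Fin n × Fin 2) ℂ :=
    MvPolynomial.X (i, 0) * MvPolynomial.C (p.rep (i, 1)) -
      MvPolynomial.X (i, 1) * MvPolynomial.C (p.rep (i, 0))
  have hf : ∀ r : P1Pow n, scale r.rep f =
      MvPolynomial.X i * MvPolynomial.C (r.rep (i, 0) * p.rep (i, 1) -
        r.rep (i, 1) * p.rep (i, 0)) := by
    intro r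
    simp only [f, scale, map_sub, map_mul, MvPolynomial.aeval_X, MvPolynomial.algHom_C,
      MvPolynomial.algebraMap_eq]
    ring
  have h0 : scale q.rep f = 0 := by
    by_contra h
    obtain ⟨r, hr, rfl⟩ := mem_closure_iff.1 hq _ (isOpen_basicOpen f) (mem_basicOpen_iff.2 h)
    exact mem_basicOpen_iff.1 hr (by
      rw [hf, mul_comm (r.rep (i, 0)), mul_comm (r.rep (i, 1))]
      simp)
  rw [hf, mul_eq_zero, or_iff_right (MvPolynomial.X_ne_zero i), MvPolynomial.C_eq_zero,
    sub_eq_zero] at h0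
  rw [← (q i).mk_rep, ← (p i).mk_rep, Projectivization.mk_eq_mk_iff']
  change (q i).rep 0 * (p i).rep 1 = (q i).rep 1 * (p i).rep 0 at h0
  have hp := (p i).rep_nonzero
  by_cases hp1 : (p i).rep 1 = 0
  · have hp0 : (p i).rep 0 ≠ 0 := fun h => hp (funext fun j => by fin_cases j <;> assumption)
    rw [hp1, mul_zero, eq_comm, mul_eq_zero, or_iff_left hp0] at h0
    refine ⟨(q i).rep 0 / (p i).rep 0, funext fun j => ?_⟩
    fin_cases j
    · simp [hp0]
    · simp [hp1, h0]
  · refine ⟨(q i).rep 1 / (p i).rep 1, funext fun j => ?_⟩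
    fin_cases j
    · change (q i).rep 1 / (p i).rep 1 * (p i).rep 0 = (q i).rep 0
      rw [div_mul_eq_mul_div, ← h0, mul_div_assoc, div_self hp1, mul_one]
    · simp [hp1]

end zariski

theorem DQ.of_list_prod {A : Type*} [CommRing A] (l : List (DualQuat A)) :
    DQ.of l.prod = (l.map DQ.of).prod := by
  induction l with
  | nil => exact DQ.of_one
  | cons a l ih => rw [List.prod_cons, DQ.of_mul, ih, List.map_cons, List.prod_cons]

theorem DQ.coords_one_zero {A : Type*} [CommRing A] : (1 : DQ A).coords 0 = 1 := by
  rw [DQ.coords_one]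
  rfl

theorem DQ.coords_one_of_ne {A : Type*} [CommRing A] {c : Fin 8} (hc : c ≠ 0) :
    (1 : DQ A).coords c = 0 := by
  rw [DQ.coords_one]
  fin_cases c
  · exact absurd rfl hc
  all_goals rfl

theorem list_prod_map_smul {A M ι : Type*} [CommRing A] [Ring M] [Algebra A M] (l : List ι)
    (d : ι → A) (a : ι → M) :
    (l.map fun k => d k • a k).prod = (l.map d).prod • (l.map a).prod := by
  induction l with
  | nil => simp
  | cons k l ih => rw [List.map_cons, List.prod_cons, ih, List.map_cons, List.prod_cons,
      List.map_cons, List.prod_cons, smul_mul_smul_comm]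

section chain

variable {A B : Type*} [CommRing A] [CommRing B] {n : ℕ} (h : Fin n → DualQuat ℝ)

theorem of_chain (φ : ℝ →+* A) (v : Fin n → Fin 2 → A) (i j : ℕ) :
    DQ.of (chain φ h v i j) = ((((List.finRange n).take j).drop i).map fun k =>
      v k 0 • (1 : DQ A) - v k 1 • DQ.map φ (DQ.of (h k))).prod := by
  rw [chain, DQ.of_list_prod, List.map_map]
  refine congrArg List.prod (List.map_congr_left fun k _ => ?_)
  simp only [Function.comp_apply, sub_eq_add_neg]
  rw [DQ.of_add, DQ.of_neg, DQ.of_smul, DQ.of_smul, DQ.of_one, DQ.of_baseChange]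

theorem map_of_chain (φ : ℝ →+* A) (ψ : A →+* B) (v : Fin n → Fin 2 → A) (i j : ℕ) :
    DQ.map ψ (DQ.of (chain φ h v i j)) =
      DQ.of (chain (ψ.comp φ) h (fun k l => ψ (v k l)) i j) := by
  rw [of_chain, of_chain, map_list_prod, List.map_map]
  congr 2
  funext k
  rw [Function.comp_apply, _root_.map_sub, DQ.map_smul, DQ.map_smul, _root_.map_one, DQ.map_map]

theorem of_chain_mul (φ : ℝ →+* A) (d : Fin n → A) (v : Fin n → Fin 2 → A) (i j : ℕ) :
    DQ.of (chain φ h (fun k l => d k * v k l) i j) =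
      ((((List.finRange n).take j).drop i).map d).prod • DQ.of (chain φ h v i j) := by
  rw [of_chain, of_chain, ← list_prod_map_smul]
  congr 2
  funext k
  rw [mul_smul, mul_smul, smul_sub]

end chain

namespace ConfigCurve

variable {n : ℕ} {h : Fin n → DualQuat ℝ} (K : ConfigCurve h)

theorem isClosed_carrier : IsClosed K.carrier := by
  have h1 : IsIrreducible (closure K.carrier) := K.isComponent.1.1.closure
  have h2 : closure K.carrier ⊆ configClosure h :=
    closure_minimal K.isComponent.1.2 isClosed_closure
  exact isClosed_of_closure_subset (K.isComponent.2 ⟨h1, h2⟩ subset_closure)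

theorem exists_configSet_mem : ∃ p ∈ configSet h, (fun i => toComplex (p i) : P1Pow n) ∈ K.carrier := by
  by_contra! hcon
  obtain ⟨T, hT, hTc, hTi, hTu⟩ :=
    TopologicalSpace.NoetherianSpace.exists_finite_set_isClosed_irreducible
      (isClosed_closure : IsClosed (configClosure h))
  have hsub : configClosure h ⊆ ⋃₀ (T \ {K.carrier}) := by
    refine closure_minimal ?_ (by
      rw [Set.sUnion_eq_biUnion]
      exact (hT.subset Set.sdiff_subset).isClosed_biUnion fun t ht => hTc t ht.1)
    rintro _ ⟨p, hp, rfl⟩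
    have h1 := hTu.le (subset_closure ⟨p, hp, rfl⟩)
    obtain ⟨t, ht, hpt⟩ := h1
    exact ⟨t, ⟨ht, fun he => hcon p hp (he ▸ hpt)⟩, hpt⟩
  have hfin : (T \ {K.carrier}).Finite := hT.subset Set.sdiff_subset
  obtain ⟨t, ht, hKt⟩ := isIrreducible_iff_sUnion_isClosed.1 K.isComponent.1.1 hfin.toFinset
    (fun t ht => hTc t (hfin.mem_toFinset.1 ht).1)
    (by rw [hfin.coe_toFinset]; exact K.isComponent.1.2.trans hsub)
  rw [hfin.mem_toFinset] at ht
  have h2 : t ⊆ configClosure h := (Set.subset_sUnion_of_mem ht.1).trans hTu.ge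
  exact ht.2 ((K.isComponent.2 ⟨hTi t ht.1, h2⟩ hKt).antisymm hKt)

theorem scale_x_eq_zero {f : MvPolynomial (Fin n × Fin 2) ℂ} (hf : f ∈ coneIdeal K.carrier) :
    scale (fun y => K.x y.1 y.2) f = 0 := by
  refine scale_eq_zero _ _ fun d hd => ?_
  let e : MvPolynomial (Fin n × Fin 2) ℂ →ₐ[ℂ] MvPolynomial (Fin n × Fin 2) ℂ :=
    MvPolynomial.aeval fun y => MvPolynomial.C (d y.1) * MvPolynomial.X y
  have he : e f ∈ coneIdeal K.carrier := by
    rw [coneIdeal, MvPolynomial.mem_vanishingIdeal_iff] at hf ⊢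
    intro v hv
    obtain ⟨p, hp, a, ha, rfl⟩ := mem_cone_iff.1 hv
    have h1 := hf _ (mem_cone_iff.2 ⟨p, hp, fun i => d i * a i,
      fun i => mul_ne_zero (hd i) (ha i), rfl⟩)
    rw [← h1]
    have h2 : (MvPolynomial.aeval fun y : Fin n × Fin 2 => a y.1 * p.rep y).comp e =
        MvPolynomial.aeval (R := ℂ) fun y : Fin n × Fin 2 => d y.1 * a y.1 * p.rep y := by
      ext y
      simp [e, mul_assoc]
    exact DFunLike.congr_fun h2 f
  have h3 : ((IsScalarTower.toAlgHom ℂ K.CoordRing K.ConeField).comp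
      (Ideal.Quotient.mkₐ ℂ (coneIdeal K.carrier))).comp e =
      MvPolynomial.aeval fun y => algebraMap ℂ K.ConeField (d y.1) * K.x y.1 y.2 := by
    ext y
    simp only [e, AlgHom.comp_apply, MvPolynomial.aeval_X, _root_.map_mul, x]
    rfl
  rw [← h3]
  change algebraMap K.CoordRing K.ConeField (Ideal.Quotient.mk _ (e f)) = 0
  rw [Ideal.Quotient.eq_zero_iff_mem.2 he, map_zero]

theorem aeval_x_eq_zero_iff {f : MvPolynomial (Fin n × Fin 2) ℂ} :
    MvPolynomial.aeval (fun y => K.x y.1 y.2) f = 0 ↔ f ∈ coneIdeal K.carrier := by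
  have h3 : (IsScalarTower.toAlgHom ℂ K.CoordRing K.ConeField).comp
      (Ideal.Quotient.mkₐ ℂ (coneIdeal K.carrier)) =
      MvPolynomial.aeval fun y => K.x y.1 y.2 := by
    ext y
    simp only [AlgHom.comp_apply, MvPolynomial.aeval_X, x]
    rfl
  rw [← h3]
  change algebraMap K.CoordRing K.ConeField (Ideal.Quotient.mk _ f) = 0 ↔ _
  rw [FaithfulSMul.algebraMap_eq_zero_iff, Ideal.Quotient.eq_zero_iff_mem]

end ConfigCurve

section closure

variable {n : ℕ} (h : Fin n → DualQuat ℝ)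

/-- The closure product over the ring of polynomials in the homogeneous coordinates. -/
def closurePoly : DQ (MvPolynomial (Fin n × Fin 2) ℂ) :=
  DQ.of (chain ((algebraMap ℂ (MvPolynomial (Fin n × Fin 2) ℂ)).comp Complex.ofRealHom) h
    (fun k l => MvPolynomial.X (k, l)) 0 n)

theorem aeval_closurePoly {L : Type*} [CommRing L] [Algebra ℂ L] (v : Fin n × Fin 2 → L)
    (c : Fin 8) : MvPolynomial.aeval v ((closurePoly h).coords c) =
      (DQ.of (chain ((algebraMap ℂ L).comp Complex.ofRealHom) h (fun k l => v (k, l)) 0 n)).coords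
        c := by
  have h1 := map_of_chain h ((algebraMap ℂ (MvPolynomial (Fin n × Fin 2) ℂ)).comp
      Complex.ofRealHom) (MvPolynomial.aeval (R := ℂ) v).toRingHom
      (fun k l => MvPolynomial.X (k, l)) 0 n
  have h2 : ((MvPolynomial.aeval (R := ℂ) v).toRingHom.comp
      ((algebraMap ℂ (MvPolynomial (Fin n × Fin 2) ℂ)).comp Complex.ofRealHom)) =
      (algebraMap ℂ L).comp Complex.ofRealHom := by
    ext1 z
    exact (MvPolynomial.aeval (R := ℂ) v).commutes z
  have h3 : (fun k l => (MvPolynomial.aeval (R := ℂ) v).toRingHom (MvPolynomial.X (k, l))) =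
      fun k l => v (k, l) := by
    funext k l
    exact MvPolynomial.aeval_X _ _
  rw [h2, h3] at h1
  rw [← h1, DQ.coords_map]
  rfl

variable {h}

theorem chain_of_mem_configSet {p : Fin n → ℙ ℝ (Fin 2 → ℝ)} (hp : p ∈ configSet h) :
    ∃ r : ℂ, r ≠ 0 ∧ ∀ d : Fin n → ℂ,
      DQ.of (chain ((algebraMap ℂ ℂ).comp Complex.ofRealHom) h
        (fun k l => d k * ((p k).rep l : ℂ)) 0 n) = ((∏ k, d k) * r) • 1 := by
  obtain ⟨r, hr, hp⟩ := hp
  refine ⟨r, Complex.ofReal_ne_zero.2 hr, fun d => ?_⟩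
  have h1 := map_of_chain h (RingHom.id ℝ) Complex.ofRealHom (fun k => (p k).rep) 0 n
  rw [hp, DQ.of_smul, DQ.of_one, DQ.map_smul, _root_.map_one] at h1
  rw [of_chain_mul h _ d fun k l => ((p k).rep l : ℂ), mul_smul]
  have h2 : ((((List.finRange n).take n).drop 0).map d).prod = ∏ k, d k := by
    rw [List.take_of_length_le (by simp), List.drop_zero, ← List.ofFn_eq_map, List.prod_ofFn]
  rw [h2]
  congr 1
  exact h1.symm

theorem eq_of_mem_cone_toComplex {p : Fin n → ℙ ℝ (Fin 2 → ℝ)} {v : Fin n × Fin 2 → ℂ}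
    (hv : v ∈ cone {(fun i => toComplex (p i) : P1Pow n)}) :
    ∃ d : Fin n → ℂ, v = fun y => d y.1 * ((p y.1).rep y.2 : ℂ) := by
  obtain ⟨hv, hvp⟩ := hv
  have h1 : ∀ i, ∃ d : ℂ, (fun j => v (i, j)) = fun j => d * ((p i).rep j : ℂ) := by
    intro i
    have h2 := congrFun (Set.mem_singleton_iff.1 hvp) i
    obtain ⟨d, hd⟩ := (Projectivization.mk_eq_mk_iff' _ _ _ _ _).1 h2
    exact ⟨d, hd.symm⟩
  choose d hd using h1
  exact ⟨d, funext fun y => congrFun (hd y.1) y.2⟩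

end closure

namespace ConfigCurve

variable {n : ℕ} {h : Fin n → DualQuat ℝ} (K : ConfigCurve h)

theorem closurePoly_coords_mem {c : Fin 8} (hc : c ≠ 0) :
    (closurePoly h).coords c ∈ coneIdeal K.carrier := by
  refine mem_coneIdeal_iff.2 fun q hq => ?_
  by_contra h0
  obtain ⟨_, ⟨v, hv, hvQ⟩, ⟨p, hp, rfl⟩⟩ := mem_closure_iff.1 (K.isComponent.1.2 hq) _
    (isOpen_basicOpen _) (mem_basicOpen_iff.2 h0)
  obtain ⟨r, -, hr⟩ := chain_of_mem_configSet hp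
  obtain ⟨d, rfl⟩ := eq_of_mem_cone_toComplex hv
  refine hvQ ?_
  rw [aeval_closurePoly, hr d, DQ.coords_smul, DQ.coords_one_of_ne hc, mul_zero]

theorem closurePoly_coords_zero_notMem : (closurePoly h).coords 0 ∉ coneIdeal K.carrier := by
  intro h0
  obtain ⟨p, hp, hpK⟩ := K.exists_configSet_mem
  obtain ⟨r, hr0, hr⟩ := chain_of_mem_configSet hp
  rw [coneIdeal, MvPolynomial.mem_vanishingIdeal_iff] at h0
  obtain ⟨d, hd⟩ := eq_of_mem_cone_toComplex (rep_mem_cone (Set.mem_singleton _))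
  have hd0 : ∀ k, d k ≠ 0 := by
    intro k hk
    refine Projectivization.rep_nonzero (toComplex (p k)) (funext fun j => ?_)
    have h1 := congrFun hd (k, j)
    simp only [hk, zero_mul] at h1
    exact h1
  have h1 := h0 _ (rep_mem_cone hpK)
  rw [hd, aeval_closurePoly, hr d, DQ.coords_smul, DQ.coords_one_zero, mul_one] at h1
  exact mul_ne_zero (Finset.prod_ne_zero_iff.2 fun k _ => hd0 k) hr0 h1

/-- The closure product on the curve is a nonzero scalar. -/
theorem exists_chain_eq_smul_one : ∃ r : K.ConeField, r ≠ 0 ∧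
    DQ.of (chain ((algebraMap ℂ K.ConeField).comp Complex.ofRealHom) h K.x 0 n) = r • 1 := by
  have h0 := mt K.aeval_x_eq_zero_iff.1 K.closurePoly_coords_zero_notMem
  refine ⟨_, h0, DQ.ext_coords fun c => ?_⟩
  rw [DQ.coords_smul]
  by_cases hc : c = 0
  · subst hc
    rw [aeval_closurePoly, DQ.coords_one_zero, mul_one]
  · have h1 := K.aeval_x_eq_zero_iff.2 (K.closurePoly_coords_mem hc)
    rw [aeval_closurePoly] at h1
    rw [h1, DQ.coords_one_of_ne hc, mul_zero]

end ConfigCurve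

section chart

variable {n : ℕ}

/-- Normalized homogeneous coordinates: `(1 + c y : y)` satisfies `x - c y = 1`. -/
def chartCoord {L : Type*} [CommRing L] [Algebra ℂ L] (c : Fin n → ℂ) (y : Fin n → L)
    (x : Fin n × Fin 2) : L := ![1 + algebraMap ℂ L (c x.1) * y x.1, y x.1] x.2

theorem chartCoord_sub {L : Type*} [CommRing L] [Algebra ℂ L] (c : Fin n → ℂ) (y : Fin n → L)
    (i : Fin n) :
    chartCoord c y (i, 0) - algebraMap ℂ L (c i) * chartCoord c y (i, 1) = 1 := by
  simp [chartCoord]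

theorem map_chartCoord {L L' : Type*} [CommRing L] [Algebra ℂ L] [CommRing L'] [Algebra ℂ L']
    (φ : L →ₐ[ℂ] L') (c : Fin n → ℂ) (y : Fin n → L) (x : Fin n × Fin 2) :
    φ (chartCoord c y x) = chartCoord c (fun i => φ (y i)) x := by
  obtain ⟨i, j⟩ := x
  fin_cases j <;> simp [chartCoord]

/-- The point with given normalized coordinates. -/
def chartPoint (c y : Fin n → ℂ) : P1Pow n := fun i =>
  Projectivization.mk ℂ (fun j => chartCoord c y (i, j)) fun h0 => by
    have h1 := chartCoord_sub c y i
    have h2 := congrFun h0 0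
    have h3 := congrFun h0 1
    simp only [Pi.zero_apply] at h2 h3
    rw [h2, h3, mul_zero, sub_zero] at h1
    exact zero_ne_one h1

theorem eq_of_mem_cone_chartPoint {c y : Fin n → ℂ} {v : Fin n × Fin 2 → ℂ}
    (hv : v ∈ cone {chartPoint c y}) :
    ∃ d : Fin n → ℂ, v = fun x => d x.1 * chartCoord c y x := by
  obtain ⟨hv, hvp⟩ := hv
  have h1 : ∀ i, ∃ d : ℂ, (fun j => v (i, j)) = fun j => d * chartCoord c y (i, j) := by
    intro i
    have h2 := congrFun (Set.mem_singleton_iff.1 hvp) i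
    obtain ⟨d, hd⟩ := (Projectivization.mk_eq_mk_iff' _ _ _ _ _).1 h2
    exact ⟨d, hd.symm⟩
  choose d hd using h1
  exact ⟨d, funext fun y => congrFun (hd y.1) y.2⟩

theorem chartPoint_injective (c : Fin n → ℂ) : Function.Injective (chartPoint c) := by
  intro y z h
  funext i
  obtain ⟨d, hd⟩ := (Projectivization.mk_eq_mk_iff' _ _ _ _ _).1 (congrFun h i)
  have h0 := congrFun hd 0
  have h1 := congrFun hd 1
  simp only [chartCoord, Pi.smul_apply, smul_eq_mul, Matrix.cons_val, Algebra.algebraMap_self,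
    RingHom.id_apply] at h0 h1
  have h2 : d = 1 := by linear_combination h0 - c i * h1
  rw [h2, one_mul] at h1
  exact h1.symm

/-- Multihomogenization, with respect to normalized coordinates. -/
def homogenize (c : Fin n → ℂ) (Q : MvPolynomial (Fin n) ℂ) : MvPolynomial (Fin n × Fin 2) ℂ :=
  ∑ m ∈ Q.support, MvPolynomial.C (Q.coeff m) * ∏ i, (MvPolynomial.X (i, 1) ^ m i *
    (MvPolynomial.X (i, 0) - MvPolynomial.C (c i) * MvPolynomial.X (i, 1)) ^
      (Q.totalDegree - m i))

theorem aeval_homogenize {L : Type*} [CommRing L] [Algebra ℂ L] (c : Fin n → ℂ)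
    (Q : MvPolynomial (Fin n) ℂ) (d y : Fin n → L) :
    MvPolynomial.aeval (fun x => d x.1 * chartCoord c y x) (homogenize c Q) =
      (∏ i, d i) ^ Q.totalDegree * MvPolynomial.aeval y Q := by
  have hfac : ∀ i, d i * chartCoord c y (i, 0) - algebraMap ℂ L (c i) *
      (d i * chartCoord c y (i, 1)) = d i := by
    intro i
    linear_combination d i * chartCoord_sub c y i
  rw [homogenize, map_sum, MvPolynomial.aeval_def, MvPolynomial.eval₂_eq', Finset.mul_sum]
  refine Finset.sum_congr rfl fun m hm => ?_
  simp only [map_mul, map_prod, map_pow, map_sub, MvPolynomial.aeval_X, MvPolynomial.aeval_C, hfac]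
  rw [mul_left_comm]
  congr 1
  rw [← Finset.prod_pow, ← Finset.prod_mul_distrib]
  refine Finset.prod_congr rfl fun i _ => ?_
  have h1 : m i ≤ Q.totalDegree := by
    refine le_trans ?_ (MvPolynomial.le_totalDegree hm)
    by_cases h : m i = 0
    · rw [h]; exact Nat.zero_le _
    · exact Finset.single_le_sum (f := fun i => m i) (fun _ _ => Nat.zero_le _)
        (Finsupp.mem_support_iff.2 h)
  have h2 : chartCoord c y (i, 1) = y i := rfl
  rw [h2, mul_pow]
  conv_rhs => rw [← Nat.add_sub_cancel' h1, pow_add]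
  ring

end chart

theorem two_le_topologicalKrullDim {X : Type*} [TopologicalSpace X] {C Z : Set X} {p : X}
    (hC : IsIrreducible C) (hCc : IsClosed C) (hZ : IsIrreducible Z) (hZc : IsClosed Z)
    (hp : IsClosed {p}) (hpZ : p ∈ Z) (hne : Z ≠ {p}) (hZC : Z ⊆ C) (hne' : Z ≠ C) :
    2 ≤ topologicalKrullDim C := by
  have key : ∀ S : Set X, IsIrreducible S → S ⊆ C → IsIrreducible ((↑) ⁻¹' S : Set C) := by
    intro S hS hSC
    obtain ⟨x, hx⟩ := hS.1
    refine ⟨⟨⟨x, hSC hx⟩, hx⟩, ?_⟩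
    rintro _ _ ⟨U, hU, rfl⟩ ⟨V, hV, rfl⟩ ⟨y, hy, hyU⟩ ⟨z, hz, hzV⟩
    obtain ⟨w, hw, hwU, hwV⟩ := hS.2 U V hU hV ⟨y, hy, hyU⟩ ⟨z, hz, hzV⟩
    exact ⟨⟨w, hSC hw⟩, hw, hwU, hwV⟩
  have hmono : ∀ S S' : Set X, S ⊆ C → S' ⊆ C → S ⊆ S' → S ≠ S' →
      ((↑) ⁻¹' S : Set C) < ((↑) ⁻¹' S' : Set C) := by
    intro S S' hS hS' hle hne
    refine lt_of_le_of_ne (Set.preimage_mono hle) fun he => hne (hle.antisymm fun x hx => ?_)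
    have h1 : (⟨x, hS' hx⟩ : C) ∈ ((↑) ⁻¹' S' : Set C) := hx
    rw [← he] at h1
    exact h1
  let F : ∀ S : Set X, IsIrreducible S → IsClosed S → S ⊆ C →
      TopologicalSpace.IrreducibleCloseds C := fun S h1 h2 h3 =>
    ⟨_, key S h1 h3, h2.preimage continuous_subtype_val⟩
  have hpC : {p} ⊆ C := Set.singleton_subset_iff.2 (hZC hpZ)
  have h1 : F {p} isIrreducible_singleton hp hpC < F Z hZ hZc hZC :=
    hmono _ _ hpC hZC (Set.singleton_subset_iff.2 hpZ) hne.symm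
  have h2 : F Z hZ hZc hZC < F C hC hCc subset_rfl := hmono _ _ hZC subset_rfl hZC hne'
  let l : LTSeries (TopologicalSpace.IrreducibleCloseds C) :=
    LTSeries.mk 2 ![_, _, _] (Fin.strictMono_iff_lt_succ.2 fun i => by
      fin_cases i
      · exact h1
      · exact h2)
  exact Order.le_krullDim_iff (n := 2) |>.2 ⟨l, rfl⟩

namespace ConfigCurve

variable {n : ℕ} {h : Fin n → DualQuat ℝ} (K : ConfigCurve h)

section

variable {O : Type} [CommRing O] [Algebra ℂ O] {ι : O →ₐ[ℂ] K.ConeField}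
  (hι : Function.Injective ι) {c : Fin n → ℂ} {Y : Fin n → O} {e : Fin n → K.ConeField}
  (he : ∀ i j, K.x i j = e i * chartCoord c (fun i => ι (Y i)) (i, j)) (he0 : ∀ i, e i ≠ 0)

include hι he he0

theorem aeval_chartCoord_eq_zero {f : MvPolynomial (Fin n × Fin 2) ℂ}
    (hf : f ∈ coneIdeal K.carrier) (d : Fin n → O) :
    MvPolynomial.aeval (fun x => d x.1 * chartCoord c Y x) f = 0 := by
  apply hι
  have h1 := eval_scale (fun y => K.x y.1 y.2) (fun i => ι (d i) / e i) f
  rw [K.scale_x_eq_zero hf, _root_.map_zero] at h1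
  have h2 : (fun y : Fin n × Fin 2 => ι (d y.1) / e y.1 * K.x y.1 y.2) =
      fun y => ι (d y.1 * chartCoord c Y y) := by
    funext y
    rw [_root_.map_mul, map_chartCoord, he, div_mul_eq_mul_div, mul_left_comm,
      mul_div_cancel_left₀ _ (he0 _)]
  rw [_root_.map_zero, h1, h2, ← MvPolynomial.comp_aeval_apply]

theorem chartPoint_mem (ψ : O →ₐ[ℂ] ℂ) : chartPoint c (fun i => ψ (Y i)) ∈ K.carrier := by
  rw [mem_iff_of_isClosed K.isClosed_carrier]
  intro f hf
  by_contra h0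
  obtain ⟨v, hv, hvf⟩ := mem_basicOpen_iff.2 h0
  obtain ⟨d, rfl⟩ := eq_of_mem_cone_chartPoint hv
  refine hvf ?_
  have h1 := K.aeval_chartCoord_eq_zero hι he he0 hf fun i => algebraMap ℂ O (d i)
  have h2 := congrArg ψ h1
  rw [_root_.map_zero, MvPolynomial.comp_aeval_apply] at h2
  rw [← h2]
  congr 2
  funext y
  rw [_root_.map_mul, map_chartCoord, AlgHom.commutes]
  rfl

theorem isAlgebraic_or_trdeg_eq_one [IsDomain O] (hgen : Algebra.adjoin ℂ (Set.range Y) = ⊤) :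
    Algebra.IsAlgebraic ℂ O ∨ Algebra.trdeg ℂ O = 1 := by
  by_contra! hcon
  have : Algebra.FiniteType ℂ O :=
    ⟨⟨(Set.finite_range Y).toFinset, by rw [Set.Finite.coe_toFinset]; exact hgen⟩⟩
  obtain ⟨x, hx0, ψ, hψ, hψx⟩ := exists_infinite_points hcon.1 hcon.2
  obtain ⟨Q, rfl⟩ : ∃ Q : MvPolynomial (Fin n) ℂ, MvPolynomial.aeval Y Q = x := by
    have h1 : x ∈ Algebra.adjoin ℂ (Set.range Y) := hgen ▸ Algebra.mem_top
    rw [Algebra.adjoin_range_eq_range_aeval] at h1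
    exact h1
  let p : ℂ → P1Pow n := fun z => chartPoint c fun i => ψ z (Y i)
  have hp : Function.Injective p := by
    intro z w hzw
    refine hψ (AlgHom.ext_of_adjoin_eq_top hgen ?_)
    rintro _ ⟨i, rfl⟩
    exact congrFun (chartPoint_injective c hzw) i
  have hpK : Set.range p ⊆ K.carrier := by
    rintro _ ⟨z, rfl⟩
    exact K.chartPoint_mem hι he he0 (ψ z)
  obtain ⟨T, hT, hTc, hTi, hTu⟩ :=
    TopologicalSpace.NoetherianSpace.exists_finite_set_isClosed_irreducible
      (isClosed_closure : IsClosed (closure (Set.range p)))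
  have hinf : (Set.range p).Infinite := Set.infinite_range_of_injective hp
  obtain ⟨Z, hZT, hZ⟩ : ∃ Z ∈ T, Z.Infinite := by
    by_contra! hfin
    refine hinf ((Set.Finite.sUnion hT fun t ht => ?_).subset (subset_closure.trans hTu.le))
    exact hfin t ht
  have hZcl : Z ⊆ closure (Set.range p) := (Set.subset_sUnion_of_mem hZT).trans hTu.ge
  have hZK : Z ⊆ K.carrier := hZcl.trans (closure_minimal hpK K.isClosed_carrier)
  have hZne : Z ≠ K.carrier := by
    rintro rfl
    have hf : homogenize c Q ∈ coneIdeal K.carrier := by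
      refine mem_coneIdeal_iff.2 fun q hq => ?_
      by_contra h0
      obtain ⟨_, ⟨v, hv, hvf⟩, ⟨z, rfl⟩⟩ := mem_closure_iff.1 (hZcl hq) _
        (isOpen_basicOpen _) (mem_basicOpen_iff.2 h0)
      obtain ⟨d, rfl⟩ := eq_of_mem_cone_chartPoint hv
      refine hvf ?_
      rw [aeval_homogenize]
      have h2 := hψx z
      rw [MvPolynomial.comp_aeval_apply] at h2
      rw [h2, mul_zero]
    have h1 := K.aeval_chartCoord_eq_zero hι he he0 hf 1
    rw [aeval_homogenize] at h1
    simp only [Pi.one_apply, Finset.prod_const_one, one_pow, one_mul] at h1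
    exact hx0 h1
  obtain ⟨q, hq⟩ := hZ.nonempty
  have h2 := two_le_topologicalKrullDim K.isComponent.1.1 K.isClosed_carrier (hTi Z hZT)
    (hTc Z hZT) (isClosed_singleton_point q) hq
    (fun h1 => hZ (h1 ▸ Set.finite_singleton q)) hZK hZne
  rw [K.dim_eq] at h2
  exact absurd h2 (by decide)

end

end ConfigCurve

namespace DQ

section gauss

variable {F Γ : Type*} [Field F] [LinearOrderedCommGroupWithZero Γ] (w : Valuation F Γ)

/-- The maximal value of the coordinates. -/
def gauss (q : DQ F) : Γ := Finset.univ.sup' Finset.univ_nonempty fun c => w (q.coords c)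

variable {w}

theorem gauss_le_iff {q : DQ F} {γ : Γ} : gauss w q ≤ γ ↔ ∀ c, w (q.coords c) ≤ γ := by
  simp [gauss]

theorem le_gauss (q : DQ F) (c : Fin 8) : w (q.coords c) ≤ gauss w q :=
  gauss_le_iff.1 le_rfl c

theorem exists_eq_gauss (w : Valuation F Γ) (q : DQ F) : ∃ c, gauss w q = w (q.coords c) := by
  obtain ⟨c, -, hc⟩ := Finset.exists_mem_eq_sup' Finset.univ_nonempty fun c => w (q.coords c)
  exact ⟨c, hc⟩

theorem gauss_smul (x : F) (q : DQ F) : gauss w (x • q) = w x * gauss w q := by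
  refine le_antisymm (gauss_le_iff.2 fun c => ?_) ?_
  · rw [coords_smul, _root_.map_mul]
    exact mul_le_mul_right (le_gauss q c) _
  · obtain ⟨c, hc⟩ := exists_eq_gauss w q
    rw [hc, ← _root_.map_mul, ← coords_smul]
    exact le_gauss _ c

theorem gauss_star (q : DQ F) : gauss w (star q) = gauss w q := by
  rw [gauss, gauss]
  congr 1
  funext c
  rw [coords_star, apply_ite w, Valuation.map_neg, ite_self]

theorem gauss_mul_le (p q : DQ F) : gauss w (p * q) ≤ gauss w p * gauss w q := by
  have h : ∀ i j, w (p.coords i * q.coords j) ≤ gauss w p * gauss w q := fun i j => by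
    rw [_root_.map_mul]
    exact mul_le_mul' (le_gauss p i) (le_gauss q j)
  have hadd : ∀ {x y γ}, w x ≤ γ → w y ≤ γ → w (x + y) ≤ γ := fun hx hy => w.map_add_le hx hy
  have hsub : ∀ {x y γ}, w x ≤ γ → w y ≤ γ → w (x - y) ≤ γ := fun hx hy => by
    rw [sub_eq_add_neg]
    exact w.map_add_le hx (by rwa [Valuation.map_neg])
  refine gauss_le_iff.2 fun c => ?_
  rw [coords_mul]
  generalize p.coords = a at h ⊢
  generalize q.coords = b at h ⊢
  generalize gauss w p * gauss w q = γ at h ⊢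
  fin_cases c <;>
  · simp only [Fin.zero_eta, Fin.mk_one, Fin.reduceFinMk, Matrix.cons_val]
    repeat' first
      | exact h _ _
      | apply hadd
      | apply hsub

variable [Algebra ℂ F]

theorem liftFunctional_le (hw : ∀ z : ℂ, w (algebraMap ℂ F z) ≤ 1) (L : DQ ℂ →ₗ[ℂ] ℂ) (q : DQ F) :
    w (liftFunctional F L q) ≤ gauss w q := by
  rw [liftFunctional_apply]
  refine Valuation.map_sum_le w fun c _ => ?_
  rw [_root_.map_mul]
  exact (mul_le_of_le_one_right' (hw _)).trans (le_gauss q c)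

end gauss

theorem factor_mul_star {A : Type*} [CommRing A] [Algebra ℂ A] {h : DualQuat ℝ}
    (hh : h * h = -1) (c : ℂ) (y : A) :
    factor h c y * star (factor h c y) =
      ((1 + algebraMap ℂ A c * y) * (1 + algebraMap ℂ A c * y) + y * y) • 1 ∧
    star (factor h c y) * factor h c y =
      ((1 + algebraMap ℂ A c * y) * (1 + algebraMap ℂ A c * y) + y * y) • 1 := by
  have hH : map (algebraMap ℂ A) (cx h) * map (algebraMap ℂ A) (cx h) = -1 := by
    rw [← _root_.map_mul, cx_sq hh, _root_.map_neg, map_one]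
  have hs : star (map (algebraMap ℂ A) (cx h)) = -map (algebraMap ℂ A) (cx h) := by
    rw [← map_star, star_cx hh, _root_.map_neg]
  have h1 : star (factor h c y) = (1 + algebraMap ℂ A c * y) • 1 +
      y • map (algebraMap ℂ A) (cx h) := by
    rw [factor_eq, star_sub, star_smul, star_smul, hs, star_one, smul_neg, sub_neg_eq_add]
  rw [h1, factor_eq]
  exact ⟨linear_mul_conj hH _ _, conj_mul_linear hH _ _⟩

section closed

variable {F : Type*} [Field F] {a : Fin 6 → DQ F} {N : Fin 6 → F}
  (hN : ∀ k, a k * star (a k) = N k • 1) (hN' : ∀ k, star (a k) * a k = N k • 1)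
  {r : F} (hr : r ≠ 0) (hcl : a 0 * a 1 * a 2 * (a 3 * a 4 * a 5) = r • 1)

include hN in
theorem mul_star_of_three (i j k : Fin 6) :
    a i * a j * a k * star (a i * a j * a k) = (N i * N j * N k) • 1 := by
  rw [star_mul, star_mul]
  calc a i * a j * a k * (star (a k) * (star (a j) * star (a i)))
      = a i * (a j * (a k * star (a k)) * star (a j)) * star (a i) := by noncomm_ring
    _ = _ := by
      rw [hN k, mul_smul_comm, mul_one, smul_mul_assoc, hN j, smul_smul, mul_smul_comm, mul_one,
        smul_mul_assoc, hN i, smul_smul]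
      congr 1
      ring

include hN hr hcl in
theorem norm_ne_zero (k : Fin 6) : N k ≠ 0 := by
  have h1 : (a 0 * a 1 * a 2 * (a 3 * a 4 * a 5)) *
      star (a 0 * a 1 * a 2 * (a 3 * a 4 * a 5)) =
      (N 0 * N 1 * N 2 * (N 3 * N 4 * N 5)) • 1 := by
    rw [star_mul, mul_assoc, ← mul_assoc (a 3 * a 4 * a 5), mul_star_of_three hN, smul_mul_assoc,
      one_mul, mul_smul_comm, mul_star_of_three hN, smul_smul, mul_comm]
  rw [hcl, star_smul, star_one, smul_mul_smul_comm, one_mul] at h1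
  have h2 := congrArg (fun q => DQ.coords q 0) h1
  simp only [coords_smul, coords_one_zero, mul_one] at h2
  have h3 : N 0 * N 1 * N 2 * (N 3 * N 4 * N 5) ≠ 0 := h2 ▸ mul_ne_zero hr hr
  simp only [mul_ne_zero_iff] at h3
  fin_cases k
  exacts [h3.1.1.1, h3.1.1.2, h3.1.2, h3.2.1.1, h3.2.1.2, h3.2.2]

include hN hr hcl in
theorem closed_split : a 0 * a 1 * a 2 = (r / (N 3 * N 4 * N 5)) • star (a 3 * a 4 * a 5) := by
  have h0 := norm_ne_zero hN hr hcl
  have h1 := congrArg (· * star (a 3 * a 4 * a 5)) hcl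
  simp only [mul_assoc (a 0 * a 1 * a 2), mul_star_of_three hN, smul_mul_assoc, one_mul,
    mul_smul_comm, mul_one] at h1
  have h2 : N 3 * N 4 * N 5 ≠ 0 := mul_ne_zero (mul_ne_zero (h0 3) (h0 4)) (h0 5)
  rw [div_eq_inv_mul, mul_smul, ← h1, inv_smul_smul₀ h2]

include hN hN' hr hcl in
theorem closed_four : a 0 * a 1 * a 2 * a 3 =
    (r / (N 3 * N 4 * N 5) * N 3) • star (a 4 * a 5) := by
  rw [closed_split hN hr hcl]
  generalize r / (N 3 * N 4 * N 5) = u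
  rw [mul_assoc (a 3), star_mul (a 3), smul_mul_assoc, mul_assoc, hN', mul_smul_comm, mul_one,
    smul_smul]

include hN hN' hr hcl in
theorem closed_three : N 0 • (a 1 * a 2 * a 3) =
    (N 3 * (r / (N 3 * N 4 * N 5))) • (star (a 0) * star (a 4 * a 5)) := by
  have h1 := congrArg (star (a 0) * ·) (closed_four hN hN' hr hcl)
  simp only [mul_smul_comm] at h1
  rw [mul_comm (N 3), ← h1, ← mul_assoc, ← mul_assoc, ← mul_assoc, hN', smul_mul_assoc,
    smul_mul_assoc, smul_mul_assoc, one_mul]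

end closed

end DQ

theorem DQ.map_factor {A B : Type*} [CommRing A] [CommRing B] [Algebra ℂ A] [Algebra ℂ B]
    (φ : A →ₐ[ℂ] B) (h : DualQuat ℝ) (c : ℂ) (y : A) :
    DQ.map (φ : A →+* B) (DQ.factor h c y) = DQ.factor h c (φ y) := by
  have h1 : (φ : A →+* B).comp (algebraMap ℂ A) = algebraMap ℂ B := RingHom.ext φ.commutes
  rw [DQ.factor, DQ.factor, _root_.map_add, _root_.map_one, DQ.map_smul, DQ.map_map, h1]
  rfl

/-- A closed 6R chain over a field, in normalized coordinates `(1 + c y : y)`, with the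
normalization at the joints `0` and `3` determined by the values `a` and `b`. -/
structure ClosedChart (h : Fin 6 → DualQuat ℝ) (a b : ℂ) (F : Type) [Field F] [Algebra ℂ F] where
  isLinkage : IsLinkage h
  coupling_left : couplingDim [h 0, h 1, h 2] = 8
  coupling_right : couplingDim [h 3, h 4, h 5] = 8
  ha : a = Complex.I ∨ a = -Complex.I
  hb : b = Complex.I ∨ b = -Complex.I
  c : Fin 6 → ℂ
  c_zero : c 0 = -a
  c_three : c 3 = -b
  y : Fin 6 → F
  r : F
  r_ne_zero : r ≠ 0
  closed : DQ.factor (h 0) (c 0) (y 0) * DQ.factor (h 1) (c 1) (y 1) *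
    DQ.factor (h 2) (c 2) (y 2) * (DQ.factor (h 3) (c 3) (y 3) * DQ.factor (h 4) (c 4) (y 4) *
    DQ.factor (h 5) (c 5) (y 5)) = r • 1

namespace ClosedChart

variable {h : Fin 6 → DualQuat ℝ} {a b : ℂ} {F : Type} [Field F] [Algebra ℂ F]
  (S : ClosedChart h a b F)

/-- The factors of the closure product. -/
def A (k : Fin 6) : DQ F := DQ.factor (h k) (S.c k) (S.y k)

/-- The norms of the factors. -/
def N (k : Fin 6) : F := (1 + algebraMap ℂ F (S.c k) * S.y k) *
  (1 + algebraMap ℂ F (S.c k) * S.y k) + S.y k * S.y k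

/-- The ratio of the two halves of the closure product. -/
def u : F := S.r / (S.N 3 * S.N 4 * S.N 5)

/-- The affine coordinate ring. -/
def O : Subalgebra ℂ F := Algebra.adjoin ℂ (Set.range S.y)

theorem A_mul_star (k : Fin 6) : S.A k * star (S.A k) = S.N k • 1 :=
  (DQ.factor_mul_star (S.isLinkage.sq_eq k) _ _).1

theorem star_mul_A (k : Fin 6) : star (S.A k) * S.A k = S.N k • 1 :=
  (DQ.factor_mul_star (S.isLinkage.sq_eq k) _ _).2

theorem A_closed : S.A 0 * S.A 1 * S.A 2 * (S.A 3 * S.A 4 * S.A 5) = S.r • 1 := S.closed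

theorem N_ne_zero (k : Fin 6) : S.N k ≠ 0 := DQ.norm_ne_zero S.A_mul_star S.r_ne_zero S.A_closed k

theorem split : S.A 0 * S.A 1 * S.A 2 = S.u • star (S.A 3 * S.A 4 * S.A 5) :=
  DQ.closed_split S.A_mul_star S.r_ne_zero S.A_closed

theorem four : S.A 0 * S.A 1 * S.A 2 * S.A 3 = (S.u * S.N 3) • star (S.A 4 * S.A 5) :=
  DQ.closed_four S.A_mul_star S.star_mul_A S.r_ne_zero S.A_closed

theorem three : S.N 0 • (S.A 1 * S.A 2 * S.A 3) =
    (S.N 3 * S.u) • (star (S.A 0) * star (S.A 4 * S.A 5)) :=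
  DQ.closed_three S.A_mul_star S.star_mul_A S.r_ne_zero S.A_closed

theorem N_zero : S.N 0 = 1 - algebraMap ℂ F (2 * a) * S.y 0 := by
  have h1 : algebraMap ℂ F a * algebraMap ℂ F a = -1 := by
    rw [← map_mul, DQ.sq_eq_neg_one S.ha, map_neg, map_one]
  rw [N, S.c_zero, map_neg, map_mul, map_ofNat]
  linear_combination S.y 0 * S.y 0 * h1

theorem N_three : S.N 3 = 1 - algebraMap ℂ F (2 * b) * S.y 3 := by
  have h1 : algebraMap ℂ F b * algebraMap ℂ F b = -1 := by
    rw [← map_mul, DQ.sq_eq_neg_one S.hb, map_neg, map_one]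
  rw [N, S.c_three, map_neg, map_mul, map_ofNat]
  linear_combination S.y 3 * S.y 3 * h1

theorem y_mem (k : Fin 6) : S.y k ∈ S.O := Algebra.subset_adjoin ⟨k, rfl⟩

theorem N_mem (k : Fin 6) : S.N k ∈ S.O :=
  add_mem (mul_mem (add_mem (one_mem _) (mul_mem (S.O.algebraMap_mem _) (S.y_mem k)))
    (add_mem (one_mem _) (mul_mem (S.O.algebraMap_mem _) (S.y_mem k))))
    (mul_mem (S.y_mem k) (S.y_mem k))

section coords

variable {O : Subalgebra ℂ F}

/-- The dual quaternions with coordinates in a subalgebra. -/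
def integral (O : Subalgebra ℂ F) : Subring (DQ F) := (DQ.map (O.val : O →+* F)).range

theorem coords_mem {q : DQ F} (hq : q ∈ integral O) (c : Fin 8) : q.coords c ∈ O := by
  obtain ⟨q, rfl⟩ := hq
  rw [DQ.coords_map]
  exact (q.coords c).2

theorem star_mem_integral {q : DQ F} (hq : q ∈ integral O) : star q ∈ integral O := by
  obtain ⟨q, rfl⟩ := hq
  exact ⟨star q, DQ.map_star _ _⟩

theorem liftFunctional_mem {q : DQ F} (hq : q ∈ integral O) (L : DQ ℂ →ₗ[ℂ] ℂ) :
    DQ.liftFunctional F L q ∈ O := by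
  rw [DQ.liftFunctional_apply]
  exact sum_mem fun c _ => mul_mem (coords_mem hq c) (O.algebraMap_mem _)

end coords

theorem A_mem (k : Fin 6) : S.A k ∈ integral S.O :=
  ⟨DQ.factor (h k) (S.c k) (⟨S.y k, S.y_mem k⟩ : S.O), DQ.map_factor S.O.val _ _ _⟩

theorem exists_functional_left : ∃ L : DQ ℂ →ₗ[ℂ] ℂ,
    DQ.liftFunctional F L (S.A 0 * S.A 1 * S.A 2) = 1 := by
  obtain ⟨L, hL⟩ := DQ.exists_functional (h := ![h 0, h 1, h 2]) S.coupling_left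
    ![S.c 0, S.c 1, S.c 2]
  exact ⟨L 0, hL F ![S.y 0, S.y 1, S.y 2] 0⟩

theorem exists_functional_right : ∃ L : DQ ℂ →ₗ[ℂ] ℂ,
    DQ.liftFunctional F L (S.A 3 * S.A 4 * S.A 5) = 1 := by
  obtain ⟨L, hL⟩ := DQ.exists_functional (h := ![h 3, h 4, h 5]) S.coupling_right
    ![S.c 3, S.c 4, S.c 5]
  exact ⟨L 0, hL F ![S.y 3, S.y 4, S.y 5] 0⟩

theorem u_mem : S.u ∈ S.O := by
  obtain ⟨L, hL⟩ := S.exists_functional_right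
  have h1 : star (S.A 0 * S.A 1 * S.A 2) = S.u • (S.A 3 * S.A 4 * S.A 5) := by
    rw [S.split, DQ.star_smul, star_star]
  have h2 := liftFunctional_mem (star_mem_integral
    (mul_mem (mul_mem (S.A_mem 0) (S.A_mem 1)) (S.A_mem 2))) L
  rwa [h1, map_smul, hL, smul_eq_mul, mul_one] at h2

theorem exists_u_mul_eq_one : ∃ v ∈ S.O, S.u * v = 1 := by
  obtain ⟨L, hL⟩ := S.exists_functional_left
  rw [S.split, map_smul, smul_eq_mul] at hL
  exact ⟨_, liftFunctional_mem (star_mem_integral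
    (mul_mem (mul_mem (S.A_mem 3) (S.A_mem 4)) (S.A_mem 5))) L, hL⟩

section valuation

variable {Γ : Type*} [LinearOrderedCommGroupWithZero Γ] {w : Valuation F Γ}
  (hw : ∀ x ∈ S.O, w x ≤ 1)

include hw

theorem gauss_le_one {q : DQ F} (hq : q ∈ integral S.O) : DQ.gauss w q ≤ 1 :=
  DQ.gauss_le_iff.2 fun c => hw _ (coords_mem hq c)

theorem const_le_one (z : ℂ) : w (algebraMap ℂ F z) ≤ 1 := hw _ (S.O.algebraMap_mem z)

theorem gauss_left : DQ.gauss w (S.A 0 * S.A 1 * S.A 2) = 1 := by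
  obtain ⟨L, hL⟩ := S.exists_functional_left
  refine le_antisymm (S.gauss_le_one hw
    (mul_mem (mul_mem (S.A_mem 0) (S.A_mem 1)) (S.A_mem 2))) ?_
  have h1 := DQ.liftFunctional_le (S.const_le_one hw) L (S.A 0 * S.A 1 * S.A 2)
  rwa [hL, map_one] at h1

theorem gauss_right : DQ.gauss w (S.A 3 * S.A 4 * S.A 5) = 1 := by
  obtain ⟨L, hL⟩ := S.exists_functional_right
  refine le_antisymm (S.gauss_le_one hw
    (mul_mem (mul_mem (S.A_mem 3) (S.A_mem 4)) (S.A_mem 5))) ?_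
  have h1 := DQ.liftFunctional_le (S.const_le_one hw) L (S.A 3 * S.A 4 * S.A 5)
  rwa [hL, map_one] at h1

theorem valuation_u : w S.u = 1 := by
  have h1 := congrArg (DQ.gauss w) S.split
  rw [S.gauss_left hw, DQ.gauss_smul, DQ.gauss_star, S.gauss_right hw, mul_one] at h1
  exact h1.symm

theorem gauss_one_two : DQ.gauss w (S.A 1 * S.A 2) = 1 := by
  refine le_antisymm (S.gauss_le_one hw (mul_mem (S.A_mem 1) (S.A_mem 2))) ?_
  rw [← S.gauss_left hw, mul_assoc]
  exact (DQ.gauss_mul_le _ _).trans (mul_le_of_le_one_left' (S.gauss_le_one hw (S.A_mem 0)))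

theorem gauss_four_five : DQ.gauss w (S.A 4 * S.A 5) = 1 := by
  refine le_antisymm (S.gauss_le_one hw (mul_mem (S.A_mem 4) (S.A_mem 5))) ?_
  rw [← S.gauss_right hw, mul_assoc]
  exact (DQ.gauss_mul_le _ _).trans (mul_le_of_le_one_left' (S.gauss_le_one hw (S.A_mem 3)))

theorem gauss_four : DQ.gauss w (S.A 0 * S.A 1 * S.A 2 * S.A 3) = w (S.N 3) := by
  rw [S.four, DQ.gauss_smul, DQ.gauss_star, S.gauss_four_five hw, mul_one, map_mul,
    S.valuation_u hw, one_mul]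

theorem le_gauss_three : w (S.N 3) ≤ DQ.gauss w (S.A 1 * S.A 2 * S.A 3) := by
  have h1 : S.A 1 * S.A 2 * S.A 3 * star (S.A 3) = S.N 3 • (S.A 1 * S.A 2) := by
    rw [mul_assoc, S.A_mul_star, mul_smul_comm, mul_one]
  have h2 := DQ.gauss_mul_le (w := w) (S.A 1 * S.A 2 * S.A 3) (star (S.A 3))
  rw [h1, DQ.gauss_smul, S.gauss_one_two hw, mul_one, DQ.gauss_star] at h2
  exact h2.trans (mul_le_of_le_one_right' (S.gauss_le_one hw (S.A_mem 3)))

theorem gauss_eq_one_of_norm {k : Fin 6} (hk : w (S.N k) = 1) {p : DQ F}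
    (hp : DQ.gauss w p = 1) : DQ.gauss w (S.A k * p) = 1 := by
  refine le_antisymm ((DQ.gauss_mul_le _ _).trans (mul_le_one' (S.gauss_le_one hw (S.A_mem k))
    hp.le)) ?_
  have h1 : star (S.A k) * (S.A k * p) = S.N k • p := by
    rw [← mul_assoc, S.star_mul_A, smul_mul_assoc, one_mul]
  have h2 := DQ.gauss_mul_le (w := w) (star (S.A k)) (S.A k * p)
  rw [h1, DQ.gauss_smul, hk, hp, one_mul, DQ.gauss_star] at h2
  exact h2.trans (mul_le_of_le_one_left' (S.gauss_le_one hw (S.A_mem k)))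

theorem gauss_A_three : DQ.gauss w (S.A 3) = 1 := by
  refine le_antisymm (S.gauss_le_one hw (S.A_mem 3)) ?_
  rw [← S.gauss_right hw, mul_assoc]
  exact (DQ.gauss_mul_le _ _).trans
    (mul_le_of_le_one_right' (S.gauss_le_one hw (mul_mem (S.A_mem 4) (S.A_mem 5))))

theorem gauss_three_eq_one (h1 : w (S.N 1) = 1) (h2 : w (S.N 2) = 1) :
    DQ.gauss w (S.A 1 * S.A 2 * S.A 3) = 1 := by
  rw [mul_assoc]
  exact S.gauss_eq_one_of_norm hw h1 (S.gauss_eq_one_of_norm hw h2 (S.gauss_A_three hw))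

end valuation

end ClosedChart

open IsDedekindDomain

theorem isIntegral_iff_forall_valuationSubring {k F : Type*} [Field k] [Field F] [Algebra k F]
    (O : Subalgebra k F) (x : F) :
    IsIntegral O x ↔ ∀ R : ValuationSubring F, (∀ z ∈ O, z ∈ R) → x ∈ R := by
  have h1 : IsIntegral O x ↔ x ∈ (integralClosure (Subring.closure (O : Set F)) F).toSubring := by
    have h2 : Subring.closure (O : Set F) = O.toSubring := Subring.closure_eq O.toSubring
    rw [h2]
    exact Iff.rfl
  rw [h1, ← iInf_valuationSubring_superset, Subring.mem_iInf]
  exact ⟨fun H R hR => H ⟨R, hR⟩, fun H R => H R.1 R.2⟩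

section finite

variable {k F : Type} [Field k] [CharZero k] [Field F] [Algebra k F]
    {O : Subalgebra k F}

theorem exists_heightOne (hO : O.FG) [IsFractionRing O F] (htr : Algebra.trdeg k F = 1)
    (R : ValuationSubring F) (hR : R ≠ ⊤) (hOR : ∀ z ∈ O, z ∈ R) :
    ∃ P : @HeightOneSpectrum (integralClosure O F) _,
      ∀ _ : IsDedekindDomain (integralClosure O F), ∀ _ : IsFractionRing (integralClosure O F) F,
        ∀ x : F, x ∈ R ↔ P.valuation F x ≤ 1 := by
  obtain ⟨h1, h2, -⟩ := curve_normalization O hO htr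
  obtain ⟨P, hP⟩ := exists_heightOne_of_valuationSubring (D := integralClosure O F) R hR
    fun d => (isIntegral_iff_forall_valuationSubring O _).1 d.2 R hOR
  exact ⟨P, fun _ _ => hP⟩

theorem finite_valuationSubrings (hO : O.FG) [IsFractionRing O F] (htr : Algebra.trdeg k F = 1)
    {x : F} (hx : x ∈ O) (hx0 : x ≠ 0) :
    {R : ValuationSubring F | R ≠ ⊤ ∧ (∀ z ∈ O, z ∈ R) ∧ x ∈ R.nonunits}.Finite := by
  obtain ⟨h1, h2, -⟩ := curve_normalization O hO htr
  let d : integralClosure O F := algebraMap O _ ⟨x, hx⟩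
  have hd : (algebraMap (integralClosure O F) F) d = x := rfl
  have hd0 : Ideal.span {d} ≠ 0 := by
    rw [Ideal.zero_eq_bot, Ne, Ideal.span_singleton_eq_bot]
    intro h
    rw [h, map_zero] at hd
    exact hx0 hd.symm
  refine ((Ideal.finite_factors hd0).image fun P =>
    (P.valuation F).valuationSubring).subset ?_
  rintro R ⟨hR, hOR, hxR⟩
  obtain ⟨P, hP⟩ := exists_heightOne hO htr R hR hOR
  have hP := hP h1 h2
  have hRP : (P.valuation F).valuationSubring = R := by
    ext z
    rw [Valuation.mem_valuationSubring_iff, hP]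
  refine ⟨P, ?_, hRP⟩
  rw [Set.mem_ofPred_eq, Ideal.dvd_span_singleton, ← P.valuation_lt_one_iff_mem (K := F)]
  change P.valuation F x < 1
  by_contra hlt
  have h3 : x⁻¹ ∈ R := by
    rw [hP, map_inv₀]
    exact inv_le_one_of_one_le₀ (not_lt.1 hlt)
  rw [ValuationSubring.mem_nonunits_iff] at hxR
  have h4 := (R.valuation_le_one_iff _).2 h3
  rw [map_inv₀] at h4
  have h5 : (R.valuation x)⁻¹ * R.valuation x = 1 :=
    inv_mul_cancel₀ ((R.valuation.ne_zero_iff).2 hx0)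
  have h6 := mul_le_mul' h4 hxR.le
  rw [h5, one_mul] at h6
  exact absurd (lt_of_le_of_lt (mul_le_mul_left h4 (R.valuation x)) (by rwa [one_mul]))
    (by rw [h5]; exact lt_irrefl _)

end finite

theorem DQ.exists_generic {F : Type*} [Field F] [Algebra ℂ F] {T : Set (ValuationSubring F)}
    (hT : T.Finite) (hc : ∀ R ∈ T, ∀ z : ℂ, algebraMap ℂ F z ∈ R) (q : DQ F) :
    ∃ g : Fin 8 → ℂ, ∀ R ∈ T, DQ.gauss R.valuation q ≤
      R.valuation (∑ c, algebraMap ℂ F (g c) * q.coords c) := by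
  classical
  let lam : (Fin 8 → ℂ) →ₗ[ℂ] F := ∑ c, (LinearMap.proj c).smulRight (q.coords c)
  have hlam : ∀ g, lam g = ∑ c, algebraMap ℂ F (g c) * q.coords c := by
    intro g
    simp [lam, Algebra.smul_def]
  let W : T → Subspace ℂ (Fin 8 → ℂ) := fun R =>
    if h0 : DQ.gauss R.1.valuation q = 0 then ⊥ else
    { carrier := {g | R.1.valuation (lam g) < DQ.gauss R.1.valuation q}
      zero_mem' := by
        rw [Set.mem_ofPred_eq, map_zero, map_zero]
        exact zero_lt_iff.2 h0
      add_mem' := fun {x y} hx hy => by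
        rw [Set.mem_ofPred_eq, map_add]
        exact R.1.valuation.map_add_lt hx hy
      smul_mem' := fun z x hx => by
        rw [Set.mem_ofPred_eq, _root_.map_smul, Algebra.smul_def, _root_.map_mul]
        exact lt_of_le_of_lt
          (mul_le_of_le_one_left' ((R.1.valuation_le_one_iff _).2 (hc R.1 R.2 z))) hx }
  have : Finite T := hT
  have : Fintype T := Fintype.ofFinite T
  have hW : (⊤ : Subspace ℂ (Fin 8 → ℂ)) ∉ Finset.univ.image W := by
    intro h
    obtain ⟨R, -, hR⟩ := Finset.mem_image.1 h
    by_cases h0 : DQ.gauss R.1.valuation q = 0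
    · simp only [W, dif_pos h0] at hR
      exact bot_ne_top hR
    · simp only [W, dif_neg h0] at hR
      obtain ⟨c, hc⟩ := DQ.exists_eq_gauss R.1.valuation q
      have h1 : (Pi.single c 1 : Fin 8 → ℂ) ∈ (⊤ : Subspace ℂ (Fin 8 → ℂ)) := Submodule.mem_top
      rw [← hR] at h1
      have h2 : R.1.valuation (lam (Pi.single c 1)) < DQ.gauss R.1.valuation q := h1
      rw [hlam, Finset.sum_eq_single c, Pi.single_eq_same, map_one, one_mul, hc] at h2
      · exact lt_irrefl _ h2
      · intro d _ hd
        rw [Pi.single_eq_of_ne hd, map_zero, zero_mul]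
      · intro h
        exact absurd (Finset.mem_univ _) h
  obtain ⟨g, hg⟩ := (Set.ne_univ_iff_exists_notMem _).1 (Subspace.biUnion_ne_univ_of_top_notMem hW)
  refine ⟨g, fun R hR => ?_⟩
  rw [← hlam]
  by_contra! hlt
  refine hg (Set.mem_biUnion (Finset.mem_image_of_mem W (Finset.mem_univ ⟨R, hR⟩)) ?_)
  have h0 : DQ.gauss R.valuation q ≠ 0 := by
    intro h0
    rw [h0] at hlt
    exact not_lt_zero hlt
  simp only [W, dif_neg h0]
  exact hlt

theorem exists_aeval_mem_of_finite_quotient {k O : Type*} [Field k] [CommRing O] [Algebra k O]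
    (I : Ideal O) [Module.Finite k (O ⧸ I)] (x : O) :
    ∃ (p : Polynomial k) (e : ℕ), p.coeff 0 ≠ 0 ∧ x ^ e * Polynomial.aeval x p ∈ I := by
  obtain ⟨p, hp0, hp⟩ := (Algebra.IsIntegral.isIntegral (R := k) (Ideal.Quotient.mk I x)).isAlgebraic
  obtain ⟨q, hq, hdvd⟩ := Polynomial.exists_eq_pow_rootMultiplicity_mul_and_not_dvd p hp0 0
  refine ⟨q, p.rootMultiplicity 0, ?_, ?_⟩
  · intro h
    rw [map_zero, sub_zero] at hdvd
    exact hdvd (Polynomial.X_dvd_iff.2 h)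
  · rw [← Ideal.Quotient.eq_zero_iff_mem]
    have h1 : Ideal.Quotient.mkₐ k I (Polynomial.aeval x p) = 0 := by
      rw [← Polynomial.aeval_algHom_apply]
      exact hp
    rw [hq, map_zero, sub_zero, map_mul, map_pow, Polynomial.aeval_X] at h1
    exact h1

namespace ClosedChart

variable {h : Fin 6 → DualQuat ℝ} {a b : ℂ} {F : Type} [Field F] [Algebra ℂ F]
  (S : ClosedChart h a b F)

theorem finrank_quotient_le_two {O : Subalgebra ℂ F} {g : F}
    (hO : O = Algebra.adjoin ℂ (insert g (Set.range S.y))) {p : Polynomial ℂ}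
    (hp : p.coeff 0 ≠ 0) (hg : g * Polynomial.aeval (S.N 3) p = 1) {n0 n3 : O}
    (hn0 : (n0 : F) = S.N 0) (hn3 : (n3 : F) = S.N 3) :
    Module.Finite ℂ (O ⧸ Ideal.span {n0, n3}) ∧
      Module.finrank ℂ (O ⧸ Ideal.span {n0, n3}) ≤ 2 := by
  set I := Ideal.span {n0, n3} with hI
  have hSO : S.O ≤ O := hO ▸ Algebra.adjoin_mono (Set.subset_insert _ _)
  have hgO : g ∈ O := hO ▸ Algebra.subset_adjoin (Set.mem_insert _ _)
  let y : Fin 6 → O := fun k => ⟨S.y k, hSO (S.y_mem k)⟩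
  obtain ⟨v, hv, huv⟩ := S.exists_u_mul_eq_one
  let u' : O := ⟨S.u, hSO S.u_mem⟩
  let v' : O := ⟨v, hSO hv⟩
  have huv' : u' * v' = 1 := Subtype.ext huv
  let m : O →ₐ[ℂ] O ⧸ I := Ideal.Quotient.mkₐ ℂ I
  have hcl : DQ.factor (h 0) (S.c 0) (y 0) * DQ.factor (h 1) (S.c 1) (y 1) *
      DQ.factor (h 2) (S.c 2) (y 2) = u' • star (DQ.factor (h 3) (S.c 3) (y 3) *
      DQ.factor (h 4) (S.c 4) (y 4) * DQ.factor (h 5) (S.c 5) (y 5)) := by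
    apply DQ.map_injective (φ := (O.val : O →+* F)) Subtype.val_injective
    rw [DQ.map_smul, DQ.map_star]
    simp only [map_mul, DQ.map_factor]
    exact S.split
  have hcl' := congrArg (DQ.map (m : O →+* O ⧸ I)) hcl
  rw [DQ.map_smul, DQ.map_star] at hcl'
  simp only [map_mul, DQ.map_factor] at hcl'
  have hm0 : m n0 = 0 := Ideal.Quotient.eq_zero_iff_mem.2 (Ideal.subset_span (by simp))
  have hm3 : m n3 = 0 := Ideal.Quotient.eq_zero_iff_mem.2 (Ideal.subset_span (by simp))
  have hy : ∀ (z : ℂ) (k : Fin 6) (n : O), z * z = -1 →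
      (n : F) = 1 - algebraMap ℂ F (2 * z) * S.y k → m n = 0 →
      m (y k) = algebraMap ℂ (O ⧸ I) (1 / (2 * z)) := by
    intro z k n hz hn hmn
    have hz0 : z ≠ 0 := by
      rintro rfl
      norm_num at hz
    have h1 : n = 1 - algebraMap ℂ O (2 * z) * y k := Subtype.ext hn
    rw [h1, map_sub, map_one, map_mul, AlgHom.commutes, sub_eq_zero] at hmn
    have h2 := congrArg (algebraMap ℂ (O ⧸ I) (1 / (2 * z)) * ·) hmn
    simp only [mul_one, ← mul_assoc, ← map_mul] at h2
    rw [h2, mul_assoc (1 / (2 * z)), one_div_mul_cancel (mul_ne_zero two_ne_zero hz0), map_one, one_mul]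
  have hgen : Algebra.adjoin ℂ (Set.range fun k => m (y k)) = ⊤ := by
    refine top_le_iff.1 fun x _ => ?_
    obtain ⟨x, rfl⟩ := Ideal.Quotient.mk_surjective x
    have hg' : m ⟨g, hgO⟩ ∈ Algebra.adjoin ℂ (Set.range fun k => m (y k)) := by
      have h1 : (⟨g, hgO⟩ : O) * Polynomial.aeval n3 p = 1 := by
        apply Subtype.ext
        change g * ((Polynomial.aeval n3 p : O) : F) = 1
        rw [← hg, ← hn3]
        congr 1
        exact (Polynomial.aeval_algHom_apply O.val n3 p).symm
      have h2 := congrArg m h1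
      rw [map_mul, map_one, ← Polynomial.aeval_algHom_apply, hm3, Polynomial.aeval_def,
        Polynomial.eval₂_at_zero] at h2
      have h3 := congrArg (· * algebraMap ℂ (O ⧸ I) (p.coeff 0)⁻¹) h2
      simp only [mul_assoc, ← map_mul, one_mul] at h3
      rw [mul_inv_cancel₀ hp, map_one, mul_one] at h3
      rw [h3]
      exact Subalgebra.algebraMap_mem _ _
    have key : ∀ z (hz : z ∈ Algebra.adjoin ℂ (insert g (Set.range S.y))),
        m ⟨z, hO ▸ hz⟩ ∈ Algebra.adjoin ℂ (Set.range fun k => m (y k)) := by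
      intro z hz
      induction hz using Algebra.adjoin_induction with
      | mem z hz =>
        rcases hz with rfl | ⟨k, rfl⟩
        · exact hg'
        · exact Algebra.subset_adjoin ⟨k, rfl⟩
      | algebraMap z => exact Subalgebra.algebraMap_mem _ z
      | add z w hz hw h1 h2 => exact add_mem h1 h2
      | mul z w hz hw h1 h2 => exact mul_mem h1 h2
    exact key x (hO ▸ x.2)
  exact DQ.finrank_le_two S.isLinkage S.coupling_left S.coupling_right S.ha S.hb S.c S.c_zero
    S.c_three (fun k => m (y k)) hgen (u := m u') (v := m v')
    (by rw [← map_mul, huv', map_one]) hcl'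
    (hy a 0 n0 (DQ.sq_eq_neg_one S.ha) (hn0.trans S.N_zero) hm0)
    (hy b 3 n3 (DQ.sq_eq_neg_one S.hb) (hn3.trans S.N_three) hm3)

end ClosedChart

open IsDedekindDomain

theorem isFractionRing_of_forall_div {k F : Type*} [Field k] [Field F] [Algebra k F]
    (O : Subalgebra k F) (hO : ∀ x : F, ∃ n ∈ O, ∃ d ∈ O, x = n / d) : IsFractionRing O F := by
  refine IsFractionRing.of_field O F fun x => ?_
  obtain ⟨n, hn, d, hd, rfl⟩ := hO x
  exact ⟨⟨n, hn⟩, ⟨d, hd⟩, rfl⟩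

theorem mem_nonunits_iff_valuation {F : Type*} [Field F] {R : ValuationSubring F} {x : F} :
    x ∈ R.nonunits ↔ R.valuation x < 1 := R.mem_nonunits_iff

namespace ClosedChart

variable {h : Fin 6 → DualQuat ℝ} {a b : ℂ} {F : Type} [Field F] [Algebra ℂ F]
  (S : ClosedChart h a b F)

theorem O_fg : S.O.FG :=
  ⟨(Set.finite_range S.y).toFinset, by rw [Set.Finite.coe_toFinset]; rfl⟩

theorem valuation_le_one {R : ValuationSubring F} (hR : ∀ z ∈ S.O, z ∈ R) :
    ∀ z ∈ S.O, R.valuation z ≤ 1 := fun z hz => (R.valuation_le_one_iff z).2 (hR z hz)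

/-- An auxiliary function `φ` whose divisor controls the connection numbers. -/
theorem exists_function (hO : ∀ x : F, ∃ n ∈ S.O, ∃ d ∈ S.O, x = n / d)
    (htr : Algebra.trdeg ℂ F = 1) {R₀ : ValuationSubring F} (hR₀ : R₀ ≠ ⊤)
    (hSR₀ : ∀ z ∈ S.O, z ∈ R₀) (hNR₀ : S.N 3 ∈ R₀.nonunits) :
    ∃ (G G' φ f : F) (p : Polynomial ℂ), φ ≠ 0 ∧ G ∈ S.O ∧ G' ∈ S.O ∧ φ * G = S.N 3 ∧
      φ * G' = S.N 0 ∧ p.coeff 0 ≠ 0 ∧ f = Polynomial.aeval (S.N 3) p ∧ f ≠ 0 ∧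
      (∀ R : ValuationSubring F, (∀ z ∈ S.O, z ∈ R) → S.N 3 ∈ R.nonunits → f⁻¹ ∈ R) ∧
      (∀ R : ValuationSubring F, (∀ z ∈ S.O, z ∈ R) → f⁻¹ ∈ R → φ ∈ R) ∧
      (∀ R : ValuationSubring F, R ≠ ⊤ → (∀ z ∈ S.O, z ∈ R) → S.N 3 ∈ R.nonunits →
        DQ.gauss R.valuation (S.A 1 * S.A 2 * S.A 3) ≤ R.valuation G) := by
  have hfr := isFractionRing_of_forall_div S.O hO
  obtain ⟨-, -, hfin, -⟩ := curve_normalization S.O S.O_fg htr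
  obtain ⟨g, hg⟩ := DQ.exists_generic
    (finite_valuationSubrings S.O_fg htr (S.N_mem 3) (S.N_ne_zero 3))
    (fun R hR z => hR.2.1 _ (S.O.algebraMap_mem z)) (S.A 1 * S.A 2 * S.A 3)
  have hAmem : S.A 1 * S.A 2 * S.A 3 ∈ integral S.O :=
    mul_mem (mul_mem (S.A_mem 1) (S.A_mem 2)) (S.A_mem 3)
  have hBmem : star (S.A 0) * star (S.A 4 * S.A 5) ∈ integral S.O :=
    mul_mem (star_mem_integral (S.A_mem 0))
      (star_mem_integral (mul_mem (S.A_mem 4) (S.A_mem 5)))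
  set G := ∑ c, algebraMap ℂ F (g c) * (S.A 1 * S.A 2 * S.A 3).coords c with hG
  set G₁ := ∑ c, algebraMap ℂ F (g c) * (star (S.A 0) * star (S.A 4 * S.A 5)).coords c with hG₁
  have hGO : G ∈ S.O := sum_mem fun c _ => mul_mem (S.O.algebraMap_mem _) (coords_mem hAmem c)
  have hG₁O : G₁ ∈ S.O := sum_mem fun c _ => mul_mem (S.O.algebraMap_mem _) (coords_mem hBmem c)
  have hrel : S.N 0 * G = S.N 3 * (S.u * G₁) := by
    have h1 : ∀ c, S.N 0 * (S.A 1 * S.A 2 * S.A 3).coords c =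
        S.N 3 * S.u * (star (S.A 0) * star (S.A 4 * S.A 5)).coords c := by
      intro c
      rw [← DQ.coords_smul, ← DQ.coords_smul, S.three]
    rw [← mul_assoc, hG, hG₁, Finset.mul_sum, Finset.mul_sum]
    refine Finset.sum_congr rfl fun c _ => ?_
    rw [mul_left_comm, h1, mul_left_comm]
  have hNG : ∀ R : ValuationSubring F, R ≠ ⊤ → (∀ z ∈ S.O, z ∈ R) → S.N 3 ∈ R.nonunits →
      R.valuation (S.N 3) ≤ R.valuation G := fun R h1 h2 h3 =>
    (S.le_gauss_three (S.valuation_le_one h2)).trans (hg R ⟨h1, h2, h3⟩)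
  have hG0 : G ≠ 0 := by
    intro h0
    have h1 := hNG R₀ hR₀ hSR₀ hNR₀
    rw [h0, map_zero, le_zero_iff, map_eq_zero] at h1
    exact S.N_ne_zero 3 h1
  have hspan : Ideal.span {(⟨G, hGO⟩ : S.O)} ≠ ⊥ := by
    rw [Ne, Ideal.span_singleton_eq_bot]
    intro h0
    exact hG0 (congrArg Subtype.val h0)
  have := hfin _ hspan
  obtain ⟨p, e, hp, hmem⟩ := exists_aeval_mem_of_finite_quotient (k := ℂ)
    (Ideal.span {(⟨G, hGO⟩ : S.O)}) ⟨S.N 3, S.N_mem 3⟩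
  obtain ⟨o, ho⟩ := Ideal.mem_span_singleton.1 hmem
  set f := Polynomial.aeval (S.N 3) p with hf
  have ho' : S.N 3 ^ e * f = G * o := by
    have h1 := congrArg (fun z : S.O => (z : F)) ho
    refine Eq.trans ?_ h1
    change _ = S.N 3 ^ e * ((Polynomial.aeval (⟨S.N 3, S.N_mem 3⟩ : S.O) p : S.O) : F)
    congr 1
    exact Polynomial.aeval_algHom_apply S.O.val ⟨S.N 3, S.N_mem 3⟩ p
  have hfO : f ∈ S.O := by
    rw [hf]
    exact Polynomial.aeval_mem_adjoin_singleton ℂ (S.N 3) |> fun h =>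
      Algebra.adjoin_le (Set.singleton_subset_iff.2 (S.N_mem 3)) h
  have hf1 : ∀ R : ValuationSubring F, (∀ z ∈ S.O, z ∈ R) → S.N 3 ∈ R.nonunits →
      R.valuation f = 1 := by
    intro R hR hN
    obtain ⟨q, hq⟩ := Polynomial.X_dvd_sub_C (p := p)
    have h1 : f = algebraMap ℂ F (p.coeff 0) + S.N 3 * Polynomial.aeval (S.N 3) q := by
      rw [hf]
      conv_lhs => rw [← sub_add_cancel p (Polynomial.C (p.coeff 0)), hq]
      rw [map_add, map_mul, Polynomial.aeval_X, Polynomial.aeval_C, add_comm]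
    have h2 : Polynomial.aeval (S.N 3) q ∈ S.O :=
      Algebra.adjoin_le (Set.singleton_subset_iff.2 (S.N_mem 3))
        (Polynomial.aeval_mem_adjoin_singleton ℂ (S.N 3))
    have hc : R.valuation (algebraMap ℂ F (p.coeff 0)) = 1 := by
      refine le_antisymm (S.valuation_le_one hR _ (S.O.algebraMap_mem _)) ?_
      have h3 := S.valuation_le_one hR _ (S.O.algebraMap_mem (p.coeff 0)⁻¹)
      rw [map_inv₀, map_inv₀] at h3
      exact (inv_le_one₀ (zero_lt_iff.2 (by
        rw [Ne, map_eq_zero, map_eq_zero]; exact hp))).1 h3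
    have h3 : R.valuation (S.N 3 * Polynomial.aeval (S.N 3) q) < 1 := by
      rw [map_mul]
      exact lt_of_le_of_lt (mul_le_of_le_one_right' (S.valuation_le_one hR _ h2))
        (mem_nonunits_iff_valuation.1 hN)
    rw [h1, Valuation.map_add_eq_of_lt_left _ (by rwa [hc]), hc]
  refine ⟨G, S.u * G₁, S.N 3 / G, f, p, div_ne_zero (S.N_ne_zero 3) hG0, hGO,
    mul_mem S.u_mem hG₁O, div_mul_cancel₀ _ hG0, ?_, hp, rfl, ?_, ?_, ?_, ?_⟩
  · rw [div_mul_eq_mul_div, ← hrel, mul_div_cancel_right₀ _ hG0]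
  · intro h0
    have h1 := hf1 R₀ hSR₀ hNR₀
    rw [h0, map_zero] at h1
    exact zero_ne_one h1
  · intro R h1 h2
    rw [← R.valuation_le_one_iff, map_inv₀, hf1 R h1 h2, inv_one]
  · intro R h1 h2
    by_cases hR : R = ⊤
    · rw [hR]; exact ValuationSubring.mem_top _
    have hG1 : 0 < R.valuation G := zero_lt_iff.2 ((R.valuation.ne_zero_iff).2 hG0)
    rw [← R.valuation_le_one_iff, map_div₀]
    refine div_le_one_of_le₀ ?_ hG1.le
    by_cases hN : S.N 3 ∈ R.nonunits
    · exact hNG R hR h1 hN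
    · have hN1 : R.valuation (S.N 3) = 1 := le_antisymm (S.valuation_le_one h1 _ (S.N_mem 3))
        (not_lt.1 fun hlt => hN (mem_nonunits_iff_valuation.2 hlt))
      have hf0 : R.valuation f ≠ 0 := by
        intro h0
        have h5 := hf1 R₀ hSR₀ hNR₀
        rw [(map_eq_zero R.valuation).1 h0, map_zero] at h5
        exact zero_ne_one h5
      have hfR : R.valuation f = 1 := by
        refine le_antisymm (S.valuation_le_one h1 _ hfO) ?_
        rw [← R.valuation_le_one_iff, map_inv₀] at h2
        exact (inv_le_one₀ (zero_lt_iff.2 hf0)).1 h2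
      have h3 := congrArg R.valuation ho'
      rw [map_mul, map_pow, hN1, hfR, one_pow, one_mul, map_mul] at h3
      rw [hN1, h3]
      exact mul_le_of_le_one_right' (S.valuation_le_one h1 _ o.2)
  · exact fun R h1 h2 h3 => hg R ⟨h1, h2, h3⟩

end ClosedChart

open IsDedekindDomain

namespace ClosedChart

variable {h : Fin 6 → DualQuat ℝ} {a b : ℂ} {F : Type} [Field F] [Algebra ℂ F]
  (S : ClosedChart h a b F)

theorem forall_mem_adjoin_insert {R : ValuationSubring F} (hR : ∀ z ∈ S.O, z ∈ R) {g : F}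
    (hg : g ∈ R) : ∀ z ∈ Algebra.adjoin ℂ (insert g (Set.range S.y)), z ∈ R := by
  intro z hz
  induction hz using Algebra.adjoin_induction with
  | mem z hz =>
    rcases hz with rfl | ⟨k, rfl⟩
    · exact hg
    · exact hR _ (S.y_mem k)
  | algebraMap z => exact hR _ (S.O.algebraMap_mem z)
  | add z w _ _ h1 h2 => exact R.add_mem _ _ h1 h2
  | mul z w _ _ h1 h2 => exact R.mul_mem _ _ h1 h2

theorem sum_le_two (hO : ∀ x : F, ∃ n ∈ S.O, ∃ d ∈ S.O, x = n / d)
    (htr : Algebra.trdeg ℂ F = 1) (T : Finset (ValuationSubring F)) (k : ValuationSubring F → ℕ)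
    (hT : ∀ R ∈ T, R ≠ ⊤ ∧ (∀ z ∈ S.O, z ∈ R) ∧ S.N 3 ∈ R.nonunits)
    (hk : ∀ R ∈ T, ∃ s, (∃ y ∈ IsLocalRing.maximalIdeal R ^ (k R + s), (y : F) = S.N 3) ∧
      ∃ c, ¬ ∃ y ∈ IsLocalRing.maximalIdeal R ^ (s + 1),
        (y : F) = (S.A 1 * S.A 2 * S.A 3).coords c) : ∑ R ∈ T, k R ≤ 2 := by
  rcases T.eq_empty_or_nonempty with rfl | ⟨R₀, hR₀⟩
  · simp
  obtain ⟨G, G', φ, f, p, hφ0, hG, hG', hφG, hφG', hp, hf, hf0, hfR, hφR, hgauss⟩ :=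
    S.exists_function hO htr (hT R₀ hR₀).1 (hT R₀ hR₀).2.1 (hT R₀ hR₀).2.2
  obtain ⟨O, hOdef⟩ : ∃ O, O = Algebra.adjoin ℂ (insert f⁻¹ (Set.range S.y)) := ⟨_, rfl⟩
  have hSO : S.O ≤ O := hOdef ▸ Algebra.adjoin_mono (Set.subset_insert _ _)
  have hfO : f⁻¹ ∈ O := hOdef ▸ Algebra.subset_adjoin (Set.mem_insert _ _)
  have hfg : O.FG := by
    have h1 : (insert f⁻¹ (Set.range S.y)).Finite := (Set.finite_range S.y).insert _
    exact ⟨h1.toFinset, by rw [Set.Finite.coe_toFinset, hOdef]⟩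
  have hfr : IsFractionRing O F := isFractionRing_of_forall_div O fun x => by
    obtain ⟨n, hn, d, hd, hx⟩ := hO x
    exact ⟨n, hSO hn, d, hSO hd, hx⟩
  obtain ⟨hD1, hD2, -, hDfin, hDO⟩ := curve_normalization O hfg htr
  have hTO : ∀ R ∈ T, ∀ z ∈ O, z ∈ R := fun R hR => hOdef ▸
    S.forall_mem_adjoin_insert (hT R hR).2.1 (hfR R (hT R hR).2.1 (hT R hR).2.2)
  let D := integralClosure O F
  let φD : D := ⟨φ, (isIntegral_iff_forall_valuationSubring O φ).2 fun R hR =>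
    hφR R (fun z hz => hR z (hSO hz)) (hR _ hfO)⟩
  have hφD0 : φD ≠ 0 := fun h0 => hφ0 (congrArg (fun z : D => (z : F)) h0)
  let n0 : O := ⟨S.N 0, hSO (S.N_mem 0)⟩
  let n3 : O := ⟨S.N 3, hSO (S.N_mem 3)⟩
  obtain ⟨hI1, hI2⟩ := S.finrank_quotient_le_two hOdef hp
    (by rw [← hf, inv_mul_cancel₀ hf0]) (n0 := n0) (n3 := n3) rfl rfl
  let ι : O →ₐ[ℂ] D := IsScalarTower.toAlgHom ℂ O D
  let GO : O := ⟨G, hSO hG⟩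
  let GO' : O := ⟨G', hSO hG'⟩
  have hn3 : φD * ι GO = ι n3 := Subtype.ext hφG
  have hn0 : φD * ι GO' = ι n0 := Subtype.ext hφG'
  let f₁ : D →ₗ[ℂ] D := LinearMap.mulLeft ℂ φD
  let U : Submodule ℂ D := ((Ideal.span {GO, GO'}).restrictScalars ℂ).map ι.toLinearMap
  let I : Submodule ℂ O := (Ideal.span {n0, n3}).restrictScalars ℂ
  have hUf : U.map f₁ = I.map ι.toLinearMap := by
    apply le_antisymm
    · rintro _ ⟨_, ⟨x, hx, rfl⟩, rfl⟩
      obtain ⟨s, t, rfl⟩ := Ideal.mem_span_pair.1 hx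
      refine ⟨s * n3 + t * n0, Ideal.mem_span_pair.2 ⟨t, s, add_comm _ _⟩, ?_⟩
      change ι (s * n3 + t * n0) = φD * ι (s * GO + t * GO')
      rw [map_add, map_mul, map_mul, map_add, map_mul, map_mul, ← hn3, ← hn0]
      ring
    · rintro _ ⟨x, hx, rfl⟩
      obtain ⟨s, t, rfl⟩ := Ideal.mem_span_pair.1 hx
      refine ⟨_, ⟨t * GO + s * GO', Ideal.mem_span_pair.2 ⟨t, s, rfl⟩, rfl⟩, ?_⟩
      change φD * ι (t * GO + s * GO') = ι (s * n0 + t * n3)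
      rw [map_add, map_mul, map_mul, map_add, map_mul, map_mul, ← hn3, ← hn0]
      ring
  have hfinI : Module.Finite ℂ (O ⧸ I) := hI1
  have hfinDO : Module.Finite ℂ (D ⧸ LinearMap.range ι.toLinearMap) := hDO
  obtain ⟨-, hdim⟩ := finrank_quotient_range_le f₁
    (fun x y hxy => mul_left_cancel₀ hφD0 hxy) U ι.toLinearMap I
    (LinearMap.map_le_range) hUf.ge (hUf.le.trans LinearMap.map_le_range)
  have hrange : LinearMap.range f₁ = (Ideal.span {φD}).restrictScalars ℂ := by
    ext x
    rw [Submodule.restrictScalars_mem, Ideal.mem_span_singleton]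
    exact ⟨fun ⟨y, hy⟩ => ⟨y, hy.symm⟩, fun ⟨y, hy⟩ => ⟨y, hy.symm⟩⟩
  rw [hrange] at hdim
  have hdim2 : Module.finrank ℂ (D ⧸ Ideal.span {φD}) ≤ 2 := hdim.trans hI2
  have hfinφ : Module.Finite ℂ (D ⧸ Ideal.span {φD}) :=
    hDfin _ (by rwa [Ne, Ideal.span_singleton_eq_bot])
  have hP : ∀ R : T, ∃ P : HeightOneSpectrum D, ∀ x : F, x ∈ R.1 ↔ P.valuation F x ≤ 1 :=
    fun R => exists_heightOne_of_valuationSubring R.1 (hT R.1 R.2).1 fun d =>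
      (isIntegral_iff_forall_valuationSubring O _).1 d.2 R.1 (hTO R.1 R.2)
  choose P hP using hP
  have hPR : ∀ R : T, ((P R).valuation F).valuationSubring = R.1 := by
    intro R
    ext z
    rw [Valuation.mem_valuationSubring_iff, hP]
  have hinj : Function.Injective P := fun R R' hRR => Subtype.ext <| by
    rw [← hPR R, hRR, hPR R']
  classical
  have hsum := sum_le_finrank_quotient (k := ℂ) (Finset.univ.image P)
    (fun Q => k (Q.valuation F).valuationSubring) (Ideal.span {φD}) (by
      intro Q hQ
      obtain ⟨R, -, rfl⟩ := Finset.mem_image.1 hQ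
      rw [hPR, Ideal.span_singleton_le_iff_mem, ← HeightOneSpectrum.intValuation_le_pow_iff_mem,
        ← HeightOneSpectrum.valuation_of_algebraMap (K := F)]
      change (P R).valuation F φ ≤ _
      obtain ⟨s, h1, c, h2⟩ := hk R.1 R.2
      rw [mem_maximalIdeal_pow_iff (hP R)] at h1 h2
      have h3 : (P R).valuation F ((S.A 1 * S.A 2 * S.A 3).coords c) ≤ (P R).valuation F G := by
        have h4 := (DQ.le_gauss _ c).trans
          (hgauss R.1 (hT R.1 R.2).1 (hT R.1 R.2).2.1 (hT R.1 R.2).2.2)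
        rw [← hPR R] at h4
        exact (Valuation.isEquiv_valuation_valuationSubring _ _ _).2 h4
      have h5 : WithZero.exp (-((s : ℤ) + 1)) < (P R).valuation F G := by
        push_cast at h2
        exact (not_le.1 h2).trans_le h3
      have hG0 : (P R).valuation F G ≠ 0 := fun h0 => by
        rw [h0] at h5
        exact not_lt_zero h5
      have hφ : (P R).valuation F φ * (P R).valuation F G ≤
          WithZero.exp (-((k R.1 + s : ℕ) : ℤ)) := by
        rw [← map_mul, hφG]
        exact h1
      have hφ1 : (P R).valuation F φ ≠ 0 := (Valuation.ne_zero_iff _).2 hφ0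
      rw [← WithZero.exp_log hG0, WithZero.exp_lt_exp] at h5
      rw [← WithZero.exp_log hG0, ← WithZero.exp_log hφ1, ← WithZero.exp_add,
        WithZero.exp_le_exp] at hφ
      rw [← WithZero.exp_log hφ1, WithZero.exp_le_exp]
      push_cast at hφ
      omega)
  rw [Finset.sum_image fun R _ R' _ hRR => hinj hRR] at hsum
  simp only [hPR] at hsum
  rw [← Finset.sum_coe_sort]
  exact hsum.trans hdim2

end ClosedChart

namespace ConfigCurve

variable {n : ℕ} {h : Fin n → DualQuat ℝ} (K : ConfigCurve h)

theorem x_ne_zero (i : Fin n) : K.x i 0 ≠ 0 ∨ K.x i 1 ≠ 0 := by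
  by_contra! hcon
  have h1 : ∀ j, MvPolynomial.X (i, j) ∈ coneIdeal K.carrier := by
    intro j
    rw [← K.aeval_x_eq_zero_iff, MvPolynomial.aeval_X]
    fin_cases j
    · exact hcon.1
    · exact hcon.2
  obtain ⟨p, hp⟩ := K.isComponent.1.1.1
  refine (p i).rep_nonzero (funext fun j => ?_)
  have h2 := h1 j
  rw [coneIdeal, MvPolynomial.mem_vanishingIdeal_iff] at h2
  have h3 := h2 _ (rep_mem_cone hp)
  rwa [MvPolynomial.aeval_X] at h3

end ConfigCurve

namespace ConfigCurve.NPoint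

variable {n : ℕ} {h : Fin n → DualQuat ℝ} {K : ConfigCurve h} (β : K.NPoint)

theorem exists_localCoord_eq (i : Fin n) : ∃ e : K.ConeField, e ≠ 0 ∧
    ∀ j, (β.localCoord i j : K.ConeField) = e * K.x i j := by
  by_cases h1 : K.x i 1 = 0
  · have h0 : K.x i 0 ≠ 0 := (K.x_ne_zero i).resolve_right (not_not.2 h1)
    refine ⟨(K.x i 0)⁻¹, inv_ne_zero h0, fun j => ?_⟩
    rw [localCoord, if_pos h1]
    fin_cases j
    · exact (inv_mul_cancel₀ h0).symm
    · exact (by rw [h1, mul_zero] : (K.x i 0)⁻¹ * K.x i 1 = 0).symm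
  by_cases ht : K.t i ∈ β.ring
  · refine ⟨(K.x i 1)⁻¹, inv_ne_zero h1, fun j => ?_⟩
    rw [localCoord, if_neg h1, if_pos ht]
    fin_cases j
    · exact (div_eq_inv_mul _ _)
    · exact (inv_mul_cancel₀ h1).symm
  · have ht0 : K.t i ≠ 0 := fun h0 => ht (h0 ▸ β.ring.zero_mem)
    have h0 : K.x i 0 ≠ 0 := by
      intro h0
      refine ht0 (Subtype.ext ?_)
      change K.x i 0 / K.x i 1 = 0
      rw [h0, zero_div]
    refine ⟨(K.x i 0)⁻¹, inv_ne_zero h0, fun j => ?_⟩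
    rw [localCoord, if_neg h1, if_neg ht]
    fin_cases j
    · exact (inv_mul_cancel₀ h0).symm
    · change ((K.t i)⁻¹ : K.functionField).1 = (K.x i 0)⁻¹ * K.x i 1
      change (K.x i 0 / K.x i 1)⁻¹ = _
      rw [inv_div, div_eq_inv_mul]

theorem localCoord_mem (i : Fin n) (j : Fin 2) : β.localCoord i j ∈ β.ring := by
  rw [localCoord]
  split_ifs with h1 h2
  · fin_cases j
    · exact β.ring.one_mem
    · exact β.ring.zero_mem
  · fin_cases j
    · exact h2
    · exact β.ring.one_mem
  · fin_cases j
    · exact β.ring.one_mem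
    · exact (β.ring.mem_or_inv_mem _).resolve_left h2

theorem localCoord_eq_one (i : Fin n) : ∃ j, β.localCoord i j = 1 := by
  rw [localCoord]
  split_ifs
  exacts [⟨0, rfl⟩, ⟨1, rfl⟩, ⟨0, rfl⟩]

theorem valuation_const {z : ℂ} (hz : z ≠ 0) :
    β.ring.valuation (algebraMap ℂ K.functionField z) = 1 := by
  refine le_antisymm ((β.ring.valuation_le_one_iff _).2 (β.const_mem z)) ?_
  have h1 := (β.ring.valuation_le_one_iff _).2 (β.const_mem z⁻¹)
  rw [map_inv₀, map_inv₀] at h1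
  exact (inv_le_one₀ (zero_lt_iff.2 (by rw [Ne, map_eq_zero, map_eq_zero]; exact hz))).1 h1

theorem valuation_const_mul {z : ℂ} (hz : z ≠ 0) (x : K.functionField) :
    β.ring.valuation (algebraMap ℂ K.functionField z * x) = β.ring.valuation x := by
  rw [map_mul, β.valuation_const hz, one_mul]

/-- The value `x - z y` of a linear form at the local homogeneous coordinates. -/
def linearForm (i : Fin n) (z : ℂ) : K.functionField :=
  β.localCoord i 0 - algebraMap ℂ K.functionField z * β.localCoord i 1

theorem linearForm_mem (i : Fin n) (z : ℂ) : β.linearForm i z ∈ β.ring :=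
  sub_mem (β.localCoord_mem i 0) (mul_mem (β.const_mem z) (β.localCoord_mem i 1))

theorem valuation_localCoord_one {i : Fin n} {z : ℂ}
    (hz : β.ring.valuation (β.linearForm i z) < 1) :
    β.ring.valuation (β.localCoord i 1) = 1 := by
  refine le_antisymm ((β.ring.valuation_le_one_iff _).2 (β.localCoord_mem i 1)) ?_
  by_contra! hlt
  have h0 : β.ring.valuation (β.localCoord i 0) < 1 := by
    have h1 : β.localCoord i 0 =
        β.linearForm i z + algebraMap ℂ K.functionField z * β.localCoord i 1 := by
      rw [linearForm, sub_add_cancel]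
    rw [h1]
    refine β.ring.valuation.map_add_lt hz ?_
    rw [map_mul]
    exact lt_of_le_of_lt
      (mul_le_of_le_one_left' ((β.ring.valuation_le_one_iff _).2 (β.const_mem z))) hlt
  obtain ⟨j, hj⟩ := β.localCoord_eq_one i
  have h2 : β.ring.valuation (β.localCoord i j) < 1 := by
    fin_cases j
    · exact h0
    · exact hlt
  rw [hj, map_one] at h2
  exact lt_irrefl _ h2

theorem linearForm_unique {i : Fin n} {z z' : ℂ}
    (hz : β.ring.valuation (β.linearForm i z) < 1)
    (hz' : β.ring.valuation (β.linearForm i z') < 1) : z = z' := by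
  by_contra hne
  have h1 : β.linearForm i z' - β.linearForm i z =
      algebraMap ℂ K.functionField (z - z') * β.localCoord i 1 := by
    rw [linearForm, linearForm, map_sub]
    ring
  have h2 := β.ring.valuation.map_sub_lt hz' hz
  rw [h1, β.valuation_const_mul (sub_ne_zero.2 hne), β.valuation_localCoord_one hz] at h2
  exact lt_irrefl _ h2

theorem linearForm_of_liesOver {p : P1Pow n} (hp : β.LiesOver p) {i : Fin n} {z : ℂ}
    (hpi : p i = affinePt z) : β.ring.valuation (β.linearForm i z) < 1 := by
  have h1 := mem_nonunits_iff_valuation.1 (hp i)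
  rw [← (p i).mk_rep, affinePt, Projectivization.mk_eq_mk_iff'] at hpi
  obtain ⟨d, hd⟩ := hpi
  have h2 := congrFun hd 0
  have h3 := congrFun hd 1
  simp only [Pi.smul_apply, Matrix.cons_val, smul_eq_mul, mul_one] at h2 h3
  have hd0 : d ≠ 0 := by
    rintro rfl
    refine (p i).rep_nonzero (funext fun j => ?_)
    fin_cases j
    · exact h2.symm.trans (zero_mul z)
    · exact h3.symm
  have h4 : algebraMap ℂ K.functionField ((p i).rep 0) * β.localCoord i 1 -
      algebraMap ℂ K.functionField ((p i).rep 1) * β.localCoord i 0 =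
      algebraMap ℂ K.functionField (-d) * β.linearForm i z := by
    rw [← h2, ← h3, linearForm, map_mul, map_neg]
    ring
  rwa [h4, β.valuation_const_mul (neg_ne_zero.2 hd0)] at h1

theorem eq_affinePt_of_linearForm {p : P1Pow n} (hp : β.LiesOver p) {i : Fin n} {z : ℂ}
    (hz : β.ring.valuation (β.linearForm i z) < 1) : p i = affinePt z := by
  have h1 := mem_nonunits_iff_valuation.1 (hp i)
  have h2 : (p i).rep 0 = z * (p i).rep 1 := by
    by_contra hne
    have h3 : (algebraMap ℂ K.functionField ((p i).rep 0) * β.localCoord i 1 -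
        algebraMap ℂ K.functionField ((p i).rep 1) * β.localCoord i 0) +
        algebraMap ℂ K.functionField ((p i).rep 1) * β.linearForm i z =
        algebraMap ℂ K.functionField ((p i).rep 0 - z * (p i).rep 1) * β.localCoord i 1 := by
      rw [linearForm, map_sub, map_mul]
      ring
    have h4 := β.ring.valuation.map_add_lt h1 (y := algebraMap ℂ K.functionField ((p i).rep 1) *
      β.linearForm i z) (by
        rw [map_mul]
        exact lt_of_le_of_lt
          (mul_le_of_le_one_left' ((β.ring.valuation_le_one_iff _).2 (β.const_mem _))) hz)
    rw [h3, β.valuation_const_mul (sub_ne_zero.2 hne), β.valuation_localCoord_one hz] at h4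
    exact lt_irrefl _ h4
  rw [← (p i).mk_rep, affinePt, Projectivization.mk_eq_mk_iff']
  refine ⟨(p i).rep 1, funext fun j => ?_⟩
  fin_cases j
  · exact (mul_comm _ _).trans h2.symm
  · exact mul_one _

theorem exists_normalization {K : ConfigCurve h} (T : Finset K.NPoint) (i : Fin n) :
    ∃ z : ℂ, ∀ β ∈ T, β.ring.valuation (β.linearForm i z) = 1 := by
  have hfin : (⋃ β ∈ T, {z : ℂ | β.ring.valuation (β.linearForm i z) < 1}).Finite :=
    T.finite_toSet.biUnion fun β _ =>
      Set.Subsingleton.finite fun z hz z' hz' => β.linearForm_unique hz hz'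
  obtain ⟨z, hz⟩ := hfin.infinite_compl.nonempty
  refine ⟨z, fun β hβ => le_antisymm ((β.ring.valuation_le_one_iff _).2 (β.linearForm_mem i z)) ?_⟩
  by_contra! hlt
  exact hz (Set.mem_biUnion hβ hlt)

end ConfigCurve.NPoint

/-- The product of the normalized factors with indices `i ≤ k < j`. -/
theorem of_chain_chartCoord {A : Type*} [CommRing A] [Algebra ℂ A] {n : ℕ}
    (h : Fin n → DualQuat ℝ) (c : Fin n → ℂ) (y : Fin n → A) (i j : ℕ) :
    DQ.of (chain ((algebraMap ℂ A).comp Complex.ofRealHom) h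
      (fun k l => chartCoord c y (k, l)) i j) =
    ((((List.finRange n).take j).drop i).map fun k => DQ.factor (h k) (c k) (y k)).prod := by
  rw [of_chain]
  refine congrArg List.prod (List.map_congr_left fun k _ => ?_)
  rw [DQ.factor_eq, DQ.cx, DQ.map_map]
  rfl

namespace ConfigCurve

section fractions

variable {n : ℕ} {h : Fin n → DualQuat ℝ} (K : ConfigCurve h) {c : Fin n → ℂ}
  {Y : Fin n → K.functionField} {d : Fin n → K.ConeField} (hd : ∀ i, d i ≠ 0)
  (hx : ∀ i j, K.x i j = d i * chartCoord c (fun i => (Y i : K.ConeField)) (i, j))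

include hx in
theorem exists_eq_div (z : K.functionField) : ∃ a ∈ Algebra.adjoin ℂ (Set.range Y),
    ∃ b ∈ Algebra.adjoin ℂ (Set.range Y), z = a / b := by
  have h1 : K.functionField ≤
      IntermediateField.adjoin ℂ (Set.range fun i => (Y i : K.ConeField)) := by
    refine IntermediateField.adjoin_le_iff.2 ?_
    rintro _ ⟨i, rfl⟩
    have hY : (Y i : K.ConeField) ∈
      IntermediateField.adjoin ℂ (Set.range fun i => (Y i : K.ConeField)) :=
      IntermediateField.subset_adjoin _ _ ⟨i, rfl⟩
    change K.x i 0 / K.x i 1 ∈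
      IntermediateField.adjoin ℂ (Set.range fun i => (Y i : K.ConeField))
    by_cases hd0 : d i = 0
    · rw [hx i 1, hd0, zero_mul, div_zero]
      exact zero_mem _
    rw [hx i 0, hx i 1, mul_div_mul_left _ _ hd0]
    exact div_mem (add_mem (one_mem _) (mul_mem (IntermediateField.algebraMap_mem _ _) hY)) hY
  obtain ⟨a, ha, b, hb, hab⟩ := IntermediateField.mem_adjoin_iff_div.1 (h1 z.2)
  have h2 : Algebra.adjoin ℂ (Set.range fun i => (Y i : K.ConeField)) =
      (Algebra.adjoin ℂ (Set.range Y)).map K.functionField.val := by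
    rw [AlgHom.map_adjoin, ← Set.range_comp]
    rfl
  rw [h2] at ha hb
  obtain ⟨a, ha, rfl⟩ := ha
  obtain ⟨b, hb, rfl⟩ := hb
  exact ⟨a, ha, b, hb, Subtype.ext hab⟩

include hd hx in
theorem trdeg_functionField (β : K.NPoint) : Algebra.trdeg ℂ K.functionField = 1 := by
  let O := Algebra.adjoin ℂ (Set.range Y)
  let y : Fin n → O := fun i => ⟨Y i, Algebra.subset_adjoin ⟨i, rfl⟩⟩
  have hgen : Algebra.adjoin ℂ (Set.range y) = ⊤ := by
    have h1 : Set.range y = (↑) ⁻¹' Set.range Y := by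
      ext z
      exact ⟨fun ⟨i, hi⟩ => ⟨i, congrArg Subtype.val hi⟩, fun ⟨i, hi⟩ => ⟨i, Subtype.ext hi⟩⟩
    rw [h1]
    exact Algebra.adjoin_adjoin_coe_preimage
  have hfr : IsFractionRing O K.functionField := isFractionRing_of_forall_div O (K.exists_eq_div hx)
  have h1 := K.isAlgebraic_or_trdeg_eq_one (ι := K.functionField.val.comp O.val)
    (Subtype.val_injective.comp Subtype.val_injective) (c := c) (Y := y) (e := d) hx hd hgen
  rcases h1 with h1 | h1
  · exfalso
    have h2 : Algebra.IsIntegral ℂ O := inferInstance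
    have h3 := IsAlgClosed.algebraMap_bijective_of_isIntegral (k := ℂ) (K := O)
    refine β.ne_top (top_le_iff.1 fun z _ => ?_)
    obtain ⟨a, ha, b, hb, rfl⟩ := K.exists_eq_div hx z
    obtain ⟨a', ha'⟩ := h3.2 ⟨a, ha⟩
    obtain ⟨b', hb'⟩ := h3.2 ⟨b, hb⟩
    have h4 : a / b = algebraMap ℂ K.functionField (a' / b') := by
      rw [map_div₀]
      exact congrArg₂ (· / ·) (congrArg Subtype.val ha').symm (congrArg Subtype.val hb').symm
    rw [h4]
    exact β.const_mem _
  · exact (trdeg_subalgebra_eq O).symm.trans h1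

end fractions

section six

variable {h : Fin 6 → DualQuat ℝ} (K : ConfigCurve h) {c : Fin 6 → ℂ}
  {Y : Fin 6 → K.functionField} {d : Fin 6 → K.ConeField} (hd : ∀ i, d i ≠ 0)
  (hx : ∀ i j, K.x i j = d i * chartCoord c (fun i => (Y i : K.ConeField)) (i, j))

include hd hx in
theorem exists_closed : ∃ r : K.functionField, r ≠ 0 ∧
    DQ.factor (h 0) (c 0) (Y 0) * DQ.factor (h 1) (c 1) (Y 1) *
    DQ.factor (h 2) (c 2) (Y 2) * (DQ.factor (h 3) (c 3) (Y 3) * DQ.factor (h 4) (c 4) (Y 4) *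
    DQ.factor (h 5) (c 5) (Y 5)) = r • 1 := by
  obtain ⟨r, hr, hK⟩ := K.exists_chain_eq_smul_one
  have hxe : K.x = fun k l => d k * chartCoord c (fun i => (Y i : K.ConeField)) (k, l) :=
    funext fun k => funext fun l => hx k l
  rw [hxe, of_chain_mul h _ d fun k l => chartCoord c (fun i => (Y i : K.ConeField)) (k, l),
    of_chain_chartCoord] at hK
  have hlist : ((List.finRange 6).take 6).drop 0 = [0, 1, 2, 3, 4, 5] := by decide
  rw [hlist] at hK
  simp only [List.map_cons, List.map_nil, List.prod_cons, List.prod_nil, mul_one] at hK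
  have hD : d 0 * (d 1 * (d 2 * (d 3 * (d 4 * d 5)))) ≠ 0 := by
    simp only [mul_ne_zero_iff]
    exact ⟨hd 0, hd 1, hd 2, hd 3, hd 4, hd 5⟩
  generalize d 0 * (d 1 * (d 2 * (d 3 * (d 4 * d 5)))) = D at hK hD
  set q := DQ.factor (h 0) (c 0) (Y 0) * DQ.factor (h 1) (c 1) (Y 1) *
    DQ.factor (h 2) (c 2) (Y 2) * (DQ.factor (h 3) (c 3) (Y 3) * DQ.factor (h 4) (c 4) (Y 4) *
    DQ.factor (h 5) (c 5) (Y 5)) with hq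
  have hmap : D • DQ.map (K.functionField.val : K.functionField →+* K.ConeField) q = r • 1 := by
    rw [hq, ← hK]
    simp only [_root_.map_mul, DQ.map_factor, mul_assoc]
    rfl
  have hco : ∀ e, D * (q.coords e : K.ConeField) = r * (1 : DQ K.ConeField).coords e := by
    intro e
    have h1 := congrArg (fun z => DQ.coords z e) hmap
    simp only [DQ.coords_smul, DQ.coords_map] at h1
    exact h1
  refine ⟨q.coords 0, fun h0 => hr ?_, DQ.ext_coords fun e => ?_⟩
  · have h1 := hco 0
    rw [h0, DQ.coords_one_zero, mul_one] at h1
    rw [← h1]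
    exact mul_zero D
  · rw [DQ.coords_smul]
    by_cases he : e = 0
    · rw [he, DQ.coords_one_zero, mul_one]
    · have h1 := hco e
      rw [DQ.coords_one_of_ne he, mul_zero] at h1
      rw [DQ.coords_one_of_ne he, mul_zero]
      exact Subtype.ext ((mul_eq_zero.1 h1).resolve_left hD)

end six

end ConfigCurve

open IsDedekindDomain

section order

variable {D F : Type*} [CommRing D] [IsDedekindDomain D] [Field F] [Algebra D F]
  [IsFractionRing D F] {R : ValuationSubring F} {P : HeightOneSpectrum D}
  (hP : ∀ x : F, x ∈ R ↔ P.valuation F x ≤ 1)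

include hP

theorem sSup_order_eq {q : DQ F} {m : ℕ}
    (hq : DQ.gauss (P.valuation F) q = WithZero.exp (-(m : ℤ))) :
    sSup {m : ℕ | ∀ c : Fin 8, ∃ y ∈ IsLocalRing.maximalIdeal R ^ m, (y : F) = q.coords c} = m := by
  have h1 : {m : ℕ | ∀ c : Fin 8, ∃ y ∈ IsLocalRing.maximalIdeal R ^ m, (y : F) = q.coords c} =
      Set.Iic m := by
    ext k
    simp only [mem_maximalIdeal_pow_iff hP, Set.mem_ofPred_eq, Set.mem_Iic]
    rw [← DQ.gauss_le_iff, hq, WithZero.exp_le_exp]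
    omega
  rw [h1, csSup_Iic]

theorem valuation_eq_one_iff (x : F) : R.valuation x = 1 ↔ P.valuation F x = 1 :=
  (Valuation.isEquiv_iff_val_eq_one.1 (Valuation.isEquiv_iff_val_le_one.2
    fun {x} => (R.valuation_le_one_iff x).trans (hP x)))

end order

theorem exists_exp_eq {x : WithZero (Multiplicative ℤ)} (h0 : x ≠ 0) (h1 : x ≤ 1) :
    ∃ m : ℕ, x = WithZero.exp (-(m : ℤ)) := by
  rw [← WithZero.exp_log h0, ← WithZero.exp_zero, WithZero.exp_le_exp] at h1
  refine ⟨(-WithZero.log x).toNat, ?_⟩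
  rw [Int.toNat_of_nonneg (by omega), neg_neg, WithZero.exp_log h0]

namespace ClosedChart

variable {h : Fin 6 → DualQuat ℝ} {a b : ℂ} {F : Type} [Field F] [Algebra ℂ F]
  (S : ClosedChart h a b F)

/-- The vanishing order of a product of consecutive factors with unit multiples of the
normalized coordinates. -/
theorem gauss_chain {Γ : Type*} [LinearOrderedCommGroupWithZero Γ] {w : Valuation F Γ}
    {v : Fin 6 → Fin 2 → F} {e : Fin 6 → F} (he : ∀ k, w (e k) = 1)
    (hv : ∀ k l, v k l = e k * chartCoord S.c S.y (k, l)) (i j : ℕ) :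
    DQ.gauss w (DQ.of (chain ((algebraMap ℂ F).comp Complex.ofRealHom) h v i j)) =
      DQ.gauss w ((((List.finRange 6).take j).drop i).map S.A).prod := by
  have hve : v = fun k l => e k * chartCoord S.c S.y (k, l) :=
    funext fun k => funext fun l => hv k l
  rw [hve, of_chain_mul h _ e fun k l => chartCoord S.c S.y (k, l), of_chain_chartCoord,
    DQ.gauss_smul, map_list_prod, List.map_map, List.prod_eq_one, one_mul]
  · rfl
  · intro z hz
    obtain ⟨k, -, rfl⟩ := List.mem_map.1 hz
    exact he k

/-- The vanishing orders that enter the connection number of the joints `0` and `3`. -/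
theorem exists_orders (hO : ∀ x : F, ∃ n ∈ S.O, ∃ d ∈ S.O, x = n / d)
    (htr : Algebra.trdeg ℂ F = 1) {R : ValuationSubring F} (hR : R ≠ ⊤)
    (hSR : ∀ z ∈ S.O, z ∈ R) (hN3 : R.valuation (S.N 3) < 1)
    {v : Fin 6 → Fin 2 → F} {e : Fin 6 → F} (he : ∀ k, R.valuation (e k) = 1)
    (hv : ∀ k l, v k l = e k * chartCoord S.c S.y (k, l)) :
    ∃ (o : ℕ → ℕ → ℕ) (m s : ℕ), (∀ i j, o i j = sSup {m : ℕ | ∀ c : Fin 8,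
      ∃ y ∈ IsLocalRing.maximalIdeal R ^ m, (y : F) =
        (chain ((algebraMap ℂ F).comp Complex.ofRealHom) h v i j).coords c}) ∧
      o 1 3 = 0 ∧ o 0 3 = 0 ∧ o 0 4 = m ∧ o 1 4 = s ∧ s ≤ m ∧ 1 ≤ m ∧
      (∃ y ∈ IsLocalRing.maximalIdeal R ^ m, (y : F) = S.N 3) ∧
      (∃ c, ¬ ∃ y ∈ IsLocalRing.maximalIdeal R ^ (s + 1),
        (y : F) = (S.A 1 * S.A 2 * S.A 3).coords c) ∧
      (R.valuation (S.N 1) = 1 → R.valuation (S.N 2) = 1 → s = 0) := by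
  have hfr := isFractionRing_of_forall_div S.O hO
  obtain ⟨h1, h2, -⟩ := curve_normalization S.O S.O_fg htr
  obtain ⟨P, hP⟩ := exists_heightOne S.O_fg htr R hR hSR
  have hP := hP h1 h2
  have hw : ∀ x ∈ S.O, P.valuation F x ≤ 1 := fun x hx => (hP x).1 (hSR x hx)
  have heP : ∀ k, P.valuation F (e k) = 1 := fun k => (valuation_eq_one_iff hP _).1 (he k)
  obtain ⟨m, hm⟩ := exists_exp_eq ((P.valuation F).ne_zero_iff.2 (S.N_ne_zero 3))
    (hw _ (S.N_mem 3))
  have hle := S.le_gauss_three hw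
  obtain ⟨s, hs⟩ := exists_exp_eq (x := DQ.gauss (P.valuation F) (S.A 1 * S.A 2 * S.A 3))
    (fun h0 => by
      rw [h0, hm, le_zero_iff] at hle
      exact WithZero.exp_ne_zero hle)
    (S.gauss_le_one hw (mul_mem (mul_mem (S.A_mem 1) (S.A_mem 2)) (S.A_mem 3)))
  have hord : ∀ (i j t : ℕ) (q : DQ F),
      ((((List.finRange 6).take j).drop i).map S.A).prod = q →
      DQ.gauss (P.valuation F) q = WithZero.exp (-(t : ℤ)) →
      sSup {m : ℕ | ∀ c : Fin 8, ∃ y ∈ IsLocalRing.maximalIdeal R ^ m, (y : F) =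
        (chain ((algebraMap ℂ F).comp Complex.ofRealHom) h v i j).coords c} = t := by
    intro i j t q hq ht
    have h3 := S.gauss_chain heP hv i j
    rw [hq, ht] at h3
    exact sSup_order_eq hP h3
  refine ⟨_, m, s, fun i j => rfl, ?_, ?_, ?_, ?_, ?_, ?_, ?_, ?_, ?_⟩
  · refine hord 1 3 0 (S.A 1 * S.A 2) ?_ ?_
    · have h4 : ((List.finRange 6).take 3).drop 1 = [1, 2] := by decide
      rw [h4]
      simp only [List.map_cons, List.map_nil, List.prod_cons, List.prod_nil, mul_one]
    · rw [S.gauss_one_two hw, Nat.cast_zero, neg_zero, WithZero.exp_zero]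
  · refine hord 0 3 0 (S.A 0 * S.A 1 * S.A 2) ?_ ?_
    · have h4 : ((List.finRange 6).take 3).drop 0 = [0, 1, 2] := by decide
      rw [h4]
      simp only [List.map_cons, List.map_nil, List.prod_cons, List.prod_nil, mul_one, mul_assoc]
    · rw [S.gauss_left hw, Nat.cast_zero, neg_zero, WithZero.exp_zero]
  · refine hord 0 4 m (S.A 0 * S.A 1 * S.A 2 * S.A 3) ?_ ?_
    · have h4 : ((List.finRange 6).take 4).drop 0 = [0, 1, 2, 3] := by decide
      rw [h4]
      simp only [List.map_cons, List.map_nil, List.prod_cons, List.prod_nil, mul_one, mul_assoc]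
    · rw [S.gauss_four hw, hm]
  · refine hord 1 4 s (S.A 1 * S.A 2 * S.A 3) ?_ hs
    have h4 : ((List.finRange 6).take 4).drop 1 = [1, 2, 3] := by decide
    rw [h4]
    simp only [List.map_cons, List.map_nil, List.prod_cons, List.prod_nil, mul_one, mul_assoc]
  · rw [hm, hs, WithZero.exp_le_exp] at hle
    omega
  · by_contra hlt
    have hm0 : m = 0 := by omega
    rw [hm0, Nat.cast_zero, neg_zero, WithZero.exp_zero, ← valuation_eq_one_iff hP] at hm
    exact absurd hm hN3.ne
  · rw [mem_maximalIdeal_pow_iff hP]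
    exact hm.le
  · obtain ⟨c, hc⟩ := DQ.exists_eq_gauss (P.valuation F) (S.A 1 * S.A 2 * S.A 3)
    refine ⟨c, ?_⟩
    rw [mem_maximalIdeal_pow_iff hP, ← hc, hs, WithZero.exp_le_exp]
    push_cast
    omega
  · intro h3 h4
    have h5 := S.gauss_three_eq_one hw ((valuation_eq_one_iff hP _).1 h3)
      ((valuation_eq_one_iff hP _).1 h4)
    rw [hs, ← WithZero.exp_zero, WithZero.exp_inj] at h5
    omega

end ClosedChart

namespace ConfigCurve.NPoint

section

variable {n : ℕ} {h : Fin n → DualQuat ℝ} {K : ConfigCurve h} (β : K.NPoint)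

theorem localCoord_eq_mul {c : Fin n → ℂ} {Y : Fin n → K.functionField} {d : Fin n → K.ConeField}
    (hx : ∀ i j, K.x i j = d i * chartCoord c (fun i => (Y i : K.ConeField)) (i, j))
    (i : Fin n) (j : Fin 2) :
    β.localCoord i j = β.linearForm i (c i) * chartCoord c Y (i, j) := by
  obtain ⟨e, -, he⟩ := β.exists_localCoord_eq i
  have h1 : (β.linearForm i (c i) : K.ConeField) = e * d i := by
    have h2 := chartCoord_sub c (fun i => (Y i : K.ConeField)) i
    change (β.localCoord i 0 : K.ConeField) - algebraMap ℂ K.ConeField (c i) *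
      (β.localCoord i 1 : K.ConeField) = _
    rw [he, he, hx, hx]
    linear_combination e * d i * h2
  apply Subtype.ext
  change (β.localCoord i j : K.ConeField) =
    (β.linearForm i (c i) : K.ConeField) * K.functionField.val (chartCoord c Y (i, j))
  rw [h1, map_chartCoord, he, hx, mul_assoc]
  rfl

theorem exists_normalized_coordinates {c : Fin n → ℂ} (hc : ∀ i, β.linearForm i (c i) ≠ 0) :
    ∃ (Y : Fin n → K.functionField) (d : Fin n → K.ConeField), (∀ i, d i ≠ 0) ∧
      ∀ i j, K.x i j = d i * chartCoord c (fun i => (Y i : K.ConeField)) (i, j) := by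
  choose e he0 he using β.exists_localCoord_eq
  have hE : ∀ i, (β.linearForm i (c i) : K.ConeField) ≠ 0 := fun i h0 => hc i (Subtype.ext h0)
  have hEe : ∀ i, (β.linearForm i (c i) : K.ConeField) =
      e i * (K.x i 0 - algebraMap ℂ K.ConeField (c i) * K.x i 1) := by
    intro i
    change (β.localCoord i 0 : K.ConeField) - algebraMap ℂ K.ConeField (c i) *
      (β.localCoord i 1 : K.ConeField) = _
    rw [he, he]
    ring
  refine ⟨fun i => β.localCoord i 1 / β.linearForm i (c i),
    fun i => K.x i 0 - algebraMap ℂ K.ConeField (c i) * K.x i 1, fun i h0 => hE i ?_, ?_⟩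
  · rw [hEe]
    exact mul_eq_zero_of_right _ h0
  intro i j
  have hd : K.x i 0 - algebraMap ℂ K.ConeField (c i) * K.x i 1 ≠ 0 := fun h0 => hE i (by
    rw [hEe, h0, mul_zero])
  have hY : ((β.localCoord i 1 / β.linearForm i (c i) : K.functionField) : K.ConeField) =
      K.x i 1 / (K.x i 0 - algebraMap ℂ K.ConeField (c i) * K.x i 1) := by
    change (β.localCoord i 1 : K.ConeField) / (β.linearForm i (c i) : K.ConeField) = _
    rw [hEe, he, mul_div_mul_left _ _ (he0 i)]
  fin_cases j
  · change K.x i 0 = (K.x i 0 - algebraMap ℂ K.ConeField (c i) * K.x i 1) *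
      (1 + algebraMap ℂ K.ConeField (c i) *
        ((β.localCoord i 1 / β.linearForm i (c i) : K.functionField) : K.ConeField))
    rw [hY, mul_add, mul_left_comm, mul_div_cancel₀ _ hd]
    ring
  · change K.x i 1 = (K.x i 0 - algebraMap ℂ K.ConeField (c i) * K.x i 1) *
      ((β.localCoord i 1 / β.linearForm i (c i) : K.functionField) : K.ConeField)
    rw [hY, mul_div_cancel₀ _ hd]

end

variable {h : Fin 6 → DualQuat ℝ} {K : ConfigCurve h} {a b : ℂ}

theorem valuation_N {S : ClosedChart h a b K.functionField} {d : Fin 6 → K.ConeField}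
    (hx : ∀ i j, K.x i j = d i * chartCoord S.c (fun i => (S.y i : K.ConeField)) (i, j))
    (β : K.NPoint) {k : Fin 6} (hE : β.ring.valuation (β.linearForm k (S.c k)) = 1) :
    β.ring.valuation (S.N k) = β.ring.valuation (β.linearForm k Complex.I) *
      β.ring.valuation (β.linearForm k (-Complex.I)) := by
  have hI : algebraMap ℂ K.functionField Complex.I * algebraMap ℂ K.functionField Complex.I = -1 := by
    rw [← map_mul, Complex.I_mul_I, map_neg, map_one]
  have h1 : β.linearForm k Complex.I * β.linearForm k (-Complex.I) =
      β.linearForm k (S.c k) * β.linearForm k (S.c k) * S.N k := by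
    have h2 : ∀ z, β.linearForm k z = β.linearForm k (S.c k) * (1 + algebraMap ℂ _ (S.c k) * S.y k) -
        algebraMap ℂ K.functionField z * (β.linearForm k (S.c k) * S.y k) := by
      intro z
      rw [linearForm, β.localCoord_eq_mul hx k 0, β.localCoord_eq_mul hx k 1]
      rfl
    rw [h2 Complex.I, h2 (-Complex.I), map_neg, ClosedChart.N]
    linear_combination -(β.linearForm k (S.c k) * S.y k) ^ 2 * hI
  rw [← map_mul, h1, map_mul, map_mul, hE, one_mul, one_mul]

end ConfigCurve.NPoint

namespace ConfigCurve

variable {h : Fin 6 → DualQuat ℝ} {K : ConfigCurve h} {a b : ℂ}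

theorem NPoint.ring_injective : Function.Injective (NPoint.ring (K := K)) := by
  rintro ⟨R, _, _⟩ ⟨R', _, _⟩ h0
  cases h0
  rfl

namespace NPoint

theorem valuation_linearForm_eq_one (β : K.NPoint) {k : Fin 6} {z : ℂ}
    (hz : ¬ β.ring.valuation (β.linearForm k z) < 1) :
    β.ring.valuation (β.linearForm k z) = 1 :=
  le_antisymm ((β.ring.valuation_le_one_iff _).2 (β.linearForm_mem k z)) (not_lt.1 hz)

theorem valuation_linearForm_neg (β : K.NPoint) {k : Fin 6}
    (ha : a = Complex.I ∨ a = -Complex.I) (hk : β.ring.valuation (β.linearForm k a) < 1) :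
    β.ring.valuation (β.linearForm k (-a)) = 1 := by
  refine β.valuation_linearForm_eq_one fun hlt => ?_
  have h1 : a = 0 := self_eq_neg.1 (β.linearForm_unique hk hlt)
  rcases ha with rfl | rfl
  · exact Complex.I_ne_zero h1
  · exact Complex.I_ne_zero (neg_eq_zero.1 h1)

/-- The orders of vanishing at a bond that connects the joints `0` and `3`, in a chart of the
closed chain whose normalization is admissible at the bond. -/
theorem connectionNumber_eq {S : ClosedChart h a b K.functionField} {d : Fin 6 → K.ConeField}
    (hx : ∀ i j, K.x i j = d i * chartCoord S.c (fun i => (S.y i : K.ConeField)) (i, j))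
    (hO : ∀ x, ∃ n ∈ S.O, ∃ d ∈ S.O, x = n / d) (htr : Algebra.trdeg ℂ K.functionField = 1)
    {β : K.NPoint} (hβ : β ∈ connectingBonds K 0 3 a b)
    (hc : ∀ k, β.ring.valuation (β.linearForm k (S.c k)) = 1) :
    ∃ k : ℕ, β.connectionNumber 0 3 = k ∧ 1 ≤ k ∧ (∀ z ∈ S.O, z ∈ β.ring) ∧
      S.N 3 ∈ β.ring.nonunits ∧
      ∃ s, (∃ y ∈ IsLocalRing.maximalIdeal β.ring ^ (k + s), (y : K.functionField) = S.N 3) ∧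
        ∃ c, ¬ ∃ y ∈ IsLocalRing.maximalIdeal β.ring ^ (s + 1),
          (y : K.functionField) = (S.A 1 * S.A 2 * S.A 3).coords c := by
  obtain ⟨p, ⟨-, hp⟩, hcon, hp0, hp3⟩ := hβ
  have hSR : ∀ z ∈ S.O, z ∈ β.ring := by
    intro z hz
    refine Algebra.adjoin_induction ?_ β.const_mem (fun _ _ _ _ => add_mem)
      (fun _ _ _ _ => mul_mem) hz
    rintro _ ⟨i, rfl⟩
    rw [← β.ring.valuation_le_one_iff]
    have h1 : β.localCoord i 1 = β.linearForm i (S.c i) * S.y i := β.localCoord_eq_mul hx i 1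
    have h2 := (β.ring.valuation_le_one_iff _).2 (β.localCoord_mem i 1)
    rwa [h1, map_mul, hc, one_mul] at h2
  have hN3 : β.ring.valuation (S.N 3) < 1 := by
    have h1 := β.linearForm_of_liesOver hp hp3
    rw [valuation_N hx β (hc 3)]
    have hle := fun z => (β.ring.valuation_le_one_iff _).2 (β.linearForm_mem 3 z)
    rcases S.hb with rfl | rfl
    · exact lt_of_le_of_lt (mul_le_of_le_one_right' (hle _)) h1
    · exact lt_of_le_of_lt (mul_le_of_le_one_left' (hle _)) h1
  obtain ⟨o, m, s, ho, h13, h03, h04, h14, hsm, hm1, hm, hs, hs0⟩ :=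
    S.exists_orders hO htr β.ne_top hSR hN3 hc (β.localCoord_eq_mul hx)
  have hk : β.connectionNumber 0 3 = (m - s : ℕ) := by
    have hv : ∀ i j, β.v i j = o i j := fun i j => (ho i j).symm
    have h1 : β.connectionNumber 0 3 = (β.v 1 3 : ℤ) + β.v 0 4 - β.v 1 4 - β.v 0 3 := rfl
    rw [h1, hv, hv, hv, hv, h13, h03, h04, h14]
    omega
  refine ⟨m - s, hk, ?_, hSR, mem_nonunits_iff_valuation.2 hN3, s, ?_, hs⟩
  · rcases hcon with hcon | hcon
    · have h1 : ∀ k : Fin 6, k ≠ 0 → k ≠ 3 → β.ring.valuation (S.N k) = 1 := by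
        intro k hk0 hk3
        have h2 := fun h3 => (not_or.2 ⟨hk0, hk3⟩) ((hcon k).1 h3)
        rw [valuation_N hx β (hc k),
          β.valuation_linearForm_eq_one fun h3 => h2 (Or.inl (β.eq_affinePt_of_linearForm hp h3)),
          β.valuation_linearForm_eq_one fun h3 => h2 (Or.inr (β.eq_affinePt_of_linearForm hp h3)),
          one_mul]
      rw [hs0 (h1 1 (by decide) (by decide)) (h1 2 (by decide) (by decide))]
      exact hm1
    · rw [hk] at hcon
      omega
  · rwa [Nat.sub_add_cancel hsm]

end NPoint

open Classical in
theorem sum_connectionNumber_le_two (hL : IsLinkage h)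
    (h123 : couplingDim [h 0, h 1, h 2] = 8) (h456 : couplingDim [h 3, h 4, h 5] = 8)
    (ha : a = Complex.I ∨ a = -Complex.I) (hb : b = Complex.I ∨ b = -Complex.I)
    (T : Finset K.NPoint) (hT : ∀ β ∈ T, β ∈ connectingBonds K 0 3 a b) :
    (∀ β ∈ T, 1 ≤ β.connectionNumber 0 3) ∧ ∑ β ∈ T, β.connectionNumber 0 3 ≤ 2 := by
  rcases T.eq_empty_or_nonempty with rfl | ⟨β₀, hβ₀⟩
  · simp
  choose c' hc' using NPoint.exists_normalization T
  let c : Fin 6 → ℂ := fun i => if i = 0 then -a else if i = 3 then -b else c' i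
  have hc : ∀ β ∈ T, ∀ i, β.ring.valuation (β.linearForm i (c i)) = 1 := by
    intro β hβ i
    obtain ⟨p, ⟨-, hp⟩, -, hp0, hp3⟩ := hT β hβ
    by_cases hi0 : i = 0
    · rw [hi0]
      exact β.valuation_linearForm_neg ha (β.linearForm_of_liesOver hp hp0)
    by_cases hi3 : i = 3
    · rw [hi3]
      exact β.valuation_linearForm_neg hb (β.linearForm_of_liesOver hp hp3)
    have h1 : c i = c' i := by simp only [c, if_neg hi0, if_neg hi3]
    rw [h1]
    exact hc' i β hβ
  obtain ⟨Y, d, hd, hx⟩ := β₀.exists_normalized_coordinates (c := c) fun i h0 => by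
    have h1 := hc β₀ hβ₀ i
    rw [h0, map_zero] at h1
    exact zero_ne_one h1
  obtain ⟨r, hr, hclosed⟩ := exists_closed K hd hx
  let S : ClosedChart h a b K.functionField :=
    ⟨hL, h123, h456, ha, hb, c, rfl, rfl, Y, r, hr, hclosed⟩
  have hO : ∀ x, ∃ n ∈ S.O, ∃ d ∈ S.O, x = n / d := exists_eq_div K hx
  have htr := trdeg_functionField K hd hx β₀
  have key := fun β (hβ : β ∈ T) =>
    NPoint.connectionNumber_eq (S := S) hx hO htr (hT β hβ) (hc β hβ)
  refine ⟨fun β hβ => ?_, ?_⟩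
  · obtain ⟨k, hk, hk1, -⟩ := key β hβ
    rw [hk]
    exact_mod_cast hk1
  let k : ValuationSubring K.functionField → ℕ :=
    Function.extend NPoint.ring (fun β => (β.connectionNumber 0 3).toNat) 0
  have hk : ∀ β : K.NPoint, k β.ring = (β.connectionNumber 0 3).toNat :=
    fun β => NPoint.ring_injective.extend_apply _ _ β
  have h2 := S.sum_le_two hO htr (T.image NPoint.ring) k (by
      simp only [Finset.forall_mem_image]
      intro β hβ
      obtain ⟨k, -, -, h3, h4, -⟩ := key β hβ
      exact ⟨β.ne_top, h3, h4⟩) (by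
      simp only [Finset.forall_mem_image]
      intro β hβ
      obtain ⟨k', hk', -, -, -, h3⟩ := key β hβ
      rw [hk, hk']
      exact h3)
  rw [Finset.sum_image fun _ _ _ _ h0 => NPoint.ring_injective h0] at h2
  have h3 : ∑ β ∈ T, β.connectionNumber 0 3 = ((∑ β ∈ T, k β.ring : ℕ) : ℤ) := by
    rw [Nat.cast_sum]
    refine Finset.sum_congr rfl fun β hβ => ?_
    obtain ⟨k', hk', -⟩ := key β hβ
    rw [hk, hk']
    rfl
  rw [h3]
  exact_mod_cast h2

theorem finsum_connectionNumber_le_two (hL : IsLinkage h)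
    (h123 : couplingDim [h 0, h 1, h 2] = 8) (h456 : couplingDim [h 3, h 4, h 5] = 8)
    (ha : a = Complex.I ∨ a = -Complex.I) (hb : b = Complex.I ∨ b = -Complex.I) :
    (connectingBonds K 0 3 a b).Finite ∧
    (∀ β ∈ connectingBonds K 0 3 a b, 1 ≤ β.connectionNumber 0 3) ∧
    ∑ᶠ β ∈ connectingBonds K 0 3 a b, β.connectionNumber 0 3 ≤ 2 := by
  have key := fun T : Finset K.NPoint =>
    sum_connectionNumber_le_two hL h123 h456 ha hb T
  have hfin : (connectingBonds K 0 3 a b).Finite := by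
    by_contra hinf
    obtain ⟨T, hT, hcard⟩ := Set.Infinite.exists_subset_card_eq hinf 3
    obtain ⟨h1, h2⟩ := key T fun β hβ => hT hβ
    have h3 := Finset.card_nsmul_le_sum T _ _ h1
    rw [hcard] at h3
    simp only [nsmul_eq_mul] at h3
    push_cast at h3
    omega
  refine ⟨hfin, fun β hβ => (key {β} ?_).1 β (Finset.mem_singleton_self β), ?_⟩
  · intro β' hβ'
    rwa [Finset.mem_singleton.1 hβ']
  · rw [finsum_mem_eq_finite_toFinset_sum _ hfin]
    exact (key hfin.toFinset fun β hβ => hfin.mem_toFinset.1 hβ).2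

end ConfigCurve

end Linkage

end

theorem mainTheorem10 (h : Fin 6 → Linkage.DualQuat ℝ) (hL : Linkage.IsLinkage h)
    (hmob : Linkage.mobility h = 1)
    (K : Linkage.ConfigCurve h) (hK : ∀ K' : Linkage.ConfigCurve h, K' = K)
    (h123 : Linkage.couplingDim [h 0, h 1, h 2] = 8)
    (h456 : Linkage.couplingDim [h 3, h 4, h 5] = 8)
    (a b : ℂ) (ha : a = Complex.I ∨ a = -Complex.I) (hb : b = Complex.I ∨ b = -Complex.I) :
    (Linkage.connectingBonds K 0 3 a b).Finite ∧
    (∀ β ∈ Linkage.connectingBonds K 0 3 a b, 1 ≤ β.connectionNumber 0 3) ∧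
    ∑ᶠ β ∈ Linkage.connectingBonds K 0 3 a b, β.connectionNumber 0 3 ≤ 2 := by
  exact Linkage.ConfigCurve.finsum_connectionNumber_le_two hL h123 h456 ha hb
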